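/- \textbf{Theorem 2.} Consider a two-sided market with $n$ buyers and $m$ sellers, seller $j$ owning item $j$. Buyer $i$ has an additive valuation with values $v_{ij}\ge 0$ for the items, and seller $j$ has value $s_j\ge 0$ for her item. All values are independent, $v_{ij}\sim D^B_{ij}$ and $s_j\sim D^S_j$, and each $D^B_{ij}$ has finite mean. Valuation spaces are the supports. A mechanism consists of allocation probabilities $x^B_{ij},x^S_j\in[0,1]$ and payments $p^B_i,p^S_j\ge 0$ (measurable functions of the reports) with $\sum_i x^B_{ij}\le x^S_j$; its expected profit is $\mathbb E[\sum_i p^B_i-\sum_j p^S_j]$. Let $\mathrm{OPT}$ be the supremum of the expected profits of all mechanisms that are dominant-strategy incentive-compatible (DSIC) and individually rational (IR) over the valuation spaces and have integrable profit. Define the following mechanisms for production-cost markets with cost $c_j\in[0,\infty]$ of item $j$ (an item of cost $\infty$ is never sold); ties between buyers are broken by index. \begin{itemize} \item $\mathcal M_{IT}$: for each item $j$ separately, the buyer with the highest ironed virtual value $\phi_{ij}(v_{ij})$ gets $j$ if this virtual value is at least $c_j$, and pays the lowest value in the support of $D^B_{ij}$ with which she would still get it. \item $\mathcal M_{BVCG}$: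 let $\beta_{ij}=\max\{\max_{i'\ne i}v_{i'j},c_j\}$ (a maximum over the empty set being $0$) and let $e_i$ be the largest median of $\sum_j(t_{ij}-\beta_{ij})^+$ for $t_i\sim\prod_j D^B_{ij}$. If $\sum_j(v_{ij}-\beta_{ij})^+\ge e_i$, then buyer $i$ pays $e_i$, gets each item $j$ for which she is the highest bidder and $v_{ij}\ge\beta_{ij}$, and pays $\beta_{ij}$ for each of them; otherwise she gets nothing and pays $0$. \item $\mathcal M_A$: run $\mathcal M_{IT}$ with probability $3/4$ and $\mathcal M_{BVCG}$ with probability $1/4$. \end{itemize} Let $\mathcal M$ be the two-sided mechanism that runs $\mathcal M_A$ on the reported buyer values with costs $c_j=\phi^S_j(s_j)$, the ironed virtual values of the sellers ($\phi^S_j(s)=s+F^S_j(s)/f^S_j(s)$ in the regular case with a density), buys exactly the items that are sold, and makes threshold payments to the sellers: with $x_j$ the probability that item $j$ is sold, seller $j$ receives the expectation, over $u$ uniform in $[0,1]$, of $\mathbb 1[u\le x_j]$ times the highest report in the support of $D^S_j$ at which the probability that $j$ is sold is still at least $u$. Then $\mathcal M_{IT}$, $\mathcal M_{BVCG}$ and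 $\mathcal M_A$ are cost-monotone (when the cost of item $j$ alone increases, the probability that $j$ is sold does not increase, at every buyer profile in the supports). The mechanism $\mathcal M$ is feasible, DSIC and IR and has integrable profit, and its expected profit is at least $\frac18\,\mathrm{OPT}$. -/

import Mathlib

open MeasureTheory Set
open scoped ENNReal

namespace Broker

/-- A two-sided market with `n` buyers with additive valuations and `m` sellers, seller `j` owning
item `j`.  `DB i j` is the distribution of buyer `i`'s value for item `j`, and `DS j` the
distribution of seller `j`'s value for her item.  All these values are independent and
nonnegative. -/
structure Market (n m : ℕ) where
  DB : Fin n → Fin m → Measure ℝ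
  DS : Fin m → Measure ℝ
  probB : ∀ i j, IsProbabilityMeasure (DB i j)
  probS : ∀ j, IsProbabilityMeasure (DS j)
  nonnegB : ∀ i j, DB i j (Iio 0) = 0
  nonnegS : ∀ j, DS j (Iio 0) = 0

/-- A valuation profile of the buyers: `v i j` is the value of buyer `i` for item `j`. -/
abbrev BProfile (n m : ℕ) := Fin n → Fin m → ℝ

/-- A valuation profile of the sellers. -/
abbrev SProfile (m : ℕ) := Fin m → ℝ

namespace Market

variable {n m : ℕ} (I : Market n m)

/-- Valuation space of buyer `i`: the support of `D_i`, the product of the supports of the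
`DB i j`. -/
def TBi (i : Fin n) : Set (Fin m → ℝ) := {w | ∀ j, w j ∈ (I.DB i j).support}

/-- Valuation profiles of the buyers. -/
def TB : Set (BProfile n m) := {v | ∀ i, v i ∈ I.TBi i}

/-- Valuation profiles of the sellers. -/
def TS : Set (SProfile m) := {s | ∀ j, s j ∈ (I.DS j).support}

/-- Joint distribution of the buyers' values. -/
noncomputable def distB : Measure (BProfile n m) :=
  Measure.pi fun i => Measure.pi fun j => I.DB i j

/-- Joint distribution of the sellers' values. -/
noncomputable def distS : Measure (SProfile m) := Measure.pi fun j => I.DS j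

/-- Joint distribution of all values. -/
noncomputable def dist : Measure (BProfile n m × SProfile m) := I.distB.prod I.distS

end Market

/-! ### Mechanisms for two-sided markets -/

/-- A (direct, randomized) mechanism for two-sided markets with additive buyers.
`xB v s i j` is the probability that buyer `i` gets item `j`, `xS v s j` the probability that
seller `j`'s item is bought from her, `pB v s i` the (expected) payment of buyer `i` and
`pS v s j` the (expected) payment to seller `j`, at the reports `(v, s)`. -/
structure Mechanism (n m : ℕ) where
  xB : BProfile n m → SProfile m → Fin n → Fin m → ℝ
  xS : BProfile n m → SProfile m → Fin m → ℝ
  pB : BProfile n m → SProfile m → Fin n → ℝ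
  pS : BProfile n m → SProfile m → Fin m → ℝ

namespace Mechanism

variable {n m : ℕ} (I : Market n m) (M : Mechanism n m)

/-- All components are measurable, allocations are probabilities, payments are nonnegative. -/
structure WellFormed : Prop where
  meas_xB : ∀ i j, Measurable fun w : BProfile n m × SProfile m => M.xB w.1 w.2 i j
  meas_xS : ∀ j, Measurable fun w : BProfile n m × SProfile m => M.xS w.1 w.2 j
  meas_pB : ∀ i, Measurable fun w : BProfile n m × SProfile m => M.pB w.1 w.2 i
  meas_pS : ∀ j, Measurable fun w : BProfile n m × SProfile m => M.pS w.1 w.2 j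
  xB_mem : ∀ v ∈ I.TB, ∀ s ∈ I.TS, ∀ i j, M.xB v s i j ∈ Icc (0 : ℝ) 1
  xS_mem : ∀ v ∈ I.TB, ∀ s ∈ I.TS, ∀ j, M.xS v s j ∈ Icc (0 : ℝ) 1
  pB_nonneg : ∀ v ∈ I.TB, ∀ s ∈ I.TS, ∀ i, 0 ≤ M.pB v s i
  pS_nonneg : ∀ v ∈ I.TB, ∀ s ∈ I.TS, ∀ j, 0 ≤ M.pS v s j

/-- No item is sold with a larger probability than it is bought. -/
def Feasible : Prop :=
  ∀ v ∈ I.TB, ∀ s ∈ I.TS, ∀ j, ∑ i, M.xB v s i j ≤ M.xS v s j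

/-- Utility of buyer `i` with true valuation `w` at the reports `(v, s)`. -/
def utilityB (i : Fin n) (w : Fin m → ℝ) (v : BProfile n m) (s : SProfile m) : ℝ :=
  ∑ j, M.xB v s i j * w j - M.pB v s i

/-- Utility of seller `j` with true value `w` at the reports `(v, s)`. -/
def utilityS (j : Fin m) (w : ℝ) (v : BProfile n m) (s : SProfile m) : ℝ :=
  M.pS v s j - w * M.xS v s j

/-- Dominant-strategy incentive compatibility. -/
structure DSIC : Prop where
  buyer : ∀ v ∈ I.TB, ∀ s ∈ I.TS, ∀ i, ∀ w' ∈ I.TBi i,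
    M.utilityB i (v i) (Function.update v i w') s ≤ M.utilityB i (v i) v s
  seller : ∀ v ∈ I.TB, ∀ s ∈ I.TS, ∀ j, ∀ w' ∈ (I.DS j).support,
    M.utilityS j (s j) v (Function.update s j w') ≤ M.utilityS j (s j) v s

/-- Individual rationality. -/
structure IR : Prop where
  buyer : ∀ v ∈ I.TB, ∀ s ∈ I.TS, ∀ i, 0 ≤ M.utilityB i (v i) v s
  seller : ∀ v ∈ I.TB, ∀ s ∈ I.TS, ∀ j, 0 ≤ M.utilityS j (s j) v s

/-- The broker's profit at the reports `w = (v, s)`. -/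
def profit (w : BProfile n m × SProfile m) : ℝ :=
  ∑ i, M.pB w.1 w.2 i - ∑ j, M.pS w.1 w.2 j

/-- The broker's expected profit. -/
noncomputable def PFT : ℝ := ∫ w, M.profit w ∂I.dist

/-- The mechanisms the broker may use: feasible, DSIC and IR, with a well-defined finite expected
profit. -/
structure Admissible : Prop where
  wellFormed : M.WellFormed I
  feasible : M.Feasible I
  dsic : M.DSIC I
  ir : M.IR I
  integrable : Integrable M.profit I.dist

end Mechanism

/-- The optimal profit of a DSIC mechanism. -/
noncomputable def OPT {n m : ℕ} (I : Market n m) : EReal :=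
  ⨆ (M : Mechanism n m) (_ : M.Admissible I), ((M.PFT I : ℝ) : EReal)

/-! ### Ironed virtual values

For a seller with distribution function `F`, posting the price `b` buys with probability `F b` at
expected cost `b * F b`.  The ironed virtual value at `v` is the slope, at the quantile of `v`, of
the greatest convex minorant of the curve `{(F b, b * F b)}`.  The slope between the points of the
prices `a < b` is `(b * F b - a * F a) / (F b - F a) = b + (b - a) * F a / (F b - F a)`, and the
slope of the minorant is the supremum over `a < v` of the infimum over `b ≥ v` of these.  If `F` has
a density `f` and `v + F v / f v` is nondecreasing (the regular case), this is `v + F v / f v`.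
In `ℝ≥0∞` one has `x / 0 = ∞` for `x ≠ 0`, a vertical slope, and `0 / 0 = 0`.

For a buyer everything is mirrored: posting the price `b` sells with probability
`S b = P(value ≥ b)` for the expected revenue `b * S b`, one takes the slope of the least concave
majorant of the curve `{(S b, b * S b)}`, and the regular case is `v - (1 - F v) / f v`. -/

/-- Ironed virtual value `φ^S` of a seller with value distribution `μ`. -/
noncomputable def sellerVirtual (μ : Measure ℝ) (v : ℝ) : ℝ≥0∞ :=
  ⨆ (a : ℝ) (_ : a < v), ⨅ (b : ℝ) (_ : v ≤ b),
    (ENNReal.ofReal b + ENNReal.ofReal (b - a) * μ (Iic a) / μ (Ioc a b))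

/-- Ironed virtual value of a buyer with value distribution `μ` (for one item). -/
noncomputable def buyerVirtual (μ : Measure ℝ) (v : ℝ) : EReal :=
  ⨅ (a : ℝ) (_ : v < a), ⨆ (b : ℝ) (_ : b ≤ v),
    ((b : EReal) - ((ENNReal.ofReal (a - b) * μ (Ici a) / μ (Ico b a) : ℝ≥0∞) : EReal))

/-! ### Mechanisms for production-cost markets -/

/-- Vectors of production costs.  Cost `∞` means that the item cannot be produced. -/
abbrev Costs (m : ℕ) := Fin m → ℝ≥0∞

/-- A mechanism for production-cost markets (the buyers' prior being fixed): for a cost vector `c`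
and a profile `v`, `x c v i j` is the probability that buyer `i` gets item `j` and `p c v i` is the
payment of buyer `i`. -/
structure CostMechanism (n m : ℕ) where
  x : Costs m → BProfile n m → Fin n → Fin m → ℝ
  p : Costs m → BProfile n m → Fin n → ℝ

namespace CostMechanism

variable {n m : ℕ}

/-- Probability that item `j` is sold. -/
def sold (M : CostMechanism n m) (c : Costs m) (v : BProfile n m) (j : Fin m) : ℝ :=
  ∑ i, M.x c v i j

/-- Cost-monotonicity: if the cost of item `j` alone increases, the probability that `j` is sold
does not increase. -/
def CostMonotone (I : Market n m) (M : CostMechanism n m) : Prop :=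
  ∀ (c c' : Costs m) (j : Fin m), c j ≤ c' j → (∀ k, k ≠ j → c k = c' k) →
    ∀ v ∈ I.TB, M.sold c' v j ≤ M.sold c v j

/-- Run `M₁` with probability `q` and `M₂` with probability `1 - q`. -/
noncomputable def mix (q : ℝ) (M₁ M₂ : CostMechanism n m) : CostMechanism n m where
  x c v i j := q * M₁.x c v i j + (1 - q) * M₂.x c v i j
  p c v i := q * M₁.p c v i + (1 - q) * M₂.p c v i

end CostMechanism

/-- `i` is the first index at which `w` is maximal (ties are broken by index). -/
def IsFirstMax {n : ℕ} {α : Type*} [LinearOrder α] (w : Fin n → α) (i : Fin n) : Prop :=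
  (∀ k, w k ≤ w i) ∧ ∀ k, k < i → w k < w i

section MechanismsForCosts

variable {n m : ℕ} (I : Market n m)

/-- In the item-wise mechanism, buyer `i` gets item `j` if her virtual value for `j` is the highest
one and is at least the cost of `j`. -/
def ITWins (c : Costs m) (v : BProfile n m) (i : Fin n) (j : Fin m) : Prop :=
  IsFirstMax (fun k => buyerVirtual (I.DB k j) (v k j)) i ∧
    (c j : EReal) ≤ buyerVirtual (I.DB i j) (v i j)

/-- The threshold price of buyer `i` for item `j`: the lowest value in her valuation space at which
she still gets it. -/
noncomputable def ITPrice (c : Costs m) (v : BProfile n m) (i : Fin n) (j : Fin m) : ℝ :=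
  sInf {z | z ∈ (I.DB i j).support ∧
    ITWins I c (Function.update v i (Function.update (v i) j z)) i j}

open Classical in
/-- `M_IT`: each item is sold separately by a second-price auction on the ironed virtual values,
with the cost of the item as reserve. -/
noncomputable def MIT : CostMechanism n m where
  x c v i j := if ITWins I c v i j then 1 else 0
  p c v i := ∑ j, if ITWins I c v i j then ITPrice I c v i j else 0

/-- The reserve `β_ij(v_{-i}) = max (max_{i' ≠ i} v_{i'j}) c_j`. -/
noncomputable def reserve (c : Costs m) (v : BProfile n m) (i : Fin n) (j : Fin m) : ℝ≥0∞ :=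
  max (⨆ (k : Fin n) (_ : k ≠ i), ENNReal.ofReal (v k j)) (c j)

/-- The surplus `∑ j, (t j - β j)⁺`. -/
noncomputable def surplus (β : Fin m → ℝ≥0∞) (t : Fin m → ℝ) : ℝ :=
  ∑ j, (ENNReal.ofReal (t j) - β j).toReal

/-- The entry fee of buyer `i`: the (largest) median of her surplus `∑ j, (t j - β_ij(v_{-i}))⁺`,
with `t` drawn from `D_i`. -/
noncomputable def entryFee (c : Costs m) (v : BProfile n m) (i : Fin n) : ℝ :=
  sSup {e : ℝ | 1 / 2 ≤
    (Measure.pi fun j => I.DB i j) {t : Fin m → ℝ | e ≤ surplus (reserve c v i) t}}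

/-- Buyer `i` accepts her entry fee. -/
def Accepts (c : Costs m) (v : BProfile n m) (i : Fin n) : Prop :=
  entryFee I c v i ≤ surplus (reserve c v i) (v i)

/-- Buyer `i` gets item `j` in the bundling VCG mechanism: she accepts her entry fee and her value
is at least her reserve; if several buyers tie for the highest value, the first one gets the
item. -/
def BVCGWins (c : Costs m) (v : BProfile n m) (i : Fin n) (j : Fin m) : Prop :=
  Accepts I c v i ∧ IsFirstMax (fun k => v k j) i ∧ reserve c v i j ≤ ENNReal.ofReal (v i j)

open Classical in
/-- `M_BVCG`: VCG with per-item reserves and per-buyer entry fees. -/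
noncomputable def MBVCG : CostMechanism n m where
  x c v i j := if BVCGWins I c v i j then 1 else 0
  p c v i := if Accepts I c v i then
      entryFee I c v i + ∑ j, if BVCGWins I c v i j then (reserve c v i j).toReal else 0
    else 0

/-- `M_A`: run `M_IT` with probability `3/4` and `M_BVCG` with probability `1/4`. -/
noncomputable def MA : CostMechanism n m := CostMechanism.mix (3 / 4) (MIT I) (MBVCG I)

end MechanismsForCosts

/-! ### The reduction -/

/-- The two-sided mechanism obtained from a production-cost mechanism: run it with the sellers'
virtual values as costs, buy exactly the items that are sold, and make threshold payments to the
sellers.  Item `j` is bought if `u ≤ x_j`, for `u` uniform in `[0, 1]` and `x_j` the probability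
that `j` is sold; for a given `u`, the threshold payment is the highest value in the valuation space
of seller `j` at which her item is still bought. -/
noncomputable def reduction {n m : ℕ} (I : Market n m) (M : CostMechanism n m) :
    Mechanism n m where
  xB v s := M.x (fun k => sellerVirtual (I.DS k) (s k)) v
  xS v s := M.sold (fun k => sellerVirtual (I.DS k) (s k)) v
  pB v s := M.p (fun k => sellerVirtual (I.DS k) (s k)) v
  pS v s j := ∫ u in (0 : ℝ)..M.sold (fun k => sellerVirtual (I.DS k) (s k)) v j,
    sSup {z | z ∈ (I.DS j).support ∧
      u ≤ M.sold (fun k => sellerVirtual (I.DS k) (Function.update s j z k)) v j}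

end Broker

/-! Take the sellers' ironed virtual values as costs c. Everything is measured against two numbers:
the expected virtual surplus K, which is the sum over items of E[max_i (φ_ij⁺ - c_j)⁺], and the
expected total E of the entry fees accepted in `MBVCG`. Every admissible mechanism has revenue at
most its payments to the sellers plus 5K + 2E (`lintegral_sum_pB_le`), while four times the profit
of the reduction is at least 3K + E (`le_lintegral_sum_reduction_pB`). Since 5K + 2E ≤ 2(3K + E),
the factor is 8.

Ironing. For arbitrary distributions, atoms included, E(r - φ^S)⁺ is the best resale profit max_b (r
- b)F(b), and E(φ⁺ - r)⁺ is the best posted-price profit max_b (b - r)S(b)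
(`lintegral_sub_sellerVirtual`, `lintegral_posVirtual_sub`): as functions of r the two sides have a
common subgradient, the probability of the level set, and agree at 0 or at infinity. A monotone
randomized allocation is a mixture over quantiles u of posted prices, so these identities compare
payments with virtual values: incentive-compatible sellers are paid at least their virtual values,
incentive-compatible buyers pay at most theirs, and the reverse inequalities hold for threshold
prices when the allocation depends on the value only through the virtual value.

Upper bound. Payments to the sellers absorb the costs of the items bought. The utility of a buyer is
charged to her favorite item, the one with the largest excess over its reserve β_ij; with her other
values fixed, the favorite item is then sold by a single-parameter mechanism on an upward closed set
and brings at most its virtual value. Any other item brings at most its value, hence at most its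
cost plus what a second-price auction collects plus its excess. The second-price part is at most K
in expectation. The excess is bounded by a core-tail decomposition: large non-favorite excesses are
rare, and the sum of the truncated ones concentrates by Chebyshev, so its mean is controlled by the
median, which is the entry fee. This costs 3 Σ_j E(φ_ij⁺ - β_ij)⁺ plus the fee; the fee is accepted
with probability at least 1/2, and since only a highest bidder can exceed her reserve, the first
terms of all buyers together are at most 3K. The total is (1 + 1 + 3)K + 2E.

Lower bound. `MIT` collects K plus the costs of what it sells, `MBVCG` collects E plus the costs of
what it sells, and threshold payments to the sellers do not exceed these costs in expectation. The
threshold payments are truthful because the allocation is cost-monotone; for `MBVCG` the reason is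
that lowering a winner's reserve by δ raises her surplus by δ and her median by at most δ. -/

namespace Broker
open Filter Topology

/-! ### Real-variable lemmas -/

/-- If the decrements of `F` are controlled by products of increments, `F` does not decrease. -/
theorem le_of_sub_le_mul_sub {F G : ℝ → ℝ} {a b : ℝ} (hab : a ≤ b)
    (h : ∀ x y, a ≤ x → x ≤ y → y ≤ b → F x - F y ≤ (y - x) * (G y - G x)) : F a ≤ F b := by
  -- Cut `[a, b]` into `N` equal pieces: the errors telescope to `(b - a) * (G b - G a) / N`, which
  -- vanishes in the limit.
  have key : ∀ N : ℕ, 0 < N → F a - F b ≤ (b - a) * (G b - G a) / N := by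
    intro N hN
    have hN' : (0 : ℝ) < N := by exact_mod_cast hN
    set d : ℝ := (b - a) / N with hd
    have hd0 : 0 ≤ d := div_nonneg (by linarith) hN'.le
    have hNd : N * d = b - a := by rw [hd]; field_simp
    have step : ∀ k : ℕ, k ≤ N → F a - F (a + k * d) ≤ d * (G (a + k * d) - G a) := by
      intro k
      induction k with
      | zero => intro _; simp
      | succ k ih =>
        intro hk
        have h1 := ih (by omega)
        have hk' : ((k : ℝ) + 1) * d ≤ N * d :=
          mul_le_mul_of_nonneg_right (by exact_mod_cast hk) hd0
        have h2 := h (a + k * d) (a + (k + 1) * d)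
          (by have : (0 : ℝ) ≤ k * d := by positivity
              linarith) (by linarith) (by linarith)
        have : (a + (k + 1) * d - (a + k * d)) = d := by ring
        rw [this] at h2
        push_cast
        linarith
    have := step N le_rfl
    rw [hNd] at this
    have e : a + (b - a) = b := by ring
    rw [e] at this
    calc F a - F b ≤ d * (G b - G a) := this
      _ = _ := by rw [hd]; ring
  have lim : Tendsto (fun N : ℕ => (b - a) * (G b - G a) / N) atTop (𝓝 0) :=
    tendsto_const_div_atTop_nhds_zero_nat _
  have := ge_of_tendsto lim (eventually_atTop.2 ⟨1, fun N hN => key N hN⟩)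
  linarith

/-- The payment of an incentive-compatible single-parameter menu with nonnegative utilities
`p z - z * x z` is at least the integral of the thresholds. -/
theorem intervalIntegral_le_payment {K : Set ℝ} {x p g : ℝ → ℝ} {s : ℝ} (hs : s ∈ K)
    (hx : 0 ≤ x s)
    (ic : ∀ z ∈ K, ∀ z' ∈ K, p z' - z * x z' ≤ p z - z * x z)
    (ir : ∀ z ∈ K, 0 ≤ p z - z * x z)
    (hg : AntitoneOn g (Icc 0 (x s)))
    (hgT : ∀ u ∈ Ioc 0 (x s), ∀ r < g u, ∃ z ∈ K, u ≤ x z ∧ r ≤ z) :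
    ∫ u in (0 : ℝ)..x s, g u ≤ p s := by
  have hne : Nonempty K := ⟨⟨s, hs⟩⟩
  -- `p z + z * (u - x z)` is the payment for the quantity `u` that leaves type `z` indifferent to
  -- her own choice. The infimum `P` starts at a nonnegative value, is at most `p s` at `x s`, and
  -- grows at least at the rate `g`.
  set P : ℝ → ℝ := fun u => ⨅ z : K, (p z + z * (u - x z)) with hP
  have bdd : ∀ u ∈ Icc 0 (x s), BddBelow (range fun z : K => p z + z * (u - x z)) := by
    intro u hu
    refine ⟨min 0 (p s), ?_⟩
    rintro _ ⟨⟨z, hz⟩, rfl⟩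
    have h1 := ir z hz
    have h2 := ic z hz s hs
    simp only
    -- Negative types occur because the buyers' case is obtained by reflection. For them the bound
    -- comes from incentive compatibility against `s` instead of individual rationality.
    rcases le_total 0 z with h0 | h0
    · exact (min_le_left _ _).trans (by nlinarith [mul_nonneg h0 hu.1])
    · exact (min_le_right _ _).trans (by nlinarith [mul_nonneg_of_nonpos_of_nonpos h0 (sub_nonpos.2 hu.2)])
  have P0 : 0 ≤ P 0 := by
    refine le_ciInf ?_
    rintro ⟨z, hz⟩
    have := ir z hz
    simp only
    linarith
  have Ps : P (x s) ≤ p s := by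
    have := ciInf_le (bdd (x s) ⟨hx, le_rfl⟩) ⟨s, hs⟩
    simpa using this
  have incr : ∀ u u', 0 ≤ u → u ≤ u' → u' ≤ x s → (u' - u) * g u' ≤ P u' - P u := by
    intro u u' h0 huu hu'
    rcases eq_or_lt_of_le huu with h | h
    · subst h; simp
    · have hgr : ∀ r < g u', (u' - u) * r ≤ P u' - P u := by
        intro r hr
        obtain ⟨z, hz, hzu, hrz⟩ := hgT u' ⟨by linarith, hu'⟩ r hr
        -- A type `y ≥ z` contributes an affine function of slope at least `z`. A type `y ≤ z` does
        -- not prefer the choice of `z`, and `u' ≤ x z`, so her function at `u'` lies above that of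
        -- `z`.
        suffices P u + (u' - u) * z ≤ P u' by nlinarith
        refine le_ciInf ?_
        rintro ⟨y, hy⟩
        simp only
        rcases le_total z y with hzy | hyz
        · have := ciInf_le (bdd u ⟨h0, by linarith⟩) ⟨y, hy⟩
          change P u ≤ _ at this
          nlinarith
        · have := ciInf_le (bdd u ⟨h0, by linarith⟩) ⟨z, hz⟩
          change P u ≤ _ at this
          have h2 := ic y hy z hz
          nlinarith [mul_nonneg (sub_nonneg.2 hzu) (sub_nonneg.2 hyz)]
      have hpos : 0 < u' - u := by linarith
      by_contra hcon
      push Not at hcon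
      have h3 : (P u' - P u) / (u' - u) < g u' := by
        rw [div_lt_iff₀ hpos]; linarith
      obtain ⟨r, hr1, hr2⟩ := exists_between h3
      have := hgr r hr2
      rw [div_lt_iff₀ hpos] at hr1
      linarith
  have hint : ∀ u u', 0 ≤ u → u ≤ u' → u' ≤ x s → IntervalIntegrable g volume u u' := by
    intro u u' h0 h h'
    refine AntitoneOn.intervalIntegrable ?_
    rw [uIcc_of_le h]
    exact hg.mono (Icc_subset_Icc h0 h')
  -- Over `[u, u']` the function `P` gains at least `(u' - u) * g u'` and the integral at most `(u'
  -- - u) * g u`; the discrepancy is of the product form that sums to zero.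
  have main := le_of_sub_le_mul_sub (F := fun u => P u - ∫ t in (0 : ℝ)..u, g t)
    (G := fun u => - g u) hx (by
      intro u u' h0 huu hu'
      have h1 := incr u u' h0 huu hu'
      have h2 : (∫ t in (0 : ℝ)..u', g t) = (∫ t in (0 : ℝ)..u, g t) + ∫ t in u..u', g t :=
        (intervalIntegral.integral_add_adjacent_intervals (hint 0 u le_rfl h0 (by linarith))
          (hint u u' h0 huu hu')).symm
      have h3 : (∫ t in u..u', g t) ≤ (u' - u) * g u := by
        calc (∫ t in u..u', g t) ≤ ∫ t in u..u', g u := by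
              refine intervalIntegral.integral_mono_on huu (hint u u' h0 huu hu') (by simp) ?_
              intro t ht
              exact hg ⟨h0, by linarith⟩ ⟨h0.trans ht.1, ht.2.trans hu'⟩ ht.1
          _ = _ := by simp
      rw [h2]
      nlinarith)
  simp only [intervalIntegral.integral_same] at main
  linarith

/-- Existence of a greatest maximizer of the resale profit `(r - b) * F b`. -/
theorem exists_greatest_maximizer {F : ℝ → ℝ} (hF : Monotone F) (hF0 : ∀ b, 0 ≤ F b)
    (hFc : ∀ b, ContinuousWithinAt F (Ici b) b) {r b₀ B : ℝ} (hb₀ : 0 < (r - b₀) * F b₀)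
    (hB : ∀ b < B, (r - b) * F b ≤ (r - b₀) * F b₀) :
    ∃ m, m < r ∧ 0 < F m ∧ (∀ b, (r - b) * F b ≤ (r - m) * F m) ∧
      ∀ z, m < z → ∃ δ > 0, ∀ b, z ≤ b → (r - b) * F b + δ ≤ (r - m) * F m := by
  set H : ℝ → ℝ := fun b => max (r - b) 0 * F b with hH
  have hHle : ∀ b, (r - b) * F b ≤ H b := fun b =>
    mul_le_mul_of_nonneg_right (le_max_left _ _) (hF0 b)
  have hHeq : ∀ b, b ≤ r → H b = (r - b) * F b := fun b hb => by
    simp only [hH]; rw [max_eq_left (by linarith)]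
  have hH0 : ∀ b, r ≤ b → H b = 0 := fun b hb => by
    simp only [hH]; rw [max_eq_right (by linarith), zero_mul]
  have husc : UpperSemicontinuous H := by
    intro b y hy
    -- A monotone right-continuous `F` is upper semicontinuous: near `b` it is bounded by `F (max b'
    -- b)`, which is continuous at `b`.
    have hc : ContinuousAt (fun b' => max (r - b') 0 * F (max b' b)) b := by
      refine ContinuousAt.mul (by fun_prop) ?_
      have h1 : Tendsto (fun b' => max b' b) (𝓝 b) (𝓝[Ici b] b) := by
        refine tendsto_nhdsWithin_iff.2 ⟨?_, Eventually.of_forall fun _ => mem_Ici.2 (le_max_right _ _)⟩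
        have : ContinuousAt (fun b' : ℝ => max b' b) b := by fun_prop
        simpa [ContinuousAt] using this
      have h2 := (hFc b).tendsto.comp h1
      simpa [ContinuousAt, Function.comp_def] using h2
    have hy' : max (r - b) 0 * F (max b b) < y := by simpa [hH] using hy
    filter_upwards [hc.eventually_lt_const hy'] with b' hb'
    refine lt_of_le_of_lt ?_ hb'
    exact mul_le_mul_of_nonneg_left (hF (le_max_left _ _)) (le_max_right _ _)
  have hb₀r : b₀ < r := by
    by_contra h
    push Not at h
    have := mul_nonneg (sub_nonneg.2 h) (hF0 b₀)
    nlinarith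
  set B' := min B b₀ with hB'
  have hB'b : B' ≤ b₀ := min_le_right _ _
  obtain ⟨c, hc, hcmax⟩ := UpperSemicontinuousOn.exists_isMaxOn (s := Icc B' r) ⟨b₀, hB'b, hb₀r.le⟩
    isCompact_Icc (husc.upperSemicontinuousOn _)
  have hcb : (r - b₀) * F b₀ ≤ H c := by
    rw [← hHeq b₀ hb₀r.le]; exact hcmax ⟨hB'b, hb₀r.le⟩
  have hglob : ∀ b, H b ≤ H c := by
    intro b
    rcases le_total r b with h | h
    · rw [hH0 b h]; linarith
    · rcases le_or_gt B' b with h' | h'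
      · exact hcmax ⟨h', h⟩
      · rw [hHeq b h]; exact (hB b (h'.trans_le (min_le_left _ _))).trans hcb
  have hcomp : IsCompact (Icc B' r ∩ H ⁻¹' Ici (H c)) :=
    isCompact_Icc.inter_right (husc.isClosed_preimage _)
  -- Maximizers form a compact set. Taking the greatest one makes every larger price worse by a
  -- fixed gap, which later separates the virtual values above `m` strictly from `r`.
  obtain ⟨m, ⟨hm, hmc⟩, hmg⟩ := hcomp.exists_isGreatest ⟨c, hc, le_rfl (a := H c)⟩
  have hmc' : H m = H c := le_antisymm (hglob m) hmc
  have hmr : m < r := by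
    by_contra h
    push Not at h
    have := hH0 m h
    linarith
  have hmH : H m = (r - m) * F m := hHeq m hmr.le
  refine ⟨m, hmr, ?_, ?_, ?_⟩
  · by_contra h
    have : F m = 0 := le_antisymm (not_lt.1 h) (hF0 m)
    rw [this, mul_zero] at hmH
    linarith
  · intro b
    rw [← hmH, hmc']
    exact (hHle b).trans (hglob b)
  · intro z hz
    rcases le_or_gt r z with hzr | hzr
    · refine ⟨H m, by linarith, fun b hb => ?_⟩
      rw [← hmH]
      have : (r - b) * F b ≤ 0 := mul_nonpos_of_nonpos_of_nonneg (by linarith) (hF0 b)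
      linarith
    · obtain ⟨d, hd, hdmax⟩ := UpperSemicontinuousOn.exists_isMaxOn (s := Icc z r)
        ⟨z, le_rfl, hzr.le⟩ isCompact_Icc (husc.upperSemicontinuousOn _)
      have hdlt : H d < H m := by
        by_contra h
        have : d ≤ m := hmg ⟨⟨hm.1.trans (hz.le.trans hd.1), hd.2⟩, by
          rw [← hmc']; exact not_lt.1 h⟩
        linarith [hd.1]
      refine ⟨H m - H d, by linarith, fun b hb => ?_⟩
      rw [← hmH]
      have : (r - b) * F b ≤ H d := by
        rcases le_total r b with h | h
        · have h1 : (r - b) * F b ≤ 0 := mul_nonpos_of_nonpos_of_nonneg (by linarith) (hF0 b)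
          have : 0 ≤ H d := mul_nonneg (le_max_right _ _) (hF0 d)
          linarith
        · exact (hHle b).trans (hdmax ⟨hb, h⟩)
      linarith

end Broker

namespace Broker
open Filter Topology

/-- With a common subgradient `q`, the difference of `E` and `Q` changes over `[x, y]` by at most
`(y - x) * (q y - q x)`, and `le_of_sub_le_mul_sub` makes these errors vanish. It identifies the
expected truncated virtual surplus with the optimal-price profit without differentiating either. -/
theorem sub_eq_sub_of_sandwich {E Q q : ℝ → ℝ} {a b : ℝ} (hab : a ≤ b)
    (hE : ∀ x y, a ≤ x → x ≤ y → y ≤ b → (y - x) * q x ≤ E y - E x ∧ E y - E x ≤ (y - x) * q y)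
    (hQ : ∀ x y, a ≤ x → x ≤ y → y ≤ b → (y - x) * q x ≤ Q y - Q x ∧ Q y - Q x ≤ (y - x) * q y) :
    E b - E a = Q b - Q a := by
  have h1 := le_of_sub_le_mul_sub (F := fun x => E x - Q x) (G := q) hab (by
    intro x y hx hxy hy
    have := (hE x y hx hxy hy).1
    have := (hQ x y hx hxy hy).2
    nlinarith)
  have h2 := le_of_sub_le_mul_sub (F := fun x => Q x - E x) (G := q) hab (by
    intro x y hx hxy hy
    have := (hE x y hx hxy hy).2
    have := (hQ x y hx hxy hy).1
    nlinarith)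
  linarith

theorem continuousWithinAt_measureReal_Iic (μ : Measure ℝ) [IsProbabilityMeasure μ] (b : ℝ) :
    ContinuousWithinAt (fun b => μ.real (Iic b)) (Ici b) b := by
  have := (ProbabilityTheory.cdf μ).right_continuous b
  refine this.congr (fun y _ => ?_) ?_ <;> rw [ProbabilityTheory.cdf_eq_real]

/-! ### Sellers' virtual values -/

section Seller

variable {μ : Measure ℝ}

theorem sellerVirtual_mono (μ : Measure ℝ) : Monotone (sellerVirtual μ) := by
  intro v w hvw
  refine iSup₂_le fun a ha => ?_
  refine le_iSup₂_of_le a (ha.trans_le hvw) ?_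
  exact le_iInf₂ fun b hb => iInf₂_le b (hvw.trans hb)

theorem measurable_sellerVirtual (μ : Measure ℝ) : Measurable (sellerVirtual μ) :=
  (sellerVirtual_mono μ).measurable

theorem ofReal_le_sellerVirtual (μ : Measure ℝ) (v : ℝ) : ENNReal.ofReal v ≤ sellerVirtual μ v := by
  refine le_iSup₂_of_le (v - 1) (by linarith) (le_iInf₂ fun b hb => ?_)
  exact (ENNReal.ofReal_le_ofReal hb).trans le_self_add

theorem le_of_sellerVirtual_le {v r : ℝ} (hr : 0 ≤ r)
    (h : sellerVirtual μ v ≤ ENNReal.ofReal r) : v ≤ r :=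
  (ENNReal.ofReal_le_ofReal_iff hr).1 ((ofReal_le_sellerVirtual μ v).trans h)

theorem measureReal_Iic_eq_zero (hμ : μ (Iio 0) = 0) {b : ℝ} (hb : b < 0) : μ.real (Iic b) = 0 := by
  rw [measureReal_def, measure_mono_null (Iic_subset_Iio.2 hb) hμ]; rfl

variable [IsProbabilityMeasure μ]

/-- The level sets of the ironed virtual value are governed by the optimal resale price. -/
theorem sellerVirtual_level (hμ : μ (Iio 0) = 0) {r : ℝ} (hr : 0 ≤ r) :
    ∃ b ≤ r, {z | sellerVirtual μ z ≤ ENNReal.ofReal r} ⊆ Iic b ∧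
      ∀ b', (r - b') * μ.real (Iic b') ≤
        (r - b) * μ.real {z | sellerVirtual μ z ≤ ENNReal.ofReal r} := by
  -- If no resale price is profitable, `b = r` makes the right side zero whatever the level set is.
  -- Otherwise the level set is exactly `Iic m` for the greatest optimal price `m`.
  by_cases hcase : ∀ b', (r - b') * μ.real (Iic b') ≤ 0
  · refine ⟨r, le_rfl, fun z hz => le_of_sellerVirtual_le hr hz, fun b' => ?_⟩
    simpa using hcase b'
  push Not at hcase
  obtain ⟨b₀, hb₀⟩ := hcase
  obtain ⟨m, hmr, hFm, hmax, hgap⟩ := exists_greatest_maximizer (F := fun b => μ.real (Iic b))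
    (fun a b hab => measureReal_mono (Iic_subset_Iic.2 hab)) (fun b => measureReal_nonneg)
    (continuousWithinAt_measureReal_Iic μ) hb₀ (B := 0)
    (fun b hb => by rw [measureReal_Iic_eq_zero hμ hb, mul_zero]; exact hb₀.le)
  have hm0 : 0 ≤ m := by
    by_contra h
    rw [measureReal_Iic_eq_zero hμ (not_le.1 h)] at hFm
    exact lt_irrefl _ hFm
  have hIoc : ∀ a b : ℝ, a ≤ b → μ.real (Ioc a b) = μ.real (Iic b) - μ.real (Iic a) := by
    intro a b hab
    have : Ioc a b = Iic b \ Iic a := by ext x; simp [and_comm]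
    rw [this, measureReal_sdiff (Iic_subset_Iic.2 hab) measurableSet_Iic]
  have hset : {z | sellerVirtual μ z ≤ ENNReal.ofReal r} = Iic m := by
    ext z
    simp only [mem_ofPred_eq, mem_Iic]
    constructor
    · intro hz
      by_contra hzm
      push Not at hzm
      obtain ⟨δ, hδ, hgap⟩ := hgap z hzm
      -- Use `m` as the left end of the chords. By the gap, the slope to any `b ≥ z` is at least `r`
      -- plus `δ` over a mass at most 1. The numerator is positive since `0 < μ.real (Iic m)`, so
      -- the default `0 / 0 = 0` does not interfere.
      have : ENNReal.ofReal (r + δ) ≤ sellerVirtual μ z := by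
        refine le_iSup₂_of_le m hzm (le_iInf₂ fun b hb => ?_)
        have hmb : m < b := hzm.trans_le hb
        have h1 : ENNReal.ofReal (r + δ - b) ≤
            ENNReal.ofReal (b - m) * μ (Iic m) / μ (Ioc m b) := by
          have hnum : ENNReal.ofReal (b - m) * μ (Iic m) ≠ 0 := by
            refine mul_ne_zero (by simpa using hmb) ?_
            intro h
            rw [measureReal_def, h] at hFm
            simp at hFm
          rw [ENNReal.le_div_iff_mul_le (Or.inr hnum) (Or.inl (measure_ne_top _ _)),
            ← ofReal_measureReal, ← ofReal_measureReal,
            ← ENNReal.ofReal_mul' measureReal_nonneg, ← ENNReal.ofReal_mul' measureReal_nonneg]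
          refine ENNReal.ofReal_le_ofReal ?_
          have h2 := hgap b hb
          have h3 : μ.real (Ioc m b) ≤ 1 := measureReal_le_one
          have h4 := hIoc m b hmb.le
          have h5 : δ * μ.real (Ioc m b) ≤ δ := by nlinarith
          rw [add_sub_right_comm, add_mul]
          rw [h4] at h5 ⊢
          linarith
        calc ENNReal.ofReal (r + δ) = ENNReal.ofReal (b + (r + δ - b)) := by ring_nf
          _ ≤ ENNReal.ofReal b + ENNReal.ofReal (r + δ - b) := ENNReal.ofReal_add_le
          _ ≤ _ := by gcongr
      have := this.trans hz
      rw [ENNReal.ofReal_le_ofReal_iff hr] at this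
      linarith
    · intro hz
      -- For each left end `a`, the right end `m` is admissible, and optimality of `m` says that the
      -- chord from `a` to `m` has slope at most `r`.
      refine iSup₂_le fun a ha => iInf₂_le_of_le m hz ?_
      have ham : a < m := ha.trans_le hz
      have h1 : ENNReal.ofReal (m - a) * μ (Iic a) / μ (Ioc a m) ≤ ENNReal.ofReal (r - m) := by
        refine ENNReal.div_le_of_le_mul ?_
        rw [← ofReal_measureReal, ← ofReal_measureReal,
          ← ENNReal.ofReal_mul' measureReal_nonneg, ← ENNReal.ofReal_mul' measureReal_nonneg]
        refine ENNReal.ofReal_le_ofReal ?_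
        rw [hIoc a m ham.le]
        have := hmax a
        linarith
      calc _ ≤ ENNReal.ofReal m + ENNReal.ofReal (r - m) := by gcongr
        _ = ENNReal.ofReal r := by
          rw [← ENNReal.ofReal_add hm0 (by linarith)]; ring_nf
  refine ⟨m, hmr.le, hset.le, fun b' => ?_⟩
  rw [hset]
  exact hmax b'

theorem measurableSet_sellerVirtual_le (μ : Measure ℝ) (r : ℝ≥0∞) :
    MeasurableSet {z | sellerVirtual μ z ≤ r} :=
  measurableSet_le (measurable_sellerVirtual μ) measurable_const

/-- The expected truncated gain `(r - φ)⁺` is the optimal resale profit. -/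
theorem lintegral_sub_sellerVirtual (hμ : μ (Iio 0) = 0) {r : ℝ} (hr : 0 ≤ r) :
    ∃ b ≤ r, {z | sellerVirtual μ z ≤ ENNReal.ofReal r} ⊆ Iic b ∧
      ∫⁻ z, (ENNReal.ofReal r - sellerVirtual μ z) ∂μ =
        ENNReal.ofReal ((r - b) * μ.real {z | sellerVirtual μ z ≤ ENNReal.ofReal r}) ∧
      ∀ b', (r - b') * μ.real (Iic b') ≤
        (r - b) * μ.real {z | sellerVirtual μ z ≤ ENNReal.ofReal r} := by
  -- Clamping at 0 makes the optimal price a total function of `r`, so that it can be chosen for all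
  -- levels at once.
  have hlev : ∀ r : ℝ, ∃ b ≤ max r 0, {z | sellerVirtual μ z ≤ ENNReal.ofReal (max r 0)} ⊆ Iic b ∧
      ∀ b', (max r 0 - b') * μ.real (Iic b') ≤
        (max r 0 - b) * μ.real {z | sellerVirtual μ z ≤ ENNReal.ofReal (max r 0)} :=
    fun r => sellerVirtual_level hμ (le_max_right r 0)
  choose b hb hsub hopt using hlev
  set q : ℝ → ℝ := fun r => μ.real {z | sellerVirtual μ z ≤ ENNReal.ofReal r} with hq
  have hfin : ∀ r, ∫⁻ z, (ENNReal.ofReal r - sellerVirtual μ z) ∂μ ≠ ⊤ := by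
    intro r
    refine ne_top_of_le_ne_top (ENNReal.ofReal_ne_top (r := r)) ?_
    calc _ ≤ ∫⁻ _, ENNReal.ofReal r ∂μ := lintegral_mono fun z => tsub_le_self
      _ = _ := by simp
  set E : ℝ → ℝ := fun r => (∫⁻ z, (ENNReal.ofReal r - sellerVirtual μ z) ∂μ).toReal with hE
  have hind : ∀ (x y : ℝ), x ≤ y → ∀ t, ∫⁻ z, {z | sellerVirtual μ z ≤ ENNReal.ofReal t}.indicator
      (fun _ => ENNReal.ofReal (y - x)) z ∂μ = ENNReal.ofReal ((y - x) * q t) := by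
    intro x y hxy t
    rw [lintegral_indicator_const (measurableSet_sellerVirtual_le μ _), hq,
      ENNReal.ofReal_mul (by linarith), ofReal_measureReal]
  have hmeas : ∀ r : ℝ, Measurable fun z => ENNReal.ofReal r - sellerVirtual μ z := fun r =>
    measurable_const.sub (measurable_sellerVirtual μ)
  -- Raising the level from `x` to `y` adds `y - x` where `φ ≤ x`, and at most `y - x` where `φ ≤
  -- y`.
  have hEs : ∀ x y, 0 ≤ x → x ≤ y → y ≤ r → (y - x) * q x ≤ E y - E x ∧
      E y - E x ≤ (y - x) * q y := by
    intro x y hx hxy _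
    have hsplit : ENNReal.ofReal y = ENNReal.ofReal x + ENNReal.ofReal (y - x) := by
      rw [← ENNReal.ofReal_add hx (by linarith)]; ring_nf
    have hqn : ∀ t, 0 ≤ (y - x) * q t := fun t => mul_nonneg (by linarith) measureReal_nonneg
    constructor
    · have : ENNReal.ofReal ((y - x) * q x) + ∫⁻ z, (ENNReal.ofReal x - sellerVirtual μ z) ∂μ ≤
          ∫⁻ z, (ENNReal.ofReal y - sellerVirtual μ z) ∂μ := by
        rw [← hind x y hxy x, ← lintegral_add_right _ (hmeas x)]
        refine lintegral_mono fun z => ?_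
        by_cases hz : sellerVirtual μ z ≤ ENNReal.ofReal x
        · simp only [indicator, mem_ofPred_eq, hz, if_true]
          refine ENNReal.le_sub_of_add_le_right (ne_top_of_le_ne_top ENNReal.ofReal_ne_top hz) ?_
          rw [hsplit, add_assoc, tsub_add_cancel_of_le hz, add_comm]
        · simp only [indicator, mem_ofPred_eq, hz, if_false]
          rw [tsub_eq_zero_of_le (not_le.1 hz).le]; simp
      have h2 := ENNReal.toReal_mono (hfin y) this
      rw [ENNReal.toReal_add (by simp) (hfin x), ENNReal.toReal_ofReal (hqn x)] at h2
      simp only [hE]; linarith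
    · have : ∫⁻ z, (ENNReal.ofReal y - sellerVirtual μ z) ∂μ ≤
          ENNReal.ofReal ((y - x) * q y) + ∫⁻ z, (ENNReal.ofReal x - sellerVirtual μ z) ∂μ := by
        rw [← hind x y hxy y, ← lintegral_add_right _ (hmeas x)]
        refine lintegral_mono fun z => ?_
        by_cases hz : sellerVirtual μ z ≤ ENNReal.ofReal y
        · simp only [indicator, mem_ofPred_eq, hz, if_true]
          rw [hsplit, add_comm (ENNReal.ofReal x)]
          exact add_tsub_le_assoc
        · rw [tsub_eq_zero_of_le (not_le.1 hz).le]; simp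
      have h2 := ENNReal.toReal_mono (by finiteness [hfin x]) this
      rw [ENNReal.toReal_add (by simp) (hfin x), ENNReal.toReal_ofReal (hqn y)] at h2
      simp only [hE]; linarith
  set Q : ℝ → ℝ := fun r => (r - b r) * q r with hQ
  have hbr : ∀ x, 0 ≤ x → b x ≤ x := fun x hx => by simpa [max_eq_left hx] using hb x
  have hQopt : ∀ x, 0 ≤ x → ∀ b', (x - b') * μ.real (Iic b') ≤ Q x := fun x hx => by
    simpa [max_eq_left hx] using hopt x
  have hqF : ∀ x, 0 ≤ x → q x ≤ μ.real (Iic (b x)) := fun x hx =>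
    measureReal_mono (by simpa [max_eq_left hx] using hsub x)
  have hq0 : ∀ x, 0 ≤ q x := fun x => measureReal_nonneg
  -- Envelope argument: the price that is optimal at one level remains available at the other.
  have hQs : ∀ x y, 0 ≤ x → x ≤ y → y ≤ r → (y - x) * q x ≤ Q y - Q x ∧
      Q y - Q x ≤ (y - x) * q y := by
    intro x y hx hxy _
    constructor
    · have h1 := hQopt y (hx.trans hxy) (b x)
      have h2 := mul_le_mul_of_nonneg_left (hqF x hx) (sub_nonneg.2 ((hbr x hx).trans hxy))
      simp only [hQ] at h1 ⊢
      linarith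
    · have h0 : (x - b y) * q y ≤ Q x := by
        rcases le_total x (b y) with h | h
        · have h3 : (x - b y) * q y ≤ 0 :=
            mul_nonpos_of_nonpos_of_nonneg (by linarith) (hq0 y)
          have : 0 ≤ Q x := mul_nonneg (sub_nonneg.2 (hbr x hx)) (hq0 x)
          linarith
        · exact (mul_le_mul_of_nonneg_left (hqF y (hx.trans hxy)) (by linarith)).trans
            (hQopt x hx (b y))
      simp only [hQ] at h0 ⊢
      linarith
  have hE0 : E 0 = 0 := by simp [hE]
  -- At resale value 0 only a negative price could earn something, and no seller accepts it.
  have hQ0 : Q 0 = 0 := by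
    refine le_antisymm ?_ (mul_nonneg (sub_nonneg.2 (hbr 0 le_rfl)) (hq0 0))
    have h := hqF 0 le_rfl
    rcases lt_or_ge (b 0) 0 with h' | h'
    · rw [measureReal_Iic_eq_zero hμ h'] at h
      simp only [hQ]
      nlinarith [hq0 0]
    · simp only [hQ]
      nlinarith [hq0 0]
  have hEQ := sub_eq_sub_of_sandwich hr hEs hQs
  rw [hE0, hQ0, sub_zero, sub_zero] at hEQ
  have hs := hsub r
  rw [max_eq_left hr] at hs
  refine ⟨b r, hbr r hr, hs, ?_, hQopt r hr⟩
  change _ = ENNReal.ofReal (Q r)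
  rw [← hEQ, ENNReal.ofReal_toReal (hfin r)]

/-- Posting the largest price at which every seller with virtual value at most `φ z` accepts costs
no more than the virtual values. -/
theorem mul_measure_le_setLIntegral_sellerVirtual (hμ : μ (Iio 0) = 0) {A : Set ℝ}
    (hA : MeasurableSet A) {z : ℝ} (hz : sellerVirtual μ z ≠ ⊤)
    (hcl : ∀ᵐ y ∂μ, sellerVirtual μ y ≤ sellerVirtual μ z → y ∈ A) :
    ENNReal.ofReal z * μ A ≤ ∫⁻ y in A, sellerVirtual μ y ∂μ := by
  set r := (sellerVirtual μ z).toReal with hr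
  have hrz : ENNReal.ofReal r = sellerVirtual μ z := ENNReal.ofReal_toReal hz
  have hr0 : 0 ≤ r := ENNReal.toReal_nonneg
  obtain ⟨b, hbr, hsub, hint, -⟩ := lintegral_sub_sellerVirtual hμ hr0
  set L := {y | sellerVirtual μ y ≤ ENNReal.ofReal r} with hL
  have hLm : MeasurableSet L := measurableSet_sellerVirtual_le μ _
  have hzb : z ≤ b := hsub (by simp [hL, hrz])
  -- On `L` the envelope identity gives an integral of at least `b * μ L`, and `z ≤ b`. Off `L` the
  -- virtual value exceeds `r ≥ b ≥ z` pointwise.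
  have h1 : ENNReal.ofReal z * μ L ≤ ∫⁻ y in L, sellerVirtual μ y ∂μ := by
    rcases le_total z 0 with hz0 | hz0
    · simp [ENNReal.ofReal_of_nonpos hz0]
    have h2 : (∫⁻ y in L, (ENNReal.ofReal r - sellerVirtual μ y) ∂μ) +
        ∫⁻ y in L, sellerVirtual μ y ∂μ = ENNReal.ofReal r * μ L := by
      rw [← lintegral_add_right _ (measurable_sellerVirtual μ), ← setLIntegral_const]
      exact setLIntegral_congr_fun hLm fun y hy => tsub_add_cancel_of_le hy
    have h3 : ∫⁻ y in L, (ENNReal.ofReal r - sellerVirtual μ y) ∂μ ≤ ENNReal.ofReal (r - b) * μ L := by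
      calc _ ≤ _ := setLIntegral_le_lintegral _ _
        _ = _ := hint
        _ = _ := by rw [ENNReal.ofReal_mul (by linarith), ofReal_measureReal]
    have h4 : ENNReal.ofReal r * μ L = ENNReal.ofReal (r - b) * μ L + ENNReal.ofReal b * μ L := by
      rw [← add_mul, ← ENNReal.ofReal_add (by linarith) (by linarith)]; ring_nf
    have h5 : ENNReal.ofReal (r - b) * μ L + ENNReal.ofReal b * μ L ≤
        ENNReal.ofReal (r - b) * μ L + ∫⁻ y in L, sellerVirtual μ y ∂μ := by
      rw [← h4, ← h2]; gcongr
    have h6 := (ENNReal.add_le_add_iff_left (by finiteness)).1 h5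
    exact le_trans (by gcongr) h6
  have h7 : ENNReal.ofReal z * μ (A \ L) ≤ ∫⁻ y in A \ L, sellerVirtual μ y ∂μ := by
    rw [← setLIntegral_const]
    refine setLIntegral_mono' (hA.diff hLm) fun y hy => ?_
    have : ENNReal.ofReal r < sellerVirtual μ y := not_le.1 hy.2
    exact (ENNReal.ofReal_le_ofReal (hzb.trans hbr)).trans this.le
  have hAL : (A ∩ L : Set ℝ) =ᵐ[μ] L := by
    filter_upwards [hcl] with y hy
    refine propext ⟨fun h => h.2, fun h => ⟨hy ?_, h⟩⟩
    rw [← hrz]; exact h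
  rw [← lintegral_inter_add_sdiff _ A hLm, setLIntegral_congr hAL, ← measure_inter_add_sdiff A hLm,
    measure_congr hAL, mul_add]
  exact add_le_add h1 h7

/-- Among downward closed sets of sellers, posting a price costs at least the virtual values. -/
theorem setLIntegral_sellerVirtual_le (hμ : μ (Iio 0) = 0) {A : Set ℝ} (hA : MeasurableSet A)
    {t : ℝ} (hAt : A ⊆ Iic t) (hcl : ∀ᵐ y ∂μ, y ∉ A → ∀ a ∈ A, a ≤ y) :
    ∫⁻ y in A, sellerVirtual μ y ∂μ ≤ ENNReal.ofReal t * μ A := by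
  have hφ := measurable_sellerVirtual μ
  have key : ∀ n : ℕ, ∫⁻ y in A, min (sellerVirtual μ y) n ∂μ ≤ ENNReal.ofReal t * μ A := by
    intro n
    -- Truncation at `n` keeps the level finite even if `φ` is unbounded on `A`. On `A` truncating
    -- at `R₀` is the same as truncating at `n`.
    set R₀ : ℝ≥0∞ := min (⨆ a ∈ A, sellerVirtual μ a) n with hR₀
    have hR₀top : R₀ ≠ ⊤ := ne_top_of_le_ne_top (ENNReal.natCast_ne_top n) (min_le_right _ _)
    have hcongr : ∫⁻ y in A, min (sellerVirtual μ y) n ∂μ =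
        ∫⁻ y in A, min (sellerVirtual μ y) R₀ ∂μ := by
      refine setLIntegral_congr_fun hA fun y hy => ?_
      have : sellerVirtual μ y ≤ ⨆ a ∈ A, sellerVirtual μ a := le_iSup₂_of_le y hy le_rfl
      simp only [hR₀]
      rw [← min_assoc, min_eq_left this]
    rw [hcongr]
    obtain ⟨b, hbr, -, hint, hopt⟩ := lintegral_sub_sellerVirtual hμ (r := R₀.toReal)
      ENNReal.toReal_nonneg
    rw [ENNReal.ofReal_toReal hR₀top] at hint
    -- By monotonicity `φ ≥ R₀` almost everywhere outside `A`, so the integral over `A` is the full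
    -- optimal resale profit at `R₀`, which beats the price `t`.
    have h0 : ∫⁻ y in A, (R₀ - sellerVirtual μ y) ∂μ = ∫⁻ y, (R₀ - sellerVirtual μ y) ∂μ := by
      rw [← lintegral_indicator hA]
      refine lintegral_congr_ae ?_
      filter_upwards [hcl] with y hy
      by_cases hyA : y ∈ A
      · simp [hyA]
      · simp only [indicator, hyA, if_false]
        refine (tsub_eq_zero_of_le ((min_le_left _ _).trans ?_)).symm
        exact iSup₂_le fun a ha => sellerVirtual_mono μ (hy hyA a ha)
    have h1 : (R₀ - ENNReal.ofReal t) * μ A ≤ ∫⁻ y in A, (R₀ - sellerVirtual μ y) ∂μ := by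
      rw [h0, hint]
      calc (R₀ - ENNReal.ofReal t) * μ A
          ≤ ENNReal.ofReal (R₀.toReal - t) * μ (Iic t) := by
            gcongr
            rw [tsub_le_iff_right]
            calc R₀ = ENNReal.ofReal (R₀.toReal - t + t) := by simp [ENNReal.ofReal_toReal hR₀top]
              _ ≤ _ := ENNReal.ofReal_add_le
        _ = ENNReal.ofReal ((R₀.toReal - t) * μ.real (Iic t)) := by
            rw [ENNReal.ofReal_mul' measureReal_nonneg, ofReal_measureReal]
        _ ≤ _ := ENNReal.ofReal_le_ofReal (hopt t)
        _ = _ := by rw [ENNReal.ofReal_toReal hR₀top]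
    have h2 : (∫⁻ y in A, min (sellerVirtual μ y) R₀ ∂μ) +
        ∫⁻ y in A, (R₀ - sellerVirtual μ y) ∂μ = R₀ * μ A := by
      rw [← lintegral_add_left (hφ.min measurable_const), ← setLIntegral_const]
      refine setLIntegral_congr_fun hA fun y _ => ?_
      rcases le_total (sellerVirtual μ y) R₀ with h | h
      · simp only [min_eq_left h]; exact add_tsub_cancel_of_le h
      · simp only [min_eq_right h, tsub_eq_zero_of_le h, add_zero]
    have h3 : (∫⁻ y in A, min (sellerVirtual μ y) R₀ ∂μ) + (R₀ - ENNReal.ofReal t) * μ A ≤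
        ENNReal.ofReal t * μ A + (R₀ - ENNReal.ofReal t) * μ A := by
      calc _ ≤ R₀ * μ A := by rw [← h2]; gcongr
        _ ≤ (ENNReal.ofReal t + (R₀ - ENNReal.ofReal t)) * μ A := by
            gcongr; exact le_add_tsub
        _ = _ := add_mul _ _ _
    exact (ENNReal.add_le_add_iff_right (by
      refine ENNReal.mul_ne_top ?_ (measure_ne_top _ _)
      exact ne_top_of_le_ne_top hR₀top tsub_le_self)).1 h3
  have hsup : ∀ y, sellerVirtual μ y = ⨆ n : ℕ, min (sellerVirtual μ y) n := by
    intro y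
    have := ENNReal.iSup_natCast
    rw [← inf_iSup_eq (sellerVirtual μ y) (fun n : ℕ => (n : ℝ≥0∞)), this]
    simp
  calc ∫⁻ y in A, sellerVirtual μ y ∂μ = ∫⁻ y in A, ⨆ n : ℕ, min (sellerVirtual μ y) n ∂μ := by
        simp_rw [← hsup]
    _ = ⨆ n : ℕ, ∫⁻ y in A, min (sellerVirtual μ y) n ∂μ := by
        refine lintegral_iSup (fun n => hφ.min measurable_const) ?_
        intro n k hnk y
        exact min_le_min_left _ (by exact_mod_cast hnk)
    _ ≤ _ := iSup_le key

end Seller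

end Broker

namespace Broker
open Filter Topology

/-! ### Buyers' virtual values -/

section Buyer

variable {μ : Measure ℝ}

theorem buyerVirtual_mono (μ : Measure ℝ) : Monotone (buyerVirtual μ) := by
  intro v w hvw
  refine le_iInf₂ fun a ha => ?_
  refine iInf₂_le_of_le a (hvw.trans_lt ha) ?_
  exact iSup₂_le fun b hb => le_iSup₂_of_le b (hb.trans hvw) le_rfl

theorem measurable_buyerVirtual (μ : Measure ℝ) : Measurable (buyerVirtual μ) :=
  (buyerVirtual_mono μ).measurable

theorem buyerVirtual_le (μ : Measure ℝ) (v : ℝ) : buyerVirtual μ v ≤ v := by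
  refine iInf₂_le_of_le (v + 1) (by linarith) (iSup₂_le fun b hb => ?_)
  calc _ ≤ (b : EReal) - 0 := by
        refine EReal.sub_le_sub le_rfl ?_
        exact EReal.coe_ennreal_nonneg _
    _ ≤ v := by simpa using hb

/-- The positive part of the ironed virtual value of a buyer. -/
noncomputable def posVirtual (μ : Measure ℝ) (v : ℝ) : ℝ≥0∞ := (buyerVirtual μ v).toENNReal

theorem posVirtual_mono (μ : Measure ℝ) : Monotone (posVirtual μ) := fun _ _ h =>
  EReal.toENNReal_le_toENNReal (buyerVirtual_mono μ h)

theorem measurable_posVirtual (μ : Measure ℝ) : Measurable (posVirtual μ) :=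
  (posVirtual_mono μ).measurable

theorem posVirtual_le (μ : Measure ℝ) (v : ℝ) : posVirtual μ v ≤ ENNReal.ofReal v := by
  have := EReal.toENNReal_le_toENNReal (buyerVirtual_le μ v)
  simpa [posVirtual] using this

theorem posVirtual_ne_top (μ : Measure ℝ) (v : ℝ) : posVirtual μ v ≠ ⊤ :=
  ne_top_of_le_ne_top ENNReal.ofReal_ne_top (posVirtual_le μ v)

theorem coe_posVirtual {v : ℝ} (h : 0 ≤ buyerVirtual μ v) :
    (posVirtual μ v : EReal) = buyerVirtual μ v := EReal.coe_toENNReal h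

theorem coe_le_buyerVirtual_iff {v : ℝ} {r : ℝ} (hr : 0 ≤ r) (h : 0 ≤ buyerVirtual μ v) :
    (r : EReal) ≤ buyerVirtual μ v ↔ ENNReal.ofReal r ≤ posVirtual μ v := by
  rw [← coe_posVirtual h, ← EReal.coe_ennreal_le_coe_ennreal_iff]
  simp [hr]

theorem ofReal_le_posVirtual {v r : ℝ} (hr : 0 ≤ r) (h : (r : EReal) ≤ buyerVirtual μ v) :
    ENNReal.ofReal r ≤ posVirtual μ v :=
  (coe_le_buyerVirtual_iff hr (le_trans (by exact_mod_cast hr) h)).1 h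

theorem posVirtual_le_ofReal {v r : ℝ} (h : buyerVirtual μ v ≤ (r : EReal)) :
    posVirtual μ v ≤ ENNReal.ofReal r := by
  have := EReal.toENNReal_le_toENNReal h
  simpa [posVirtual] using this

theorem measurableSet_le_buyerVirtual (μ : Measure ℝ) (r : EReal) :
    MeasurableSet {z | r ≤ buyerVirtual μ z} :=
  measurableSet_le measurable_const (measurable_buyerVirtual μ)

variable [IsProbabilityMeasure μ]

theorem continuousWithinAt_measureReal_Ici (μ : Measure ℝ) [IsProbabilityMeasure μ] (b : ℝ) :
    ContinuousWithinAt (fun b => μ.real (Ici (-b))) (Ici b) b := by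
  have hp : IsProbabilityMeasure (μ.map Neg.neg) :=
    Measure.isProbabilityMeasure_map measurable_neg.aemeasurable
  have h : ∀ b, μ.real (Ici (-b)) = (μ.map Neg.neg).real (Iic b) := fun b => by
    rw [map_measureReal_apply measurable_neg measurableSet_Iic]
    simp
  simp_rw [h]
  exact continuousWithinAt_measureReal_Iic _ b

/-- The revenue at price `y` is at most the part of the mean above `y`. This is where the finite
mean enters: it yields an optimal price and fixes the constant of integration at infinity. -/
theorem tendsto_mul_measureReal_Ici (hint : Integrable (fun z : ℝ => z) μ) :
    Tendsto (fun y : ℝ => y * μ.real (Ici y)) atTop (𝓝 0) := by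
  have h1 : Tendsto (fun y : ℝ => ∫ z, (Ici y).indicator (fun z => z) z ∂μ) atTop (𝓝 0) := by
    have := tendsto_integral_filter_of_dominated_convergence (μ := μ) (l := atTop)
      (F := fun (y : ℝ) z => (Ici y).indicator (fun z => z) z) (f := fun _ => (0 : ℝ))
      (fun z => ‖z‖)
      (Eventually.of_forall fun y => (measurable_id.indicator measurableSet_Ici).aestronglyMeasurable)
      (Eventually.of_forall fun y => Eventually.of_forall fun z => norm_indicator_le_norm_self _ _)
      hint.norm (Eventually.of_forall fun z => by
        refine tendsto_const_nhds.congr' ?_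
        filter_upwards [eventually_gt_atTop z] with y hy
        simp [indicator, hy])
    simpa using this
  refine tendsto_of_tendsto_of_tendsto_of_le_of_le' tendsto_const_nhds h1 ?_ ?_
  · filter_upwards [eventually_ge_atTop 0] with y hy
    exact mul_nonneg hy measureReal_nonneg
  · refine Eventually.of_forall fun y => ?_
    have : y * μ.real (Ici y) = ∫ z, (Ici y).indicator (fun _ => y) z ∂μ := by
      rw [integral_indicator_const _ measurableSet_Ici, smul_eq_mul, mul_comm]
    rw [this]
    refine integral_mono ((integrable_const y).indicator measurableSet_Ici)
      (hint.indicator measurableSet_Ici) fun z => ?_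
    by_cases hz : y ≤ z <;> simp [indicator, hz]

/-- The level sets of the ironed virtual value are governed by the optimal posted price. -/
theorem buyerVirtual_level (hint : Integrable (fun z : ℝ => z) μ) {r : ℝ} (hr : 0 ≤ r) :
    ∃ b, r ≤ b ∧ {z | (r : EReal) ≤ buyerVirtual μ z} ⊆ Ici b ∧
      ∀ b', (b' - r) * μ.real (Ici b') ≤
        (b - r) * μ.real {z | (r : EReal) ≤ buyerVirtual μ z} := by
  by_cases hcase : ∀ b', (b' - r) * μ.real (Ici b') ≤ 0
  · refine ⟨r, le_rfl, fun z hz => ?_, fun b' => ?_⟩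
    · exact_mod_cast (show (r : EReal) ≤ _ from hz).trans (buyerVirtual_le μ z)
    · simpa using hcase b'
  push Not at hcase
  obtain ⟨b₀, hb₀⟩ := hcase
  obtain ⟨B, hB⟩ : ∃ B, ∀ y > B, (y - r) * μ.real (Ici y) ≤ (b₀ - r) * μ.real (Ici b₀) := by
    have := (tendsto_mul_measureReal_Ici hint).eventually_lt_const hb₀
    obtain ⟨B, hB⟩ := eventually_atTop.1 this
    refine ⟨B, fun y hy => ?_⟩
    have h1 := hB y hy.le
    have h2 : 0 ≤ r * μ.real (Ici y) := mul_nonneg hr measureReal_nonneg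
    linarith
  -- Reflecting prices turns the selling problem into the resale problem; the greatest maximizer
  -- becomes the smallest optimal price `m`, and the level set is `Ici m`.
  obtain ⟨m', hmr, hFm, hmax, hgap⟩ := exists_greatest_maximizer
    (F := fun b => μ.real (Ici (-b))) (r := -r) (b₀ := -b₀) (B := -B)
    (fun a b hab => measureReal_mono (Ici_subset_Ici.2 (neg_le_neg hab)))
    (fun b => measureReal_nonneg) (continuousWithinAt_measureReal_Ici μ)
    (by rw [neg_neg]; linarith)
    (fun b hb => by
      have := hB (-b) (by linarith)
      rw [neg_neg]; linarith)
  set m := -m' with hm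
  have hmax' : ∀ b, (b - r) * μ.real (Ici b) ≤ (m - r) * μ.real (Ici m) := fun b => by
    have := hmax (-b)
    rw [neg_neg] at this
    linarith
  have hgap' : ∀ z, z < m → ∃ δ > 0, ∀ b, b ≤ z →
      (b - r) * μ.real (Ici b) + δ ≤ (m - r) * μ.real (Ici m) := fun z hz => by
    obtain ⟨δ, hδ, h⟩ := hgap (-z) (by linarith)
    refine ⟨δ, hδ, fun b hb => ?_⟩
    have := h (-b) (by linarith)
    rw [neg_neg] at this
    linarith
  have hIco : ∀ a b : ℝ, a ≤ b → μ.real (Ico a b) = μ.real (Ici a) - μ.real (Ici b) := by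
    intro a b hab
    have : Ico a b = Ici a \ Ici b := by ext x; simp
    rw [this, measureReal_sdiff (Ici_subset_Ici.2 hab) measurableSet_Ici]
  have hset : {z | (r : EReal) ≤ buyerVirtual μ z} = Ici m := by
    ext z
    simp only [mem_ofPred_eq, mem_Ici]
    constructor
    · intro hz
      by_contra hzm
      push Not at hzm
      obtain ⟨δ, hδ, hgap⟩ := hgap' z hzm
      have : buyerVirtual μ z ≤ ((r - δ : ℝ) : EReal) := by
        refine iInf₂_le_of_le m hzm (iSup₂_le fun b hb => ?_)
        have hmb : b < m := lt_of_le_of_lt hb hzm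
        have h1 : ENNReal.ofReal (b - r + δ) ≤
            ENNReal.ofReal (m - b) * μ (Ici m) / μ (Ico b m) := by
          have hnum : ENNReal.ofReal (m - b) * μ (Ici m) ≠ 0 := by
            refine mul_ne_zero (by simpa using hmb) ?_
            intro h
            rw [measureReal_def, h] at hFm
            simp at hFm
          rw [ENNReal.le_div_iff_mul_le (Or.inr hnum) (Or.inl (measure_ne_top _ _)),
            ← ofReal_measureReal, ← ofReal_measureReal,
            ← ENNReal.ofReal_mul' measureReal_nonneg, ← ENNReal.ofReal_mul' measureReal_nonneg]
          refine ENNReal.ofReal_le_ofReal ?_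
          have h2 := hgap b hb
          have h3 : μ.real (Ico b m) ≤ 1 := measureReal_le_one
          have h4 := hIco b m hmb.le
          have h5 : δ * μ.real (Ico b m) ≤ δ := by nlinarith
          rw [add_mul]
          rw [h4] at h5 ⊢
          linarith
        have h2 : ((b - r + δ : ℝ) : EReal) ≤
            ((ENNReal.ofReal (m - b) * μ (Ici m) / μ (Ico b m) : ℝ≥0∞) : EReal) := by
          refine le_trans ?_ (EReal.coe_ennreal_le_coe_ennreal_iff.2 h1)
          rw [EReal.coe_ennreal_ofReal]
          exact_mod_cast le_max_left _ _
        calc _ ≤ (b : EReal) - ((b - r + δ : ℝ) : EReal) := EReal.sub_le_sub le_rfl h2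
          _ = _ := by rw [← EReal.coe_sub]; congr 1; ring
      have := hz.trans this
      have : r ≤ r - δ := by exact_mod_cast this
      linarith
    · intro hz
      refine le_iInf₂ fun a ha => le_iSup₂_of_le m hz ?_
      have ham : m < a := lt_of_le_of_lt hz ha
      have h1 : ENNReal.ofReal (a - m) * μ (Ici a) / μ (Ico m a) ≤ ENNReal.ofReal (m - r) := by
        refine ENNReal.div_le_of_le_mul ?_
        rw [← ofReal_measureReal, ← ofReal_measureReal,
          ← ENNReal.ofReal_mul' measureReal_nonneg, ← ENNReal.ofReal_mul' measureReal_nonneg]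
        refine ENNReal.ofReal_le_ofReal ?_
        rw [hIco m a ham.le]
        have := hmax' a
        linarith
      have h2 : ((ENNReal.ofReal (a - m) * μ (Ici a) / μ (Ico m a) : ℝ≥0∞) : EReal) ≤
          ((m - r : ℝ) : EReal) := by
        refine (EReal.coe_ennreal_le_coe_ennreal_iff.2 h1).trans ?_
        rw [EReal.coe_ennreal_ofReal, max_eq_left (by linarith)]
      calc (r : EReal) = (m : EReal) - ((m - r : ℝ) : EReal) := by
            rw [← EReal.coe_sub]; congr 1; ring
        _ ≤ _ := EReal.sub_le_sub le_rfl h2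
  refine ⟨m, by linarith, hset.le, fun b' => ?_⟩
  rw [hset]
  exact hmax' b'

/-- The expected excess of the virtual value over `r` is the optimal posted-price profit. -/
theorem lintegral_posVirtual_sub (hint : Integrable (fun z : ℝ => z) μ) {r : ℝ} (hr : 0 ≤ r) :
    ∃ b, r ≤ b ∧ {z | (r : EReal) ≤ buyerVirtual μ z} ⊆ Ici b ∧
      ∫⁻ z, (posVirtual μ z - ENNReal.ofReal r) ∂μ =
        ENNReal.ofReal ((b - r) * μ.real {z | (r : EReal) ≤ buyerVirtual μ z}) ∧
      ∀ b', (b' - r) * μ.real (Ici b') ≤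
        (b - r) * μ.real {z | (r : EReal) ≤ buyerVirtual μ z} := by
  have hlev : ∀ r : ℝ, ∃ b, max r 0 ≤ b ∧ {z | ((max r 0 : ℝ) : EReal) ≤ buyerVirtual μ z} ⊆ Ici b ∧
      ∀ b', (b' - max r 0) * μ.real (Ici b') ≤
        (b - max r 0) * μ.real {z | ((max r 0 : ℝ) : EReal) ≤ buyerVirtual μ z} :=
    fun r => buyerVirtual_level hint (le_max_right r 0)
  choose b hb hsub hopt using hlev
  set q : ℝ → ℝ := fun r => μ.real {z | (r : EReal) ≤ buyerVirtual μ z} with hq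
  have hmean : ∫⁻ z, ENNReal.ofReal z ∂μ ≠ ⊤ := hint.lintegral_lt_top.ne
  have hfin : ∀ r : ℝ, ∫⁻ z, (posVirtual μ z - ENNReal.ofReal r) ∂μ ≠ ⊤ := by
    intro r
    exact ne_top_of_le_ne_top hmean
      (lintegral_mono fun z => tsub_le_self.trans (posVirtual_le μ z))
  set E : ℝ → ℝ := fun r => (∫⁻ z, (posVirtual μ z - ENNReal.ofReal r) ∂μ).toReal with hE
  have hind : ∀ (x y : ℝ), x ≤ y → ∀ t : ℝ, ∫⁻ z, {z | (t : EReal) ≤ buyerVirtual μ z}.indicator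
      (fun _ => ENNReal.ofReal (y - x)) z ∂μ = ENNReal.ofReal ((y - x) * q t) := by
    intro x y hxy t
    rw [lintegral_indicator_const (measurableSet_le_buyerVirtual μ _), hq,
      ENNReal.ofReal_mul (by linarith), ofReal_measureReal]
  have hmeas : ∀ r : ℝ, Measurable fun z => posVirtual μ z - ENNReal.ofReal r := fun r =>
    (measurable_posVirtual μ).sub measurable_const
  have hEs : ∀ x y, 0 ≤ x → x ≤ y → (y - x) * q y ≤ E x - E y ∧
      E x - E y ≤ (y - x) * q x := by
    intro x y hx hxy
    have hsplit : ENNReal.ofReal y = ENNReal.ofReal x + ENNReal.ofReal (y - x) := by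
      rw [← ENNReal.ofReal_add hx (by linarith)]; ring_nf
    have hqn : ∀ t, 0 ≤ (y - x) * q t := fun t => mul_nonneg (by linarith) measureReal_nonneg
    constructor
    · have : ENNReal.ofReal ((y - x) * q y) + ∫⁻ z, (posVirtual μ z - ENNReal.ofReal y) ∂μ ≤
          ∫⁻ z, (posVirtual μ z - ENNReal.ofReal x) ∂μ := by
        rw [← hind x y hxy y, ← lintegral_add_right _ (hmeas y)]
        refine lintegral_mono fun z => ?_
        by_cases hz : (y : EReal) ≤ buyerVirtual μ z
        · simp only [indicator, mem_ofPred_eq, hz, if_true]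
          have h1 := ofReal_le_posVirtual (hx.trans hxy) hz
          refine ENNReal.le_sub_of_add_le_right ENNReal.ofReal_ne_top ?_
          calc _ = (posVirtual μ z - ENNReal.ofReal y) + ENNReal.ofReal y := by
                rw [hsplit]; ring
            _ ≤ _ := (tsub_add_cancel_of_le h1).le
        · simp only [indicator, mem_ofPred_eq, hz, if_false]
          rw [zero_add]
          exact tsub_le_tsub_left (ENNReal.ofReal_le_ofReal hxy) _
      have h2 := ENNReal.toReal_mono (hfin x) this
      rw [ENNReal.toReal_add (by simp) (hfin y), ENNReal.toReal_ofReal (hqn y)] at h2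
      simp only [hE]; linarith
    · have : ∫⁻ z, (posVirtual μ z - ENNReal.ofReal x) ∂μ ≤
          ENNReal.ofReal ((y - x) * q x) + ∫⁻ z, (posVirtual μ z - ENNReal.ofReal y) ∂μ := by
        rw [← hind x y hxy x, ← lintegral_add_right _ (hmeas y)]
        refine lintegral_mono fun z => ?_
        by_cases hz : (x : EReal) ≤ buyerVirtual μ z
        · simp only [indicator, mem_ofPred_eq, hz, if_true]
          rw [tsub_le_iff_right, add_comm _ (ENNReal.ofReal x), ← add_assoc, ← hsplit]
          exact le_add_tsub
        · have : posVirtual μ z ≤ ENNReal.ofReal x := posVirtual_le_ofReal (not_le.1 hz).le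
          rw [tsub_eq_zero_of_le this]; simp
      have h2 := ENNReal.toReal_mono (by finiteness [hfin y]) this
      rw [ENNReal.toReal_add (by simp) (hfin y), ENNReal.toReal_ofReal (hqn x)] at h2
      simp only [hE]; linarith
  set Q : ℝ → ℝ := fun r => (b r - r) * q r with hQ
  have hbr : ∀ x, 0 ≤ x → x ≤ b x := fun x hx => by simpa [max_eq_left hx] using hb x
  have hQopt : ∀ x, 0 ≤ x → ∀ b', (b' - x) * μ.real (Ici b') ≤ Q x := fun x hx => by
    simpa [max_eq_left hx] using hopt x
  have hqF : ∀ x, 0 ≤ x → q x ≤ μ.real (Ici (b x)) := fun x hx =>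
    measureReal_mono (by simpa [max_eq_left hx] using hsub x)
  have hq0 : ∀ x, 0 ≤ q x := fun x => measureReal_nonneg
  have hQnn : ∀ x, 0 ≤ x → 0 ≤ Q x := fun x hx => mul_nonneg (sub_nonneg.2 (hbr x hx)) (hq0 x)
  have hQs : ∀ x y, 0 ≤ x → x ≤ y → (y - x) * q y ≤ Q x - Q y ∧
      Q x - Q y ≤ (y - x) * q x := by
    intro x y hx hxy
    have hy := hx.trans hxy
    constructor
    · have h1 := hQopt x hx (b y)
      have h2 := mul_le_mul_of_nonneg_left (hqF y hy) (sub_nonneg.2 (hxy.trans (hbr y hy)))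
      simp only [hQ] at h1 ⊢
      linarith
    · have h0 : (b x - y) * q x ≤ Q y := by
        rcases le_total (b x) y with h | h
        · have h3 : (b x - y) * q x ≤ 0 :=
            mul_nonpos_of_nonpos_of_nonneg (by linarith) (hq0 x)
          linarith [hQnn y hy]
        · exact (mul_le_mul_of_nonneg_left (hqF x hx) (by linarith)).trans (hQopt y hy (b x))
      simp only [hQ] at h0 ⊢
      linarith
  -- Unlike for sellers, the two functions need not vanish at 0. They are compared on `[r, N]`, and
  -- both tend to 0 as `N` grows. The sign of `q` is reversed because they decrease.
  have hEQ : ∀ N, r ≤ N → E r - E N = Q r - Q N := fun N hN => by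
    have := sub_eq_sub_of_sandwich (E := E) (Q := Q)
      (q := fun r => - q r) hN
      (fun x y hx hxy _ => by
        have := hEs x y (hr.trans hx) hxy
        constructor <;> linarith)
      (fun x y hx hxy _ => by
        have := hQs x y (hr.trans hx) hxy
        constructor <;> linarith)
    linarith
  have htail := tendsto_mul_measureReal_Ici hint
  have hQlim : Tendsto Q atTop (𝓝 0) := by
    have hbtop : Tendsto b atTop atTop :=
      tendsto_atTop_mono' _ ((eventually_ge_atTop 0).mono fun x hx => hbr x hx) tendsto_id
    refine tendsto_of_tendsto_of_tendsto_of_le_of_le' tendsto_const_nhds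
      (htail.comp hbtop) ((eventually_ge_atTop 0).mono fun x hx => hQnn x hx) ?_
    filter_upwards [eventually_ge_atTop 0] with x hx
    have h1 := hqF x hx
    have h2 := hbr x hx
    have h3 := hq0 x
    simp only [hQ, Function.comp]
    nlinarith
  have hElim : Tendsto E atTop (𝓝 0) := by
    have : Tendsto (fun r : ℝ => ∫⁻ z, (posVirtual μ z - ENNReal.ofReal r) ∂μ) atTop (𝓝 0) := by
      have := tendsto_lintegral_filter_of_dominated_convergence (μ := μ) (l := atTop)
        (F := fun (r : ℝ) z => posVirtual μ z - ENNReal.ofReal r) (f := fun _ => 0)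
        (fun z => ENNReal.ofReal z) (Eventually.of_forall fun r => hmeas r)
        (Eventually.of_forall fun r => Eventually.of_forall fun z =>
          tsub_le_self.trans (posVirtual_le μ z)) hmean
        (Eventually.of_forall fun z => by
          refine tendsto_const_nhds.congr' ?_
          filter_upwards [eventually_ge_atTop z] with y hy
          exact (tsub_eq_zero_of_le ((posVirtual_le μ z).trans
            (ENNReal.ofReal_le_ofReal hy))).symm)
      simpa using this
    simpa [hE, Function.comp_def] using (ENNReal.tendsto_toReal ENNReal.zero_ne_top).comp this
  have hfinal : E r = Q r := by
    have h1 : Tendsto (fun N => E r - E N) atTop (𝓝 (E r - 0)) := tendsto_const_nhds.sub hElim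
    have h2 : Tendsto (fun N => E r - E N) atTop (𝓝 (Q r - 0)) := by
      refine (tendsto_const_nhds.sub hQlim).congr' ?_
      filter_upwards [eventually_ge_atTop r] with N hN
      exact (hEQ N hN).symm
    simpa using tendsto_nhds_unique h1 h2
  have hs := hsub r
  rw [max_eq_left hr] at hs
  refine ⟨b r, hbr r hr, hs, ?_, hQopt r hr⟩
  change _ = ENNReal.ofReal (Q r)
  rw [← hfinal, ENNReal.ofReal_toReal (hfin r)]

/-- Posted-price profits are bounded by the virtual surplus. -/
theorem ofReal_sub_mul_measure_Ici_le (hint : Integrable (fun z : ℝ => z) μ) {c : ℝ≥0∞}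
    (hc : c ≠ ⊤) (t : ℝ) :
    (ENNReal.ofReal t - c) * μ (Ici t) ≤ ∫⁻ z, (posVirtual μ z - c) ∂μ := by
  obtain ⟨b, -, -, hE, hopt⟩ := lintegral_posVirtual_sub hint (r := c.toReal) ENNReal.toReal_nonneg
  have hcc := ENNReal.ofReal_toReal hc
  rw [hcc] at hE
  rw [hE]
  calc (ENNReal.ofReal t - c) * μ (Ici t) ≤ ENNReal.ofReal (t - c.toReal) * μ (Ici t) := by
        gcongr
        rw [tsub_le_iff_right]
        calc ENNReal.ofReal t = ENNReal.ofReal (t - c.toReal + c.toReal) := by simp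
          _ ≤ _ := ENNReal.ofReal_add_le
          _ = _ := by rw [hcc]
    _ = ENNReal.ofReal ((t - c.toReal) * μ.real (Ici t)) := by
        rw [ENNReal.ofReal_mul' measureReal_nonneg, ofReal_measureReal]
    _ ≤ _ := ENNReal.ofReal_le_ofReal (hopt t)

/-- Selling to an upward closed set of values at a price below all of them brings no more than the
virtual values. -/
theorem mul_measure_le_setLIntegral_posVirtual (hint : Integrable (fun z : ℝ => z) μ) {W : Set ℝ}
    (hW : MeasurableSet W) {t : ℝ} (hWt : W ⊆ Ici t)
    (hcl : ∀ᵐ y ∂μ, y ∉ W → ∀ a ∈ W, y ≤ a) {c : ℝ≥0∞} (hc : c ≠ ⊤) :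
    ENNReal.ofReal t * μ W ≤ ∫⁻ y in W, ((posVirtual μ y - c) + c) ∂μ := by
  rcases W.eq_empty_or_nonempty with rfl | ⟨w₀, hw₀⟩
  · simp
  -- Almost everywhere outside `W` the virtual value is at most `R₀`, so the integral of its excess
  -- over `R₀` lives on `W`. If `R₀ > c`, then `R₀` is below the virtual value on all of `W`, so
  -- adding it back costs nothing.
  set R₀ : ℝ≥0∞ := max c (⨅ a ∈ W, posVirtual μ a) with hR₀
  have hR₀top : R₀ ≠ ⊤ := by
    refine (max_lt hc.lt_top ?_).ne
    exact (iInf₂_le w₀ hw₀).trans_lt (posVirtual_ne_top μ w₀).lt_top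
  have hmeas : Measurable fun y => posVirtual μ y - R₀ :=
    (measurable_posVirtual μ).sub measurable_const
  have h0 : ∫⁻ y in W, (posVirtual μ y - R₀) ∂μ = ∫⁻ y, (posVirtual μ y - R₀) ∂μ := by
    rw [← lintegral_indicator hW]
    refine lintegral_congr_ae ?_
    filter_upwards [hcl] with y hy
    by_cases hyA : y ∈ W
    · simp [hyA]
    · simp only [indicator, hyA, if_false]
      refine (tsub_eq_zero_of_le (le_trans ?_ (le_max_right _ _))).symm
      exact le_iInf₂ fun a ha => posVirtual_mono μ (hy hyA a ha)
  calc ENNReal.ofReal t * μ W ≤ (ENNReal.ofReal t - R₀ + R₀) * μ W := by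
        gcongr; exact le_tsub_add
    _ = (ENNReal.ofReal t - R₀) * μ W + R₀ * μ W := add_mul _ _ _
    _ ≤ (ENNReal.ofReal t - R₀) * μ (Ici t) + R₀ * μ W := by gcongr
    _ ≤ (∫⁻ y in W, (posVirtual μ y - R₀) ∂μ) + R₀ * μ W := by
        rw [h0]; gcongr; exact ofReal_sub_mul_measure_Ici_le hint hR₀top t
    _ = ∫⁻ y in W, ((posVirtual μ y - R₀) + R₀) ∂μ := by
        rw [lintegral_add_left hmeas, setLIntegral_const]
    _ ≤ _ := by
        refine setLIntegral_mono' hW fun y hy => ?_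
        rcases le_total (⨅ a ∈ W, posVirtual μ a) c with h | h
        · rw [hR₀, max_eq_left h]
        · rw [hR₀, max_eq_right h,
            tsub_add_cancel_of_le (iInf₂_le (f := fun a (_ : a ∈ W) => posVirtual μ a) y hy)]
          exact le_tsub_add

/-- Selling to all values with virtual value at least `φ z`, at the price `z`, brings at least the
virtual values. -/
theorem setLIntegral_posVirtual_le (hint : Integrable (fun z : ℝ => z) μ) {W : Set ℝ}
    (hW : MeasurableSet W) {z : ℝ} (hz : 0 ≤ buyerVirtual μ z)
    (hcl : ∀ᵐ y ∂μ, buyerVirtual μ z ≤ buyerVirtual μ y → y ∈ W) :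
    ∫⁻ y in W, posVirtual μ y ∂μ ≤ ENNReal.ofReal z * μ W := by
  set r := (posVirtual μ z).toReal with hr
  have hrz : ENNReal.ofReal r = posVirtual μ z := ENNReal.ofReal_toReal (posVirtual_ne_top μ z)
  have hr0 : 0 ≤ r := ENNReal.toReal_nonneg
  have hrE : (r : EReal) = buyerVirtual μ z := by
    rw [← coe_posVirtual hz, ← hrz, EReal.coe_ennreal_ofReal, max_eq_left hr0]
  -- `b` is an optimal price against the cost `r = φ(z)`. On the level set of `r` the virtual values
  -- integrate to at most `b` times its mass, off it they are below `r`, and `r ≤ b ≤ z`.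
  obtain ⟨b, hrb, hsub, hE, -⟩ := lintegral_posVirtual_sub hint hr0
  rw [hrE] at hsub hE
  set L := {y | buyerVirtual μ z ≤ buyerVirtual μ y} with hL
  have hLm : MeasurableSet L := measurableSet_le_buyerVirtual μ _
  have hzb : b ≤ z := hsub (by simp [hL])
  have hmeas : Measurable fun y => posVirtual μ y - ENNReal.ofReal r :=
    (measurable_posVirtual μ).sub measurable_const
  have h1 : ∫⁻ y in L, posVirtual μ y ∂μ ≤ ENNReal.ofReal z * μ L := by
    calc ∫⁻ y in L, posVirtual μ y ∂μ
        ≤ ∫⁻ y in L, ((posVirtual μ y - ENNReal.ofReal r) + ENNReal.ofReal r) ∂μ :=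
          lintegral_mono fun y => le_tsub_add
      _ = (∫⁻ y in L, (posVirtual μ y - ENNReal.ofReal r) ∂μ) + ENNReal.ofReal r * μ L := by
          rw [lintegral_add_left hmeas, setLIntegral_const]
      _ ≤ ENNReal.ofReal (b - r) * μ L + ENNReal.ofReal r * μ L := by
          gcongr
          refine (setLIntegral_le_lintegral _ _).trans ?_
          rw [hE, ENNReal.ofReal_mul (by linarith), ofReal_measureReal]
      _ = ENNReal.ofReal b * μ L := by
          rw [← add_mul, ← ENNReal.ofReal_add (by linarith) hr0]; ring_nf
      _ ≤ _ := by gcongr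
  have h7 : ∫⁻ y in W \ L, posVirtual μ y ∂μ ≤ ENNReal.ofReal z * μ (W \ L) := by
    rw [← setLIntegral_const]
    refine setLIntegral_mono' (hW.diff hLm) fun y hy => ?_
    have : buyerVirtual μ y < r := by rw [hrE]; exact not_le.1 hy.2
    exact (posVirtual_le_ofReal this.le).trans (ENNReal.ofReal_le_ofReal (hrb.trans hzb))
  have hWL : (W ∩ L : Set ℝ) =ᵐ[μ] L := by
    filter_upwards [hcl] with y hy
    exact propext ⟨fun h => h.2, fun h => ⟨hy h, h⟩⟩
  rw [← lintegral_inter_add_sdiff _ W hLm, setLIntegral_congr hWL, ← measure_inter_add_sdiff W hLm,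
    measure_congr hWL, mul_add]
  exact add_le_add h1 h7

end Buyer

end Broker

namespace Broker
open Filter Topology

/-! ### Single-parameter mechanisms -/

/-- Tonelli on the region under the graph of `x`: integrating over quantiles `u` first or over types
`z` first. -/
theorem lintegral_lintegral_Ioc {μ : Measure ℝ} [SFinite μ] {B : Set ℝ} (hB : MeasurableSet B)
    {x : ℝ → ℝ} (hx : Measurable x) {G : ℝ → ℝ → ℝ≥0∞} (hG : Measurable (Function.uncurry G)) :
    ∫⁻ z in B, (∫⁻ u in Ioc 0 (x z), G z u) ∂μ =
      ∫⁻ u in Ioi (0 : ℝ), ∫⁻ z in {z | z ∈ B ∧ u ≤ x z}, G z u ∂μ := by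
  have hset : MeasurableSet {w : ℝ × ℝ | w.1 ∈ B ∧ 0 < w.2 ∧ w.2 ≤ x w.1} :=
    (measurable_fst hB).inter ((measurable_snd measurableSet_Ioi).inter
      (measurableSet_le measurable_snd (hx.comp measurable_fst)))
  set H : ℝ → ℝ → ℝ≥0∞ := fun z u =>
    {w : ℝ × ℝ | w.1 ∈ B ∧ 0 < w.2 ∧ w.2 ≤ x w.1}.indicator (Function.uncurry G) (z, u)
    with hH
  have hHm : Measurable (Function.uncurry H) := hG.indicator hset
  have h1 : ∫⁻ z in B, (∫⁻ u in Ioc 0 (x z), G z u) ∂μ = ∫⁻ z, (∫⁻ u, H z u) ∂μ := by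
    rw [← lintegral_indicator hB]
    refine lintegral_congr fun z => ?_
    by_cases hz : z ∈ B
    · simp only [indicator_of_mem hz]
      rw [← lintegral_indicator measurableSet_Ioc]
      refine lintegral_congr fun u => ?_
      simp [hH, indicator, hz]
    · simp [hH, indicator, hz]
  have h2 : ∫⁻ u in Ioi (0 : ℝ), ∫⁻ z in {z | z ∈ B ∧ u ≤ x z}, G z u ∂μ =
      ∫⁻ u, ∫⁻ z, H z u ∂μ := by
    have hAm : ∀ u, MeasurableSet {z | z ∈ B ∧ u ≤ x z} := fun u =>
      hB.inter (measurableSet_le measurable_const hx)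
    rw [← lintegral_indicator measurableSet_Ioi]
    refine lintegral_congr fun u => ?_
    by_cases hu : u ∈ Ioi (0 : ℝ)
    · simp only [indicator_of_mem hu]
      rw [← lintegral_indicator (hAm u)]
      refine lintegral_congr fun z => ?_
      have : 0 < u := hu
      by_cases h : z ∈ B ∧ u ≤ x z
      · simp [hH, h.1, h.2, this]
      · rw [indicator_of_notMem (s := {z | z ∈ B ∧ u ≤ x z}) h]
        exact (indicator_of_notMem (fun h' => h ⟨h'.1, h'.2.2⟩) _).symm
    · have : ¬ 0 < u := hu
      simp [hH, indicator, this]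
  rw [h1, h2, lintegral_lintegral_swap hHm.aemeasurable]

/-- A randomized allocation is a mixture over `u` of deterministic ones that trade on `{x ≥ u}` at
the price `T u`. An inequality for every posted price therefore passes to the mixture, because `f z
* x z` is the integral of `f z` over `(0, x z]`. -/
theorem lintegral_threshold_le {μ : Measure ℝ} [SFinite μ] {B : Set ℝ} (hB : MeasurableSet B)
    {x : ℝ → ℝ} (hx : Measurable x) {T f : ℝ → ℝ≥0∞} (hT : Measurable T) (hf : Measurable f)
    (h : ∀ u, 0 < u → T u * μ {z | z ∈ B ∧ u ≤ x z} ≤ ∫⁻ z in {z | z ∈ B ∧ u ≤ x z}, f z ∂μ) :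
    ∫⁻ z in B, (∫⁻ u in Ioc 0 (x z), T u) ∂μ ≤ ∫⁻ z in B, f z * ENNReal.ofReal (x z) ∂μ := by
  have h1 : ∀ z, f z * ENNReal.ofReal (x z) = ∫⁻ _ in Ioc 0 (x z), f z := fun z => by simp
  simp_rw [h1]
  rw [lintegral_lintegral_Ioc hB hx (G := fun _ u => T u) (hT.comp measurable_snd),
    lintegral_lintegral_Ioc hB hx (G := fun z _ => f z) (hf.comp measurable_fst)]
  refine setLIntegral_mono' measurableSet_Ioi fun u hu => ?_
  rw [setLIntegral_const]
  exact h u hu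

theorem le_lintegral_threshold {μ : Measure ℝ} [SFinite μ] {B : Set ℝ} (hB : MeasurableSet B)
    {x : ℝ → ℝ} (hx : Measurable x) {T f : ℝ → ℝ≥0∞} (hT : Measurable T) (hf : Measurable f)
    (h : ∀ u, 0 < u → ∫⁻ z in {z | z ∈ B ∧ u ≤ x z}, f z ∂μ ≤ T u * μ {z | z ∈ B ∧ u ≤ x z}) :
    ∫⁻ z in B, f z * ENNReal.ofReal (x z) ∂μ ≤ ∫⁻ z in B, (∫⁻ u in Ioc 0 (x z), T u) ∂μ := by
  have h1 : ∀ z, f z * ENNReal.ofReal (x z) = ∫⁻ _ in Ioc 0 (x z), f z := fun z => by simp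
  simp_rw [h1]
  rw [lintegral_lintegral_Ioc hB hx (G := fun _ u => T u) (hT.comp measurable_snd),
    lintegral_lintegral_Ioc hB hx (G := fun z _ => f z) (hf.comp measurable_fst)]
  refine setLIntegral_mono' measurableSet_Ioi fun u hu => ?_
  rw [setLIntegral_const]
  exact h u hu

theorem measurableSet_support (μ : Measure ℝ) : MeasurableSet μ.support :=
  Measure.isClosed_support.measurableSet

theorem ae_mem_support (μ : Measure ℝ) : ∀ᵐ z ∂μ, z ∈ μ.support := Measure.support_mem_ae

theorem setLIntegral_inter_support (μ : Measure ℝ) (W : Set ℝ) (f : ℝ → ℝ≥0∞) :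
    ∫⁻ z in μ.support ∩ W, f z ∂μ = ∫⁻ z in W, f z ∂μ := by
  refine setLIntegral_congr ?_
  filter_upwards [ae_mem_support μ] with z hz
  exact propext ⟨fun h => h.2, fun h => ⟨hz, h⟩⟩

theorem setLIntegral_support (μ : Measure ℝ) (f : ℝ → ℝ≥0∞) :
    ∫⁻ z in μ.support, f z ∂μ = ∫⁻ z, f z ∂μ := by
  have := setLIntegral_inter_support μ univ f
  rwa [inter_univ, Measure.restrict_univ] at this

theorem nonneg_of_mem_support {μ : Measure ℝ} (hμ : μ (Iio 0) = 0) {z : ℝ} (hz : z ∈ μ.support) :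
    0 ≤ z := by
  have := Measure.support_subset_of_isClosed (μ := μ) isClosed_Ici (t := Ici (0 : ℝ)) (by
    rw [mem_ae_iff, compl_Ici]; exact hμ)
  exact this hz

/-- The payments of an incentive-compatible and individually rational procurement mechanism are
on average at least the ironed virtual values of the bought items. -/
theorem lintegral_sellerVirtual_mul_le {μ : Measure ℝ} [IsProbabilityMeasure μ]
    (hμ : μ (Iio 0) = 0) {x p : ℝ → ℝ} (hx : Measurable x) (hx0 : ∀ z ∈ μ.support, 0 ≤ x z)
    (ic : ∀ z ∈ μ.support, ∀ z' ∈ μ.support, p z' - z * x z' ≤ p z - z * x z)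
    (ir : ∀ z ∈ μ.support, 0 ≤ p z - z * x z) :
    ∫⁻ z, sellerVirtual μ z * ENNReal.ofReal (x z) ∂μ ≤ ∫⁻ z, ENNReal.ofReal (p z) ∂μ := by
  set K := μ.support with hK
  have hKm : MeasurableSet K := measurableSet_support μ
  set T : ℝ → ℝ≥0∞ := fun u => ⨆ z ∈ {z | z ∈ K ∧ u ≤ x z}, ENNReal.ofReal z with hT
  have hTanti : Antitone T := fun u u' h =>
    biSup_mono fun z hz => ⟨hz.1, h.trans hz.2⟩
  have hxanti : ∀ z ∈ K, ∀ z' ∈ K, z < z' → x z' ≤ x z := by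
    intro z hz z' hz' h
    have h1 := ic z hz z' hz'
    have h2 := ic z' hz' z hz
    by_contra hcon
    push Not at hcon
    nlinarith
  rw [← setLIntegral_support, ← setLIntegral_support μ fun z => ENNReal.ofReal (p z)]
  refine (le_lintegral_threshold hKm hx hTanti.measurable (measurable_sellerVirtual μ) ?_).trans ?_
  · intro u _
    have hAm : MeasurableSet {z | z ∈ K ∧ u ≤ x z} :=
      hKm.inter (measurableSet_le measurable_const hx)
    -- An infinite threshold leaves nothing to prove unless the set of trading types is null, where
    -- both sides vanish.
    by_cases htop : T u = ⊤
    · rw [htop]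
      by_cases h0 : μ {z | z ∈ K ∧ u ≤ x z} = 0
      · rw [setLIntegral_measure_zero _ _ h0]; exact zero_le
      · rw [ENNReal.top_mul h0]; exact le_top
    rw [← ENNReal.ofReal_toReal htop]
    refine setLIntegral_sellerVirtual_le hμ hAm (fun z hz => ?_) ?_
    · have : ENNReal.ofReal z ≤ T u := le_iSup₂_of_le z hz le_rfl
      exact (ENNReal.ofReal_le_iff_le_toReal htop).1 this
    · filter_upwards [ae_mem_support μ] with y hy hyA a ha
      by_contra h
      exact hyA ⟨hy, ha.2.trans (hxanti y hy a ha.1 (not_le.1 h))⟩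
  · refine setLIntegral_mono' hKm fun s hs => ?_
    -- Thresholds may be infinite, while the payment lemma needs a real-valued function; it is
    -- applied to truncations, followed by monotone convergence.
    have hmin : ∀ u, T u = ⨆ n : ℕ, min (T u) n := fun u => by
      rw [← inf_iSup_eq (T u) (fun n : ℕ => (n : ℝ≥0∞)), ENNReal.iSup_natCast]; simp
    calc ∫⁻ u in Ioc 0 (x s), T u = ∫⁻ u in Ioc 0 (x s), ⨆ n : ℕ, min (T u) n := by
          simp_rw [← hmin]
      _ = ⨆ n : ℕ, ∫⁻ u in Ioc 0 (x s), min (T u) n := by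
          refine lintegral_iSup (fun n => hTanti.measurable.min measurable_const) ?_
          intro n k hnk y
          exact min_le_min_left _ (by exact_mod_cast hnk)
      _ ≤ _ := iSup_le fun n => ?_
    have hfin : ∀ u, min (T u) n ≠ ⊤ := fun u =>
      ne_top_of_le_ne_top (ENNReal.natCast_ne_top n) (min_le_right _ _)
    have hganti : Antitone fun u => (min (T u) n).toReal := fun u u' h =>
      ENNReal.toReal_mono (hfin u) (min_le_min_right _ (hTanti h))
    have := intervalIntegral_le_payment (g := fun u => (min (T u) n).toReal) hs (hx0 s hs) ic ir
      (hganti.antitoneOn _) (by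
        intro u hu r hr
        rcases lt_or_ge r 0 with h0 | h0
        · exact ⟨s, hs, hu.2, h0.le.trans (nonneg_of_mem_support hμ hs)⟩
        · have h1 : ENNReal.ofReal r < T u :=
            lt_of_lt_of_le ((ENNReal.ofReal_lt_iff_lt_toReal h0 (hfin u)).2 hr) (min_le_left _ _)
          obtain ⟨z, hz⟩ := lt_iSup_iff.1 h1
          obtain ⟨hzA, hz⟩ := lt_iSup_iff.1 hz
          exact ⟨z, hzA.1, hzA.2, (ENNReal.ofReal_lt_ofReal_iff_of_nonneg h0).1 hz |>.le⟩)
    rw [intervalIntegral.integral_of_le (hx0 s hs)] at this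
    calc ∫⁻ u in Ioc 0 (x s), min (T u) n
        = ∫⁻ u in Ioc 0 (x s), ENNReal.ofReal (min (T u) n).toReal := by
          simp_rw [ENNReal.ofReal_toReal (hfin _)]
      _ = ENNReal.ofReal (∫ u in Ioc 0 (x s), (min (T u) n).toReal) := by
          rw [ofReal_integral_eq_lintegral_ofReal]
          · refine (intervalIntegrable_iff_integrableOn_Ioc_of_le (hx0 s hs)).1 ?_
            exact hganti.intervalIntegrable
          · exact Eventually.of_forall fun u => ENNReal.toReal_nonneg
      _ ≤ _ := ENNReal.ofReal_le_ofReal this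

/-- The payments of an incentive-compatible and individually rational mechanism on an upward closed
set of values are on average at most the ironed virtual values of the sold items. -/
theorem setLIntegral_payment_le {μ : Measure ℝ} [IsProbabilityMeasure μ] (hμ : μ (Iio 0) = 0)
    (hint : Integrable (fun z : ℝ => z) μ) {W : Set ℝ} (hW : MeasurableSet W)
    (hWup : ∀ z ∈ W, ∀ z', z ≤ z' → z' ∈ W) {x p : ℝ → ℝ} (hx : Measurable x)
    (hx0 : ∀ z ∈ μ.support ∩ W, 0 ≤ x z)
    (ic : ∀ z ∈ μ.support ∩ W, ∀ z' ∈ μ.support ∩ W, z * x z' - p z' ≤ z * x z - p z)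
    (ir : ∀ z ∈ μ.support ∩ W, 0 ≤ z * x z - p z) {c : ℝ≥0∞} (hc : c ≠ ⊤) :
    ∫⁻ z in W, ENNReal.ofReal (p z) ∂μ ≤
      ∫⁻ z in W, ((posVirtual μ z - c) + c) * ENNReal.ofReal (x z) ∂μ := by
  set K := μ.support ∩ W with hK
  have hKm : MeasurableSet K := (measurableSet_support μ).inter hW
  have hK0 : ∀ z ∈ K, 0 ≤ z := fun z hz => nonneg_of_mem_support hμ hz.1
  set T : ℝ → ℝ≥0∞ := fun u => ⨅ z ∈ {z | z ∈ K ∧ u ≤ x z}, ENNReal.ofReal z with hT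
  have hTmono : Monotone T := fun u u' h =>
    biInf_mono fun z hz => ⟨hz.1, h.trans hz.2⟩
  have hxmono : ∀ z ∈ K, ∀ z' ∈ K, z < z' → x z ≤ x z' := by
    intro z hz z' hz' h
    have h1 := ic z hz z' hz'
    have h2 := ic z' hz' z hz
    by_contra hcon
    push Not at hcon
    nlinarith
  rw [← setLIntegral_inter_support, ← setLIntegral_inter_support μ W fun z =>
    ((posVirtual μ z - c) + c) * ENNReal.ofReal (x z)]
  refine le_trans ?_ (lintegral_threshold_le hKm hx hTmono.measurable
    (((measurable_posVirtual μ).sub measurable_const).add measurable_const) ?_)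
  · refine setLIntegral_mono' hKm fun s hs => ?_
    have hfin : ∀ u ≤ x s, T u ≠ ⊤ := fun u hu =>
      ne_top_of_le_ne_top (ENNReal.ofReal_ne_top (r := s)) (iInf₂_le s ⟨hs, hu⟩)
    have hgm : MonotoneOn (fun u => (T u).toReal) (Icc 0 (x s)) := fun u _ u' hu' h =>
      ENNReal.toReal_mono (hfin u' hu'.2) (hTmono h)
    -- A buyer of value `z` is a seller of cost `-z` who is paid `-p`. Lower bounds on payments
    -- become upper bounds, and the smallest winning value becomes the largest trading cost.
    have := intervalIntegral_le_payment (K := {y | -y ∈ K}) (x := fun y => x (-y))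
      (p := fun y => - p (-y)) (g := fun u => - (T u).toReal) (s := -s)
      (by rw [mem_ofPred_eq, neg_neg]; exact hs) (by rw [neg_neg]; exact hx0 s hs)
      (fun z hz z' hz' => by
        have := ic (-z) hz (-z') hz'
        linarith)
      (fun z hz => by
        have := ir (-z) hz
        linarith)
      (by rw [neg_neg]; exact hgm.neg)
      (by
        rw [neg_neg]
        intro u hu r hr
        have h1 : T u < ENNReal.ofReal (-r) := by
          rw [ENNReal.lt_ofReal_iff_toReal_lt (hfin u hu.2)]; linarith
        obtain ⟨z, hz⟩ := iInf_lt_iff.1 h1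
        obtain ⟨hzA, hz⟩ := iInf_lt_iff.1 hz
        have h2 := (ENNReal.ofReal_lt_ofReal_iff_of_nonneg (hK0 z hzA.1)).1 hz
        exact ⟨-z, by simpa using hzA.1, by simpa using hzA.2, by linarith⟩)
    rw [neg_neg, intervalIntegral.integral_neg, neg_le_neg_iff,
      intervalIntegral.integral_of_le (hx0 s hs)] at this
    calc ENNReal.ofReal (p s) ≤ ENNReal.ofReal (∫ u in Ioc 0 (x s), (T u).toReal) :=
          ENNReal.ofReal_le_ofReal this
      _ = ∫⁻ u in Ioc 0 (x s), ENNReal.ofReal (T u).toReal := by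
          rw [ofReal_integral_eq_lintegral_ofReal]
          · refine (intervalIntegrable_iff_integrableOn_Ioc_of_le (hx0 s hs)).1 ?_
            refine MonotoneOn.intervalIntegrable ?_
            rwa [uIcc_of_le (hx0 s hs)]
          · exact Eventually.of_forall fun u => ENNReal.toReal_nonneg
      _ ≤ _ := lintegral_mono fun u => ENNReal.ofReal_toReal_le
  · intro u _
    have hAm : MeasurableSet {z | z ∈ K ∧ u ≤ x z} :=
      hKm.inter (measurableSet_le measurable_const hx)
    rcases {z | z ∈ K ∧ u ≤ x z}.eq_empty_or_nonempty with h0 | ⟨w, hw⟩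
    · rw [h0]; simp
    have htop : T u ≠ ⊤ := ne_top_of_le_ne_top (ENNReal.ofReal_ne_top (r := w)) (iInf₂_le w hw)
    rw [← ENNReal.ofReal_toReal htop]
    refine mul_measure_le_setLIntegral_posVirtual hint hAm (fun z hz => ?_) ?_ hc
    · have : T u ≤ ENNReal.ofReal z := iInf₂_le z hz
      exact (ENNReal.le_ofReal_iff_toReal_le htop (hK0 z hz.1)).1 this
    · filter_upwards [ae_mem_support μ] with y hy hyA a ha
      by_contra h
      push Not at h
      have hyK : y ∈ K := ⟨hy, hWup a ha.1.2 y h.le⟩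
      exact hyA ⟨hyK, ha.2.trans (hxmono a ha.1 y hyK h)⟩

/-- Only an inequality holds in general, since the real `sSup` of an unbounded set is 0. -/
theorem ofReal_sSup_le {A : Set ℝ} : ENNReal.ofReal (sSup A) ≤ ⨆ z ∈ A, ENNReal.ofReal z := by
  by_cases htop : (⨆ z ∈ A, ENNReal.ofReal z) = ⊤
  · rw [htop]; exact le_top
  rw [← ENNReal.ofReal_toReal htop]
  refine ENNReal.ofReal_le_ofReal (Real.sSup_le (fun z hz => ?_) ENNReal.toReal_nonneg)
  exact (ENNReal.ofReal_le_iff_le_toReal htop).1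
    (le_iSup₂_of_le (f := fun z (_ : z ∈ A) => ENNReal.ofReal z) z hz le_rfl)

/-- No integrability is needed: the Bochner integral of a non-integrable function is 0. -/
theorem ofReal_integral_le {α : Type*} [MeasurableSpace α] {μ : Measure α} {f : α → ℝ}
    (hf : ∀ a, 0 ≤ f a) : ENNReal.ofReal (∫ a, f a ∂μ) ≤ ∫⁻ a, ENNReal.ofReal (f a) ∂μ := by
  calc _ ≤ ‖∫ a, f a ∂μ‖ₑ := Real.ofReal_le_enorm _
    _ ≤ ∫⁻ a, ‖f a‖ₑ ∂μ := enorm_integral_le_lintegral_enorm _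
    _ = _ := by simp_rw [Real.enorm_eq_ofReal (hf _)]

/-- The threshold payments of a procurement mechanism whose allocation is a nonincreasing function
of the virtual value are on average at most the virtual values. -/
theorem lintegral_threshold_payment_le {μ : Measure ℝ} [IsProbabilityMeasure μ]
    (hμ : μ (Iio 0) = 0) {x : ℝ → ℝ} (hx : Measurable x) (hx0 : ∀ z, 0 ≤ x z)
    (hanti : ∀ y z, sellerVirtual μ y ≤ sellerVirtual μ z → x z ≤ x y)
    (htop : ∀ z, sellerVirtual μ z = ⊤ → x z ≤ 0) :
    ∫⁻ z, ENNReal.ofReal (∫ u in (0 : ℝ)..x z, sSup {y | y ∈ μ.support ∧ u ≤ x y}) ∂μ ≤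
      ∫⁻ z, sellerVirtual μ z * ENNReal.ofReal (x z) ∂μ := by
  set K := μ.support with hK
  have hKm : MeasurableSet K := measurableSet_support μ
  set T : ℝ → ℝ≥0∞ := fun u => ⨆ z ∈ {z | z ∈ K ∧ u ≤ x z}, ENNReal.ofReal z with hT
  have hTanti : Antitone T := fun u u' h =>
    biSup_mono fun z hz => ⟨hz.1, h.trans hz.2⟩
  rw [← setLIntegral_support,
    ← setLIntegral_support μ fun z => sellerVirtual μ z * ENNReal.ofReal (x z)]
  refine le_trans ?_ (lintegral_threshold_le hKm hx hTanti.measurable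
    (measurable_sellerVirtual μ) ?_)
  · refine lintegral_mono fun z => ?_
    rw [intervalIntegral.integral_of_le (hx0 z)]
    refine (ofReal_integral_le fun u => ?_).trans (lintegral_mono fun u => ofReal_sSup_le)
    exact Real.sSup_nonneg fun y hy => nonneg_of_mem_support hμ hy.1
  · intro u hu
    have hAm : MeasurableSet {z | z ∈ K ∧ u ≤ x z} :=
      hKm.inter (measurableSet_le measurable_const hx)
    -- The supremum is handled one value `z` at a time: since `x z ≥ u > 0`, its virtual value is
    -- finite, and every type of no larger virtual value also trades at `u`.
    simp only [hT, ENNReal.iSup_mul]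
    refine iSup₂_le fun z hz => ?_
    refine mul_measure_le_setLIntegral_sellerVirtual hμ hAm (z := z) (fun h => ?_) ?_
    · have := htop z h
      linarith [hz.2]
    · filter_upwards [ae_mem_support μ] with y hy hyz
      exact ⟨hy, hz.2.trans (hanti y z hyz)⟩

end Broker

namespace Broker
open Filter Topology

/-! ### Resampling one coordinate of a product -/

section Update

variable {ι : Type*} [Fintype ι] [DecidableEq ι] {α : ι → Type*} [∀ i, MeasurableSpace (α i)]

/-- Replacing one coordinate by an independent copy preserves a product law. This gives conditional
expectations given the other coordinates without splitting the product. -/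
theorem measurePreserving_update (μ : ∀ i, Measure (α i)) [∀ i, IsProbabilityMeasure (μ i)]
    (j : ι) : MeasurePreserving (fun w : (∀ i, α i) × α j => Function.update w.1 j w.2)
      ((Measure.pi μ).prod (μ j)) (Measure.pi μ) := by
  refine ⟨measurable_update', ?_⟩
  symm
  refine Measure.pi_eq fun s hs => ?_
  rw [Measure.map_apply measurable_update' (MeasurableSet.univ_pi hs)]
  have : (fun w : (∀ i, α i) × α j => Function.update w.1 j w.2) ⁻¹' (univ.pi s) =
      (univ.pi (Function.update s j univ)) ×ˢ s j := by
    ext w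
    simp only [mem_preimage, Set.mem_pi, mem_univ, true_imp_iff, mem_prod]
    constructor
    · intro h
      refine ⟨fun i => ?_, by simpa using h j⟩
      by_cases hij : i = j
      · subst hij; simp
      · simpa [hij] using h i
    · rintro ⟨h1, h2⟩ i
      by_cases hij : i = j
      · subst hij; simpa using h2
      · simpa [hij] using h1 i
  rw [this, Measure.prod_prod, Measure.pi_pi, ← Finset.mul_prod_erase Finset.univ _ (Finset.mem_univ j),
    ← Finset.mul_prod_erase Finset.univ (fun i => μ i (s i)) (Finset.mem_univ j)]
  simp only [Function.update_self, measure_univ, one_mul]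
  rw [mul_comm]
  congr 1
  refine Finset.prod_congr rfl fun i hi => ?_
  rw [Function.update_of_ne (Finset.ne_of_mem_erase hi)]

theorem lintegral_pi_update (μ : ∀ i, Measure (α i)) [∀ i, IsProbabilityMeasure (μ i)]
    (j : ι) {f : (∀ i, α i) → ℝ≥0∞} (hf : Measurable f) :
    ∫⁻ w, f w ∂Measure.pi μ = ∫⁻ w, ∫⁻ z, f (Function.update w j z) ∂μ j ∂Measure.pi μ := by
  rw [← (measurePreserving_update μ j).lintegral_comp hf, lintegral_prod]
  exact (hf.comp measurable_update').aemeasurable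

end Update

/-! ### Measurability of extrema -/

/-- A countable dense subset suffices except for the maximum of `K`, if there is one, which is added
by hand. It turns uncountable unions of monotone conditions into countable ones. -/
theorem exists_countable_cofinal (K : Set ℝ) : ∃ C ⊆ K, C.Countable ∧ ∀ z ∈ K, ∃ c ∈ C, z ≤ c := by
  obtain ⟨D, hDc, hD⟩ := TopologicalSpace.exists_countable_dense K
  refine ⟨Subtype.val '' D ∪ {z | IsGreatest K z}, ?_, ?_, ?_⟩
  · rintro z (⟨⟨z, hz⟩, -, rfl⟩ | hz)
    · exact hz
    · exact hz.1
  · refine (hDc.image _).union (Set.Subsingleton.countable ?_)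
    intro a ha b hb
    exact ha.unique hb
  · intro z hz
    by_cases h : ∃ z' ∈ K, z < z'
    · obtain ⟨z', hz', hlt⟩ := h
      obtain ⟨c, hc, hcD⟩ := hD.exists_mem_open (U := {y : K | z < y})
        (isOpen_lt continuous_const continuous_subtype_val) ⟨⟨z', hz'⟩, hlt⟩
      exact ⟨c, Or.inl ⟨c, hc, rfl⟩, le_of_lt hcD⟩
    · push Not at h
      exact ⟨z, Or.inr ⟨hz, h⟩, le_rfl⟩

/-- The infimum of an upward closed part of a fixed set of reals depends measurably on the part. -/
theorem measurable_sInf_of_upClosed {α : Type*} [MeasurableSpace α] {K : Set ℝ} {S : α → Set ℝ}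
    (hS : ∀ a, ∀ z ∈ K, ∀ z' ∈ K, z ≤ z' → z ∈ S a → z' ∈ S a)
    (hm : ∀ z, MeasurableSet {a | z ∈ S a}) :
    Measurable fun a => sInf {z | z ∈ K ∧ z ∈ S a} := by
  -- By upward closedness it is enough to test the `z` in a countable cofinal subset of `K ∩ Iio q`.
  have hlt : ∀ q : ℝ, MeasurableSet {a | ∃ z ∈ K, z < q ∧ z ∈ S a} := by
    intro q
    obtain ⟨C, hCK, hCc, hC⟩ := exists_countable_cofinal (K ∩ Iio q)
    have : {a | ∃ z ∈ K, z < q ∧ z ∈ S a} = ⋃ z ∈ C, {a | z ∈ S a} := by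
      ext a
      simp only [mem_iUnion, mem_ofPred_eq, exists_prop]
      constructor
      · rintro ⟨z, hzK, hzq, hz⟩
        obtain ⟨c, hc, hzc⟩ := hC z ⟨hzK, hzq⟩
        exact ⟨c, hc, hS a z hzK c (hCK hc).1 hzc hz⟩
      · rintro ⟨z, hzC, hz⟩
        exact ⟨z, (hCK hzC).1, (hCK hzC).2, hz⟩
    rw [this]
    exact MeasurableSet.biUnion hCc fun z _ => hm z
  -- Off `N` the set is empty or unbounded below and `sInf` takes its default value 0, so the two
  -- cases are measured separately.
  set N : Set α := {a | ({z | z ∈ K ∧ z ∈ S a}).Nonempty ∧ BddBelow {z | z ∈ K ∧ z ∈ S a}} with hN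
  have hNm : MeasurableSet N := by
    have : N = (⋃ n : ℕ, {a | ∃ z ∈ K, z < n ∧ z ∈ S a}) ∩
        ⋃ n : ℕ, {a | ∃ z ∈ K, z < -(n : ℝ) ∧ z ∈ S a}ᶜ := by
      ext a
      simp only [hN, mem_inter_iff, mem_iUnion, mem_compl_iff, mem_ofPred_eq]
      refine and_congr ⟨?_, ?_⟩ ⟨?_, ?_⟩
      · rintro ⟨z, hz⟩
        obtain ⟨n, hn⟩ := exists_nat_gt z
        exact ⟨n, z, hz.1, hn, hz.2⟩
      · rintro ⟨n, z, h1, -, h2⟩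
        exact ⟨z, h1, h2⟩
      · rintro ⟨b, hb⟩
        obtain ⟨n, hn⟩ := exists_nat_gt (-b)
        refine ⟨n, ?_⟩
        rintro ⟨z, h1, h2, h3⟩
        have : b ≤ z := hb ⟨h1, h3⟩
        linarith
      · rintro ⟨n, hn⟩
        refine ⟨-(n : ℝ), fun z hz => ?_⟩
        by_contra h
        exact hn ⟨z, hz.1, not_le.1 h, hz.2⟩
    rw [this]
    exact (MeasurableSet.iUnion fun n => hlt _).inter (MeasurableSet.iUnion fun n => (hlt _).compl)
  refine measurable_of_Iio fun q => ?_
  have hpre : (fun a => sInf {z | z ∈ K ∧ z ∈ S a}) ⁻¹' Iio q =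
      (N ∩ {a | ∃ z ∈ K, z < q ∧ z ∈ S a}) ∪ (Nᶜ ∩ {_a | 0 < q}) := by
    ext a
    simp only [mem_preimage, mem_Iio, mem_union, mem_inter_iff, mem_compl_iff, mem_ofPred_eq]
    by_cases ha : a ∈ N
    · simp only [ha, true_and, not_true_eq_false, false_and, or_false]
      rw [csInf_lt_iff ha.2 ha.1]
      constructor
      · rintro ⟨z, hz, hzq⟩; exact ⟨z, hz.1, hzq, hz.2⟩
      · rintro ⟨z, h1, h2, h3⟩; exact ⟨z, ⟨h1, h3⟩, h2⟩
    · simp only [ha, false_and, not_false_eq_true, true_and, false_or]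
      have : sInf {z | z ∈ K ∧ z ∈ S a} = 0 := by
        by_cases hne : ({z | z ∈ K ∧ z ∈ S a}).Nonempty
        · exact Real.sInf_of_not_bddBelow fun h => ha ⟨hne, h⟩
        · rw [not_nonempty_iff_eq_empty.1 hne, Real.sInf_empty]
      rw [this]
  rw [hpre]
  exact (hNm.inter (hlt q)).union (hNm.compl.inter (MeasurableSet.const _))

theorem measurable_sSup_of_downClosed {α : Type*} [MeasurableSpace α] {K : Set ℝ} {S : α → Set ℝ}
    (hS : ∀ a, ∀ z ∈ K, ∀ z' ∈ K, z ≤ z' → z' ∈ S a → z ∈ S a)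
    (hm : ∀ z, MeasurableSet {a | z ∈ S a}) :
    Measurable fun a => sSup {z | z ∈ K ∧ z ∈ S a} := by
  have := (measurable_sInf_of_upClosed (K := -K) (S := fun a => -S a)
    (fun a z hz z' hz' h hzS => hS a (-z') hz' (-z) hz (neg_le_neg h) hzS)
    (fun z => hm (-z))).neg
  convert this using 2 with a
  rw [Pi.neg_apply, Real.sInf_def, neg_neg]
  congr 1
  ext z
  simp

/-! ### The market -/

section Market

variable {n m : ℕ} (I : Market n m)

instance (i : Fin n) (j : Fin m) : IsProbabilityMeasure (I.DB i j) := I.probB i j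

instance (j : Fin m) : IsProbabilityMeasure (I.DS j) := I.probS j

instance : IsProbabilityMeasure I.distB := by unfold Market.distB; infer_instance

instance : IsProbabilityMeasure I.distS := by unfold Market.distS; infer_instance

/-- Replace the value of buyer `i` for item `j`. -/
def setValue (v : BProfile n m) (i : Fin n) (j : Fin m) (z : ℝ) : BProfile n m :=
  Function.update v i (Function.update (v i) j z)

theorem setValue_self (v : BProfile n m) (i : Fin n) (j : Fin m) (z : ℝ) :
    setValue v i j z i j = z := by simp [setValue]

theorem setValue_of_ne (v : BProfile n m) {i k : Fin n} (j l : Fin m) (z : ℝ) (h : k ≠ i) :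
    setValue v i j z k l = v k l := by simp [setValue, h]

theorem setValue_row (v : BProfile n m) (i : Fin n) (j : Fin m) (z : ℝ) :
    setValue v i j z i = Function.update (v i) j z := by simp [setValue]

theorem setValue_of_ne_item (v : BProfile n m) (i k : Fin n) {j l : Fin m} (z : ℝ) (h : l ≠ j) :
    setValue v i j z k l = v k l := by
  by_cases hk : k = i
  · subst hk; simp [setValue, h]
  · exact setValue_of_ne v j l z hk

theorem measurable_setValue (i : Fin n) (j : Fin m) :
    Measurable fun w : BProfile n m × ℝ => setValue w.1 i j w.2 := by
  refine measurable_pi_iff.2 fun k => measurable_pi_iff.2 fun l => ?_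
  by_cases hk : k = i
  · subst hk
    by_cases hl : l = j
    · subst hl; simpa only [setValue_self] using measurable_snd
    · simp only [setValue_of_ne_item _ _ _ _ hl]; fun_prop
  · simp only [setValue_of_ne _ _ _ _ hk]; fun_prop

theorem lintegral_distB_row (i : Fin n) {f : BProfile n m → ℝ≥0∞} (hf : Measurable f) :
    ∫⁻ v, f v ∂I.distB =
      ∫⁻ v, ∫⁻ t, f (Function.update v i t) ∂(Measure.pi fun j => I.DB i j) ∂I.distB :=
  lintegral_pi_update _ i hf

theorem lintegral_distB_value (i : Fin n) (j : Fin m) {f : BProfile n m → ℝ≥0∞}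
    (hf : Measurable f) :
    ∫⁻ v, f v ∂I.distB = ∫⁻ v, ∫⁻ z, f (setValue v i j z) ∂(I.DB i j) ∂I.distB := by
  have hF : Measurable fun v => ∫⁻ z, f (setValue v i j z) ∂(I.DB i j) :=
    (hf.comp (measurable_setValue i j)).lintegral_prod_right'
  rw [lintegral_distB_row I i hf, lintegral_distB_row I i hF]
  refine lintegral_congr fun v => ?_
  have : Measurable fun t : Fin m → ℝ => f (Function.update v i t) :=
    hf.comp (measurable_update v)
  rw [lintegral_pi_update (fun j => I.DB i j) j this]
  simp [setValue]

/-! ### Comparing expectations by resampling one agent -/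

variable {f g : BProfile n m × SProfile m → ℝ≥0∞}

/-- To compare two expectations it is enough to compare them conditionally on all values but one,
which reduces statements about the market to single-parameter ones. -/
theorem lintegral_dist_mono_value (hf : Measurable f) (hg : Measurable g) (i : Fin n) (j : Fin m)
    (h : ∀ᵐ w ∂I.dist, ∫⁻ z, f (setValue w.1 i j z, w.2) ∂(I.DB i j) ≤
      ∫⁻ z, g (setValue w.1 i j z, w.2) ∂(I.DB i j)) :
    ∫⁻ w, f w ∂I.dist ≤ ∫⁻ w, g w ∂I.dist := by
  have key : ∀ {f : BProfile n m × SProfile m → ℝ≥0∞}, Measurable f →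
      ∫⁻ w, f w ∂I.dist = ∫⁻ w, ∫⁻ z, f (setValue w.1 i j z, w.2) ∂(I.DB i j) ∂I.dist := by
    intro f hf
    have hF : Measurable fun w : BProfile n m × SProfile m =>
        ∫⁻ z, f (setValue w.1 i j z, w.2) ∂(I.DB i j) := by
      refine Measurable.lintegral_prod_right' (f := fun q : (BProfile n m × SProfile m) × ℝ =>
        f (setValue q.1.1 i j q.2, q.1.2)) ?_
      exact hf.comp (((measurable_setValue i j).comp
        ((measurable_fst.comp measurable_fst).prodMk measurable_snd)).prodMk
        (measurable_snd.comp measurable_fst))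
    unfold Market.dist
    rw [lintegral_prod_symm _ hf.aemeasurable, lintegral_prod_symm _ hF.aemeasurable]
    refine lintegral_congr fun s => ?_
    exact lintegral_distB_value I i j (hf.comp measurable_prodMk_right)
  rw [key hf, key hg]
  exact lintegral_mono_ae h

theorem lintegral_dist_mono_row (hf : Measurable f) (hg : Measurable g) (i : Fin n)
    (h : ∀ᵐ w ∂I.dist, ∫⁻ t, f (Function.update w.1 i t, w.2) ∂(Measure.pi fun j => I.DB i j) ≤
      ∫⁻ t, g (Function.update w.1 i t, w.2) ∂(Measure.pi fun j => I.DB i j)) :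
    ∫⁻ w, f w ∂I.dist ≤ ∫⁻ w, g w ∂I.dist := by
  have key : ∀ {f : BProfile n m × SProfile m → ℝ≥0∞}, Measurable f →
      ∫⁻ w, f w ∂I.dist = ∫⁻ w, ∫⁻ t, f (Function.update w.1 i t, w.2)
        ∂(Measure.pi fun j => I.DB i j) ∂I.dist := by
    intro f hf
    have hF : Measurable fun w : BProfile n m × SProfile m =>
        ∫⁻ t, f (Function.update w.1 i t, w.2) ∂(Measure.pi fun j => I.DB i j) := by
      refine Measurable.lintegral_prod_right' (f := fun q : (BProfile n m × SProfile m) ×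
        (Fin m → ℝ) => f (Function.update q.1.1 i q.2, q.1.2)) ?_
      have h1 : Measurable fun q : (BProfile n m × SProfile m) × (Fin m → ℝ) =>
          Function.update q.1.1 i q.2 :=
        (measurable_update' (X := fun _ : Fin n => Fin m → ℝ) (a := i)).comp
        ((measurable_fst.comp measurable_fst).prodMk measurable_snd)
      exact hf.comp (h1.prodMk (measurable_snd.comp measurable_fst))
    unfold Market.dist
    rw [lintegral_prod_symm _ hf.aemeasurable, lintegral_prod_symm _ hF.aemeasurable]
    refine lintegral_congr fun s => ?_
    exact lintegral_distB_row I i (hf.comp measurable_prodMk_right)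
  rw [key hf, key hg]
  exact lintegral_mono_ae h

theorem lintegral_dist_mono_seller (hf : Measurable f) (hg : Measurable g) (j : Fin m)
    (h : ∀ᵐ w ∂I.dist, ∫⁻ z, f (w.1, Function.update w.2 j z) ∂(I.DS j) ≤
      ∫⁻ z, g (w.1, Function.update w.2 j z) ∂(I.DS j)) :
    ∫⁻ w, f w ∂I.dist ≤ ∫⁻ w, g w ∂I.dist := by
  have key : ∀ {f : BProfile n m × SProfile m → ℝ≥0∞}, Measurable f →
      ∫⁻ w, f w ∂I.dist = ∫⁻ w, ∫⁻ z, f (w.1, Function.update w.2 j z) ∂(I.DS j) ∂I.dist := by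
    intro f hf
    have hF : Measurable fun w : BProfile n m × SProfile m =>
        ∫⁻ z, f (w.1, Function.update w.2 j z) ∂(I.DS j) := by
      refine Measurable.lintegral_prod_right' (f := fun q : (BProfile n m × SProfile m) × ℝ =>
        f (q.1.1, Function.update q.1.2 j q.2)) ?_
      have h1 : Measurable fun q : (BProfile n m × SProfile m) × ℝ =>
          Function.update q.1.2 j q.2 :=
        (measurable_update' (X := fun _ : Fin m => ℝ) (a := j)).comp
        ((measurable_snd.comp measurable_fst).prodMk measurable_snd)
      exact hf.comp ((measurable_fst.comp measurable_fst).prodMk h1)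
    unfold Market.dist
    rw [lintegral_prod _ hf.aemeasurable, lintegral_prod _ hF.aemeasurable]
    refine lintegral_congr fun v => ?_
    exact lintegral_pi_update (fun j => I.DS j) j (hf.comp measurable_prodMk_left)
  rw [key hf, key hg]
  exact lintegral_mono_ae h

theorem measurePreserving_value (i : Fin n) (j : Fin m) :
    MeasurePreserving (fun w : BProfile n m × SProfile m => w.1 i j) I.dist (I.DB i j) :=
  ((measurePreserving_eval (fun j => I.DB i j) j).comp
    (measurePreserving_eval (fun i => Measure.pi fun j => I.DB i j) i)).comp
    measurePreserving_fst

theorem measurePreserving_sellerValue (j : Fin m) :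
    MeasurePreserving (fun w : BProfile n m × SProfile m => w.2 j) I.dist (I.DS j) :=
  (measurePreserving_eval (fun j => I.DS j) j).comp measurePreserving_snd

theorem ae_mem_TB_TS : ∀ᵐ w ∂I.dist, w.1 ∈ I.TB ∧ w.2 ∈ I.TS := by
  have h1 : ∀ᵐ w ∂I.dist, ∀ i j, w.1 i j ∈ (I.DB i j).support := by
    simp only [ae_all_iff]
    intro i j
    exact (measurePreserving_value I i j).quasiMeasurePreserving.ae (ae_mem_support _)
  have h2 : ∀ᵐ w ∂I.dist, ∀ j, w.2 j ∈ (I.DS j).support := by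
    simp only [ae_all_iff]
    intro j
    exact (measurePreserving_sellerValue I j).quasiMeasurePreserving.ae (ae_mem_support _)
  filter_upwards [h1, h2] with w h1 h2
  exact ⟨h1, h2⟩

/-- Posting the price `k` to `Iic k` costs at least the integral of the virtual value there, so that
integral is finite for every `k`. -/
theorem ae_sellerVirtual_ne_top {μ : Measure ℝ} [IsProbabilityMeasure μ] (hμ : μ (Iio 0) = 0) :
    ∀ᵐ z ∂μ, sellerVirtual μ z ≠ ⊤ := by
  have h : ∀ k : ℕ, ∀ᵐ z ∂μ, z ∈ Iic (k : ℝ) → sellerVirtual μ z < ⊤ := by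
    intro k
    rw [← ae_restrict_iff' measurableSet_Iic]
    refine ae_lt_top (measurable_sellerVirtual μ) ?_
    refine ne_top_of_le_ne_top ?_ (setLIntegral_sellerVirtual_le hμ measurableSet_Iic
      (t := k) subset_rfl (Eventually.of_forall fun y hy a ha => ?_))
    · finiteness
    · exact (show a ≤ k from ha).trans (not_le.1 hy).le
  filter_upwards [ae_all_iff.2 h] with z hz
  obtain ⟨k, hk⟩ := exists_nat_ge z
  exact (hz k hk).ne

/-- The costs that the sellers' virtual values define. -/
noncomputable def virtualCosts (s : SProfile m) : Costs m :=
  fun k => sellerVirtual (I.DS k) (s k)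

theorem measurable_virtualCosts : Measurable (virtualCosts I) :=
  measurable_pi_iff.2 fun k => (measurable_sellerVirtual _).comp (measurable_pi_apply k)

theorem ae_virtualCosts_ne_top : ∀ᵐ w ∂I.dist, ∀ j, virtualCosts I w.2 j ≠ ⊤ := by
  rw [ae_all_iff]
  intro j
  exact (measurePreserving_sellerValue I j).quasiMeasurePreserving.ae
    (ae_sellerVirtual_ne_top (I.nonnegS j))

variable {I}

theorem nonneg_of_mem_TB {v : BProfile n m} (hv : v ∈ I.TB) (i : Fin n) (j : Fin m) : 0 ≤ v i j :=
  nonneg_of_mem_support (I.nonnegB i j) (hv i j)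

theorem setValue_mem_TB {v : BProfile n m} (hv : v ∈ I.TB) {i : Fin n} {j : Fin m} {z : ℝ}
    (hz : z ∈ (I.DB i j).support) : setValue v i j z ∈ I.TB := by
  intro k l
  by_cases hk : k = i
  · subst hk
    by_cases hl : l = j
    · subst hl; rwa [setValue_self]
    · rw [setValue_of_ne_item _ _ _ _ hl]; exact hv k l
  · rw [setValue_of_ne _ _ _ _ hk]; exact hv k l

theorem update_mem_TS {s : SProfile m} (hs : s ∈ I.TS) {j : Fin m} {z : ℝ}
    (hz : z ∈ (I.DS j).support) : Function.update s j z ∈ I.TS := by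
  intro k
  by_cases hk : k = j
  · subst hk; simpa using hz
  · simpa [hk] using hs k

end Market

end Broker

namespace Broker
open Filter Topology

/-! ### First maxima and indicator sums -/

theorem IsFirstMax.unique {n : ℕ} {α : Type*} [LinearOrder α] {w : Fin n → α} {i k : Fin n}
    (hi : IsFirstMax w i) (hk : IsFirstMax w k) : i = k := by
  rcases lt_trichotomy i k with h | h | h
  · exact absurd (hi.1 k) (not_le.2 (hk.2 i h))
  · exact h
  · exact absurd (hk.1 i) (not_le.2 (hi.2 k h))

theorem exists_isFirstMax {n : ℕ} {α : Type*} [LinearOrder α] (w : Fin n → α) (i₀ : Fin n) :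
    ∃ i, IsFirstMax w i := by
  classical
  obtain ⟨k, -, hk⟩ := Finset.exists_max_image Finset.univ w ⟨i₀, Finset.mem_univ _⟩
  have hne : (Finset.univ.filter fun i => ∀ k, w k ≤ w i).Nonempty :=
    ⟨k, by simpa using fun l => hk l (Finset.mem_univ _)⟩
  set i := Finset.min' _ hne with hi
  have him : ∀ k, w k ≤ w i := by simpa using Finset.min'_mem _ hne
  refine ⟨i, him, fun l hl => lt_of_le_of_ne (him l) fun h => ?_⟩
  have : i ≤ l := Finset.min'_le _ _ (by simpa [h] using him)
  exact absurd hl (not_lt.2 this)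

theorem IsFirstMax.update_mono {n : ℕ} {α : Type*} [LinearOrder α] {w w' : Fin n → α} {i : Fin n}
    (h : IsFirstMax w i) (hi : w i ≤ w' i) (hk : ∀ k, k ≠ i → w' k = w k) : IsFirstMax w' i := by
  constructor
  · intro k
    by_cases hki : k = i
    · rw [hki]
    · rw [hk k hki]; exact (h.1 k).trans hi
  · intro k hlt
    rw [hk k hlt.ne]; exact (h.2 k hlt).trans_le hi

open Classical in
theorem sum_ite_of_unique {n : ℕ} {P : Fin n → Prop} (h : ∀ i k, P i → P k → i = k) :
    (∑ i, if P i then (1 : ℝ) else 0) = if ∃ i, P i then 1 else 0 := by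
  by_cases hex : ∃ i, P i
  · obtain ⟨i, hi⟩ := hex
    rw [if_pos ⟨i, hi⟩, Finset.sum_eq_single i]
    · simp [hi]
    · intro k _ hki
      exact if_neg fun hk => hki (h k i hk hi)
    · simp
  · rw [if_neg hex]
    push Not at hex
    exact Finset.sum_eq_zero fun i _ => if_neg (hex i)

section

variable {n m : ℕ} {I : Market n m} {c : Costs m} {v : BProfile n m} {i : Fin n} {j : Fin m}

/-! ### The item-wise mechanism -/

theorem ITWins.unique {k : Fin n} (hi : ITWins I c v i j) (hk : ITWins I c v k j) : i = k :=
  hi.1.unique hk.1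

open Classical in
theorem sold_MIT (I : Market n m) (c : Costs m) (v : BProfile n m) (j : Fin m) :
    (MIT I).sold c v j = if ∃ i, ITWins I c v i j then 1 else 0 :=
  sum_ite_of_unique fun _ _ hi hk => hi.unique hk

theorem ITWins_congr {c' : Costs m} {v' : BProfile n m} (hc : c j = c' j)
    (h : ∀ k, v k j = v' k j) : ITWins I c v i j ↔ ITWins I c' v' i j := by
  unfold ITWins
  simp_rw [h, hc]

theorem ITWins_setValue_mono {z z' : ℝ} (hz : z ≤ z') (h : ITWins I c (setValue v i j z) i j) :
    ITWins I c (setValue v i j z') i j := by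
  have hmono : buyerVirtual (I.DB i j) (setValue v i j z i j) ≤
      buyerVirtual (I.DB i j) (setValue v i j z' i j) := by
    rw [setValue_self, setValue_self]; exact buyerVirtual_mono _ hz
  refine ⟨h.1.update_mono hmono fun k hk => ?_, h.2.trans hmono⟩
  rw [setValue_of_ne _ _ _ _ hk, setValue_of_ne _ _ _ _ hk]

theorem ITPrice_eq (I : Market n m) (c : Costs m) (v : BProfile n m) (i : Fin n) (j : Fin m) :
    ITPrice I c v i j =
      sInf {z | z ∈ (I.DB i j).support ∧ ITWins I c (setValue v i j z) i j} := rfl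

theorem ITPrice_congr {v' : BProfile n m} (h : ∀ k, k ≠ i → v k j = v' k j) :
    ITPrice I c v i j = ITPrice I c v' i j := by
  rw [ITPrice_eq, ITPrice_eq]
  congr 1
  ext z
  refine and_congr_right fun _ => ITWins_congr rfl fun k => ?_
  by_cases hk : k = i
  · subst hk; rw [setValue_self, setValue_self]
  · rw [setValue_of_ne _ _ _ _ hk, setValue_of_ne _ _ _ _ hk, h k hk]

theorem ITWins_setValue_self : ITWins I c (setValue v i j (v i j)) i j ↔ ITWins I c v i j := by
  refine ITWins_congr rfl fun k => ?_
  by_cases hk : k = i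
  · subst hk; rw [setValue_self]
  · rw [setValue_of_ne _ _ _ _ hk]

theorem ITPrice_le {z : ℝ} (hz : z ∈ (I.DB i j).support) (h : ITWins I c (setValue v i j z) i j) :
    ITPrice I c v i j ≤ z :=
  csInf_le ⟨0, fun _ hy => nonneg_of_mem_support (I.nonnegB i j) hy.1⟩ ⟨hz, h⟩

theorem le_ITPrice {z z' : ℝ} (hz' : z' ∈ (I.DB i j).support)
    (h' : ITWins I c (setValue v i j z') i j) (h : ¬ ITWins I c (setValue v i j z) i j) :
    z ≤ ITPrice I c v i j := by
  refine le_csInf ⟨z', hz', h'⟩ fun y hy => ?_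
  by_contra hlt
  exact h (ITWins_setValue_mono (not_le.1 hlt).le hy.2)

theorem ITPrice_nonneg : 0 ≤ ITPrice I c v i j :=
  Real.sInf_nonneg fun _ hz => nonneg_of_mem_support (I.nonnegB i j) hz.1

theorem sold_MIT_anti (I : Market n m) {c c' : Costs m} (hj : c j ≤ c' j) (v : BProfile n m) :
    (MIT I).sold c' v j ≤ (MIT I).sold c v j := by
  classical
  rw [sold_MIT, sold_MIT]
  by_cases h : ∃ i, ITWins I c' v i j
  · obtain ⟨i, hi⟩ := h
    have h' : ∃ i, ITWins I c v i j :=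
      ⟨i, hi.1, (EReal.coe_ennreal_le_coe_ennreal_iff.2 hj).trans hi.2⟩
    rw [if_pos ⟨i, hi⟩, if_pos h']
  · rw [if_neg h]; split_ifs <;> norm_num

/-- Utility of buyer `i` with true values `w` in a production-cost mechanism. -/
def CostMechanism.utility (M : CostMechanism n m) (c : Costs m) (i : Fin n) (w : Fin m → ℝ)
    (v : BProfile n m) : ℝ := ∑ j, M.x c v i j * w j - M.p c v i

open Classical in
theorem utility_MIT (I : Market n m) (c : Costs m) (i : Fin n) (w : Fin m → ℝ)
    (v : BProfile n m) : (MIT I).utility c i w v =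
      ∑ j, if ITWins I c v i j then w j - ITPrice I c v i j else 0 := by
  unfold CostMechanism.utility MIT
  rw [← Finset.sum_sub_distrib]
  refine Finset.sum_congr rfl fun j _ => ?_
  by_cases h : ITWins I c v i j <;> simp [h]

theorem utility_MIT_nonneg (hv : v ∈ I.TB) : 0 ≤ (MIT I).utility c i (v i) v := by
  rw [utility_MIT]
  refine Finset.sum_nonneg fun j _ => ?_
  split_ifs with h
  · exact sub_nonneg.2 (ITPrice_le (hv i j) (ITWins_setValue_self.2 h))
  · exact le_rfl

/-- The threshold price of an item does not depend on the buyer's own report, and she wins when her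
value is above it. The comparison is made item by item, utilities being additive. -/
theorem utility_MIT_dsic (hv : v ∈ I.TB) {w : Fin m → ℝ} (hw : w ∈ I.TBi i) :
    (MIT I).utility c i (v i) (Function.update v i w) ≤ (MIT I).utility c i (v i) v := by
  rw [utility_MIT, utility_MIT]
  refine Finset.sum_le_sum fun j _ => ?_
  have h1 : ITWins I c (Function.update v i w) i j ↔ ITWins I c (setValue v i j (w j)) i j := by
    refine ITWins_congr rfl fun k => ?_
    by_cases hk : k = i
    · subst hk; simp [setValue]
    · rw [setValue_of_ne _ _ _ _ hk]; simp [hk]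
  have h2 : ITPrice I c (Function.update v i w) i j = ITPrice I c v i j :=
    ITPrice_congr fun k hk => by simp [hk]
  rw [h2]
  by_cases hvw : ITWins I c v i j
  · rw [if_pos hvw]
    have := ITPrice_le (hv i j) (ITWins_setValue_self.2 hvw)
    split_ifs <;> linarith
  · rw [if_neg hvw]
    split_ifs with h
    · have := le_ITPrice (hw j) (h1.1 h) (fun h' => hvw (ITWins_setValue_self.1 h'))
      linarith
    · exact le_rfl

theorem p_MIT_nonneg : 0 ≤ (MIT I).p c v i := by
  unfold MIT
  dsimp only
  refine Finset.sum_nonneg fun j _ => ?_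
  split_ifs
  · exact ITPrice_nonneg
  · exact le_rfl

/-! ### Medians -/

section Median

variable {α : Type*} [MeasurableSpace α] (ν : Measure α) [IsProbabilityMeasure ν] {X : α → ℝ}

/-- Tail probabilities tend to 0, so they are below one half from some level on. -/
theorem bddAbove_median (hX : Measurable X) :
    BddAbove {e : ℝ | 1 / 2 ≤ ν {t | e ≤ X t}} := by
  have h : Tendsto (fun k : ℕ => ν {t | (k : ℝ) ≤ X t}) atTop (𝓝 (ν (⋂ k : ℕ, {t | (k : ℝ) ≤ X t}))) :=
    tendsto_measure_iInter_atTop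
      (fun k => (measurableSet_le measurable_const hX).nullMeasurableSet)
      (fun k l hkl t (ht : (l : ℝ) ≤ X t) => le_trans (by exact_mod_cast hkl) ht)
      ⟨0, measure_ne_top _ _⟩
  have h0 : (⋂ k : ℕ, {t | (k : ℝ) ≤ X t}) = ∅ := by
    refine eq_empty_of_forall_notMem fun t ht => ?_
    obtain ⟨k, hk⟩ := exists_nat_gt (X t)
    have : (k : ℝ) ≤ X t := mem_iInter.1 ht k
    linarith
  rw [h0, measure_empty] at h
  obtain ⟨k, hk⟩ := (h.eventually_lt_const (show (0 : ℝ≥0∞) < 1 / 2 by simp)).exists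
  refine ⟨k, fun e he => ?_⟩
  by_contra hcon
  refine absurd (he.trans (measure_mono fun t ht => ?_)) (not_le.2 hk)
  exact (not_le.1 hcon).le.trans ht

/-- The supremum is itself a median, by continuity of the measure along the decreasing events `{sSup
E - 1/(k+1) ≤ X}`. -/
theorem half_le_measure_median (hX : Measurable X) (hX0 : ∀ t, 0 ≤ X t) :
    1 / 2 ≤ ν {t | sSup {e : ℝ | 1 / 2 ≤ ν {t | e ≤ X t}} ≤ X t} := by
  set E := {e : ℝ | 1 / 2 ≤ ν {t | e ≤ X t}} with hE
  have hne : E.Nonempty := ⟨0, by simp [hE, hX0]⟩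
  have hlim : Tendsto (fun k : ℕ => ν {t | sSup E - 1 / ((k : ℝ) + 1) ≤ X t}) atTop
      (𝓝 (ν (⋂ k : ℕ, {t | sSup E - 1 / ((k : ℝ) + 1) ≤ X t}))) :=
    tendsto_measure_iInter_atTop
      (fun k => (measurableSet_le measurable_const hX).nullMeasurableSet)
      (fun k l hkl t (ht : sSup E - 1 / ((l : ℝ) + 1) ≤ X t) => by
        have : 1 / ((l : ℝ) + 1) ≤ 1 / ((k : ℝ) + 1) :=
          one_div_le_one_div_of_le (by positivity) (by exact_mod_cast Nat.succ_le_succ hkl)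
        change sSup E - 1 / ((k : ℝ) + 1) ≤ X t
        linarith)
      ⟨0, measure_ne_top _ _⟩
  have hset : (⋂ k : ℕ, {t | sSup E - 1 / ((k : ℝ) + 1) ≤ X t}) = {t | sSup E ≤ X t} := by
    ext t
    simp only [mem_iInter, mem_ofPred_eq]
    constructor
    · intro h
      have h1 : Tendsto (fun k : ℕ => sSup E - 1 / ((k : ℝ) + 1)) atTop (𝓝 (sSup E - 0)) :=
        tendsto_const_nhds.sub tendsto_one_div_add_atTop_nhds_zero_nat
      rw [sub_zero] at h1
      exact le_of_tendsto' h1 h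
    · intro h k
      have : 0 < 1 / ((k : ℝ) + 1) := by positivity
      linarith
  rw [hset] at hlim
  refine ge_of_tendsto' hlim fun k => ?_
  obtain ⟨e, he, hlt⟩ := exists_lt_of_lt_csSup hne
    (show sSup E - 1 / ((k : ℝ) + 1) < sSup E by
      have : 0 < 1 / ((k : ℝ) + 1) := by positivity
      linarith)
  exact le_trans (show 1 / 2 ≤ ν {t | e ≤ X t} from he)
    (measure_mono fun t (ht : e ≤ X t) => hlt.le.trans ht)

theorem median_nonneg (hX0 : ∀ t, 0 ≤ X t) : 0 ≤ sSup {e : ℝ | 1 / 2 ≤ ν {t | e ≤ X t}} :=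
  Real.sSup_nonneg' ⟨0, by simp [hX0], le_rfl⟩

theorem le_median (hX : Measurable X) {e : ℝ} (he : 1 / 2 ≤ ν {t | e ≤ X t}) :
    e ≤ sSup {e : ℝ | 1 / 2 ≤ ν {t | e ≤ X t}} := le_csSup (bddAbove_median ν hX) he

end Median

/-! ### The bundling VCG mechanism -/

theorem surplus_nonneg (β : Fin m → ℝ≥0∞) (t : Fin m → ℝ) : 0 ≤ surplus β t :=
  Finset.sum_nonneg fun _ _ => ENNReal.toReal_nonneg

theorem measurable_surplus_right (β : Fin m → ℝ≥0∞) : Measurable (surplus β) :=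
  Finset.measurable_sum _ fun j _ =>
    ((measurable_pi_apply j).ennreal_ofReal.sub measurable_const).ennreal_toReal

theorem entryFee_nonneg : 0 ≤ entryFee I c v i := median_nonneg _ (surplus_nonneg _)

theorem half_le_measure_entryFee (I : Market n m) (c : Costs m) (v : BProfile n m) (i : Fin n) :
    1 / 2 ≤ (Measure.pi fun j => I.DB i j) {t | entryFee I c v i ≤ surplus (reserve c v i) t} :=
  half_le_measure_median _ (measurable_surplus_right _) (surplus_nonneg _)

theorem reserve_congr {v' : BProfile n m} (h : ∀ k, k ≠ i → v k j = v' k j) :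
    reserve c v i j = reserve c v' i j := by
  unfold reserve
  congr 1
  exact iSup_congr fun k => iSup_congr fun hk => by rw [h k hk]

theorem reserve_update (c : Costs m) (v : BProfile n m) (i : Fin n) (t : Fin m → ℝ) :
    reserve c (Function.update v i t) i = reserve c v i :=
  funext fun j => reserve_congr fun k hk => by simp [hk]

theorem entryFee_update (I : Market n m) (c : Costs m) (v : BProfile n m) (i : Fin n)
    (t : Fin m → ℝ) : entryFee I c (Function.update v i t) i = entryFee I c v i := by
  unfold entryFee
  rw [reserve_update]

theorem ofReal_le_reserve {k : Fin n} (hk : k ≠ i) : ENNReal.ofReal (v k j) ≤ reserve c v i j :=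
  le_max_of_le_left (le_iSup₂_of_le k hk le_rfl)

theorem cost_le_reserve : c j ≤ reserve c v i j := le_max_right _ _

theorem reserve_ne_top (hc : c j ≠ ⊤) : reserve c v i j ≠ ⊤ := by
  refine (max_lt ?_ hc.lt_top).ne
  rw [← Finset.sup_univ_eq_iSup]
  refine (Finset.sup_lt_iff ENNReal.zero_lt_top).2 fun k _ => ?_
  by_cases hk : k = i
  · simp [hk]
  · simp [hk]

theorem BVCGWins.unique {k : Fin n} (hi : BVCGWins I c v i j) (hk : BVCGWins I c v k j) : i = k :=
  hi.2.1.unique hk.2.1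

open Classical in
theorem sold_MBVCG (I : Market n m) (c : Costs m) (v : BProfile n m) (j : Fin m) :
    (MBVCG I).sold c v j = if ∃ i, BVCGWins I c v i j then 1 else 0 :=
  sum_ite_of_unique fun _ _ hi hk => hi.unique hk

theorem sub_toReal_le {w : ℝ} {β : ℝ≥0∞} (hβ : β ≠ ⊤) :
    w - β.toReal ≤ (ENNReal.ofReal w - β).toReal := by
  rw [← ENNReal.ofReal_toReal hβ, ← ENNReal.ofReal_sub _ ENNReal.toReal_nonneg,
    ENNReal.ofReal_toReal hβ, ENNReal.toReal_ofReal']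
  exact le_max_left _ _

theorem toReal_sub_eq {w : ℝ} {β : ℝ≥0∞} (hw : 0 ≤ w) (hβ : β ≤ ENNReal.ofReal w) :
    (ENNReal.ofReal w - β).toReal = w - β.toReal := by
  rw [ENNReal.toReal_sub_of_le hβ ENNReal.ofReal_ne_top, ENNReal.toReal_ofReal hw]

theorem ofReal_le_reserve_of_not_isFirstMax (h : ¬ IsFirstMax (fun k => v k j) i) :
    ENNReal.ofReal (v i j) ≤ reserve c v i j := by
  unfold IsFirstMax at h
  rw [not_and_or] at h
  rcases h with h | h
  · push Not at h
    obtain ⟨k, hk⟩ := h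
    have hki : k ≠ i := fun h => by subst h; exact lt_irrefl _ hk
    exact (ENNReal.ofReal_le_ofReal hk.le).trans (ofReal_le_reserve hki)
  · push Not at h
    obtain ⟨k, hki, hk⟩ := h
    exact (ENNReal.ofReal_le_ofReal hk).trans (ofReal_le_reserve hki.ne)

-- A positive excess forces the value to beat all other bids strictly. Hence tie-breaking affects
-- only items of zero excess, and the utility from the items won is the whole surplus.
open Classical in
theorem surplus_term_eq (hv : v ∈ I.TB) (ha : Accepts I c v i) :
    (if BVCGWins I c v i j then v i j - (reserve c v i j).toReal else 0) =
      (ENNReal.ofReal (v i j) - reserve c v i j).toReal := by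
  split_ifs with h
  · rw [toReal_sub_eq (nonneg_of_mem_TB hv i j) h.2.2]
  · symm
    have : ENNReal.ofReal (v i j) ≤ reserve c v i j := by
      by_contra hcon
      refine h ⟨ha, ?_, (not_le.1 hcon).le⟩
      by_contra hf
      exact hcon (ofReal_le_reserve_of_not_isFirstMax hf)
    rw [tsub_eq_zero_of_le this]; rfl

open Classical in
theorem utility_MBVCG (I : Market n m) (c : Costs m) (i : Fin n) (w : Fin m → ℝ)
    (v : BProfile n m) : (MBVCG I).utility c i w v =
      if Accepts I c v i then (∑ j, if BVCGWins I c v i j then w j - (reserve c v i j).toReal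
        else 0) - entryFee I c v i else 0 := by
  unfold CostMechanism.utility MBVCG
  dsimp only
  split_ifs with h
  · rw [sub_add_eq_sub_sub, sub_right_comm, ← Finset.sum_sub_distrib]
    congr 1
    refine Finset.sum_congr rfl fun j _ => ?_
    by_cases h : BVCGWins I c v i j <;> simp [h]
  · have : ∀ j, ¬ BVCGWins I c v i j := fun j hj => h hj.1
    simp [this]

open Classical in
theorem utility_MBVCG_truth (hv : v ∈ I.TB) : (MBVCG I).utility c i (v i) v =
    if Accepts I c v i then surplus (reserve c v i) (v i) - entryFee I c v i else 0 := by
  rw [utility_MBVCG]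
  split_ifs with h
  · congr 1
    exact Finset.sum_congr rfl fun j _ => surplus_term_eq hv h
  · rfl

theorem utility_MBVCG_nonneg (hv : v ∈ I.TB) : 0 ≤ (MBVCG I).utility c i (v i) v := by
  rw [utility_MBVCG_truth hv]
  split_ifs with h
  · exact sub_nonneg.2 h
  · exact le_rfl

/-- Fee and reserves do not depend on the buyer's own report. A misreport buys some set of items at
these prices, worth at most surplus minus fee, and truth yields the better of this and 0. -/
theorem utility_MBVCG_dsic (hv : v ∈ I.TB) {w : Fin m → ℝ} :
    (MBVCG I).utility c i (v i) (Function.update v i w) ≤ (MBVCG I).utility c i (v i) v := by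
  classical
  have h0 := utility_MBVCG_nonneg (c := c) (i := i) hv
  rw [utility_MBVCG]
  split_ifs with h
  swap
  · exact h0
  have hle : (∑ j, if BVCGWins I c (Function.update v i w) i j then
      v i j - (reserve c (Function.update v i w) i j).toReal else 0) ≤
      surplus (reserve c v i) (v i) := by
    refine Finset.sum_le_sum fun j _ => ?_
    split_ifs with hw
    · have hfin : reserve c (Function.update v i w) i j ≠ ⊤ :=
        ne_top_of_le_ne_top ENNReal.ofReal_ne_top hw.2.2
      rw [reserve_update] at hfin ⊢
      exact sub_toReal_le hfin
    · exact ENNReal.toReal_nonneg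
  rw [entryFee_update]
  rw [utility_MBVCG_truth hv] at h0 ⊢
  split_ifs with ha
  · linarith
  · have : surplus (reserve c v i) (v i) < entryFee I c v i := not_le.1 ha
    linarith

theorem p_MBVCG_nonneg : 0 ≤ (MBVCG I).p c v i := by
  classical
  unfold MBVCG
  simp only
  split_ifs
  · refine add_nonneg entryFee_nonneg (Finset.sum_nonneg fun j _ => ?_)
    split_ifs
    · exact ENNReal.toReal_nonneg
    · exact le_rfl
  · exact le_rfl

/-- Let `δ` be the amount by which the reserve of the winner `i` at cost `c'` falls when the cost
drops to `c`. Her surplus grows by exactly `δ` at her actual values but by at most `δ` at any other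
ones, so her median grows by at most `δ` and she still accepts. -/
theorem sold_MBVCG_anti (I : Market n m) {c c' : Costs m} (hj : c j ≤ c' j)
    (hother : ∀ k, k ≠ j → c k = c' k) (v : BProfile n m) :
    (MBVCG I).sold c' v j ≤ (MBVCG I).sold c v j := by
  classical
  rw [sold_MBVCG, sold_MBVCG]
  by_cases h : ∃ i, BVCGWins I c' v i j
  swap
  · rw [if_neg h]; split_ifs <;> norm_num
  obtain ⟨i, ha, hmax, hres⟩ := h
  suffices h' : ∃ i, BVCGWins I c v i j by rw [if_pos ⟨i, ha, hmax, hres⟩, if_pos h']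
  have hle : reserve c v i j ≤ reserve c' v i j := max_le_max le_rfl hj
  have heq : ∀ k, k ≠ j → reserve c v i k = reserve c' v i k := fun k hk => by
    unfold reserve; rw [hother k hk]
  have hfin' : reserve c' v i j ≠ ⊤ := ne_top_of_le_ne_top ENNReal.ofReal_ne_top hres
  have hfin : reserve c v i j ≠ ⊤ := ne_top_of_le_ne_top hfin' hle
  set δ := (reserve c' v i j).toReal - (reserve c v i j).toReal with hδ
  have hδ0 : 0 ≤ δ := sub_nonneg.2 (ENNReal.toReal_mono hfin' hle)
  have hterm : ∀ t : ℝ, (ENNReal.ofReal t - reserve c v i j).toReal ≤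
      (ENNReal.ofReal t - reserve c' v i j).toReal + δ := by
    intro t
    have h2 : ENNReal.ofReal t - reserve c v i j ≤
        (ENNReal.ofReal t - reserve c' v i j) + (reserve c' v i j - reserve c v i j) :=
      tsub_le_tsub_add_tsub
    have h3 := ENNReal.toReal_mono (by finiteness) h2
    rwa [ENNReal.toReal_add (by finiteness) (by finiteness),
      ENNReal.toReal_sub_of_le hle hfin'] at h3
  have hsur : ∀ t, surplus (reserve c v i) t ≤ surplus (reserve c' v i) t + δ := by
    intro t
    unfold surplus
    rw [← Finset.add_sum_erase _ _ (Finset.mem_univ j),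
      ← Finset.add_sum_erase _ (fun j => (ENNReal.ofReal (t j) - reserve c' v i j).toReal)
        (Finset.mem_univ j)]
    have : ∑ k ∈ Finset.univ.erase j, (ENNReal.ofReal (t k) - reserve c v i k).toReal =
        ∑ k ∈ Finset.univ.erase j, (ENNReal.ofReal (t k) - reserve c' v i k).toReal :=
      Finset.sum_congr rfl fun k hk => by rw [heq k (Finset.ne_of_mem_erase hk)]
    rw [this]
    linarith [hterm (t j)]
  have hsurv : surplus (reserve c v i) (v i) = surplus (reserve c' v i) (v i) + δ := by
    unfold surplus
    rw [← Finset.add_sum_erase _ _ (Finset.mem_univ j),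
      ← Finset.add_sum_erase _ (fun j => (ENNReal.ofReal (v i j) - reserve c' v i j).toReal)
        (Finset.mem_univ j)]
    have : ∑ k ∈ Finset.univ.erase j, (ENNReal.ofReal (v i k) - reserve c v i k).toReal =
        ∑ k ∈ Finset.univ.erase j, (ENNReal.ofReal (v i k) - reserve c' v i k).toReal :=
      Finset.sum_congr rfl fun k hk => by rw [heq k (Finset.ne_of_mem_erase hk)]
    rw [this, ENNReal.toReal_sub_of_le (hle.trans hres) ENNReal.ofReal_ne_top,
      ENNReal.toReal_sub_of_le hres ENNReal.ofReal_ne_top]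
    linarith
  have hfee : entryFee I c v i ≤ entryFee I c' v i + δ := by
    have h1 := half_le_measure_entryFee I c v i
    have h2 := le_median (Measure.pi fun j => I.DB i j)
      (measurable_surplus_right (reserve c' v i)) (e := entryFee I c v i - δ)
      (h1.trans (measure_mono fun t ht => by
        have := hsur t
        have ht : entryFee I c v i ≤ surplus (reserve c v i) t := ht
        change entryFee I c v i - δ ≤ surplus (reserve c' v i) t
        linarith))
    change _ ≤ entryFee I c' v i at h2
    linarith
  have ha' : entryFee I c' v i ≤ surplus (reserve c' v i) (v i) := ha
  refine ⟨i, ?_, hmax, hle.trans hres⟩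
  change entryFee I c v i ≤ surplus (reserve c v i) (v i)
  linarith

/-! ### The mixed mechanism -/

theorem sold_MA (I : Market n m) (c : Costs m) (v : BProfile n m) (j : Fin m) :
    (MA I).sold c v j = 3 / 4 * (MIT I).sold c v j + 1 / 4 * (MBVCG I).sold c v j := by
  unfold CostMechanism.sold MA CostMechanism.mix
  rw [Finset.mul_sum, Finset.mul_sum, ← Finset.sum_add_distrib]
  norm_num

theorem sold_MA_anti (I : Market n m) {c c' : Costs m} (hj : c j ≤ c' j)
    (hother : ∀ k, k ≠ j → c k = c' k) (v : BProfile n m) :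
    (MA I).sold c' v j ≤ (MA I).sold c v j := by
  have h1 := sold_MIT_anti I hj v
  have h2 := sold_MBVCG_anti I hj hother v
  rw [sold_MA, sold_MA]
  linarith

theorem p_MA (I : Market n m) (c : Costs m) (v : BProfile n m) (i : Fin n) :
    (MA I).p c v i = 3 / 4 * (MIT I).p c v i + 1 / 4 * (MBVCG I).p c v i := by
  unfold MA CostMechanism.mix
  norm_num

theorem utility_MA (I : Market n m) (c : Costs m) (i : Fin n) (w : Fin m → ℝ) (v : BProfile n m) :
    (MA I).utility c i w v =
      3 / 4 * (MIT I).utility c i w v + 1 / 4 * (MBVCG I).utility c i w v := by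
  unfold CostMechanism.utility
  rw [p_MA]
  have : ∀ j, (MA I).x c v i j * w j = 3 / 4 * ((MIT I).x c v i j * w j) +
      1 / 4 * ((MBVCG I).x c v i j * w j) := fun j => by
    unfold MA CostMechanism.mix; ring
  simp_rw [this]
  rw [Finset.sum_add_distrib, ← Finset.mul_sum, ← Finset.mul_sum]
  ring

theorem x_MIT_nonneg : 0 ≤ (MIT I).x c v i j := by
  classical
  unfold MIT; simp only; split_ifs <;> norm_num

theorem x_MBVCG_nonneg : 0 ≤ (MBVCG I).x c v i j := by
  classical
  unfold MBVCG; simp only; split_ifs <;> norm_num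

theorem sold_MIT_mem : (MIT I).sold c v j ∈ Icc (0 : ℝ) 1 := by
  rw [sold_MIT]; split_ifs <;> norm_num

theorem sold_MBVCG_mem : (MBVCG I).sold c v j ∈ Icc (0 : ℝ) 1 := by
  rw [sold_MBVCG]; split_ifs <;> norm_num

theorem x_MA_nonneg : 0 ≤ (MA I).x c v i j := by
  have h1 : 0 ≤ (MIT I).x c v i j := x_MIT_nonneg
  have h2 : 0 ≤ (MBVCG I).x c v i j := x_MBVCG_nonneg
  unfold MA CostMechanism.mix
  simp only
  linarith

theorem sold_MA_mem : (MA I).sold c v j ∈ Icc (0 : ℝ) 1 := by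
  have h1 := sold_MIT_mem (I := I) (c := c) (v := v) (j := j)
  have h2 := sold_MBVCG_mem (I := I) (c := c) (v := v) (j := j)
  rw [sold_MA]
  constructor <;> linarith [h1.1, h1.2, h2.1, h2.2]

theorem x_MA_le_one : (MA I).x c v i j ≤ 1 :=
  (Finset.single_le_sum (f := fun i => (MA I).x c v i j) (fun _ _ => x_MA_nonneg)
    (Finset.mem_univ i)).trans sold_MA_mem.2

/-- An item is sold only if some buyer's value is at least its cost. -/
theorem exists_cost_le_of_sold_MA_pos (h : 0 < (MA I).sold c v j) :
    ∃ i, c j ≤ ENNReal.ofReal (v i j) := by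
  classical
  rw [sold_MA, sold_MIT, sold_MBVCG] at h
  by_cases h1 : ∃ i, ITWins I c v i j
  · obtain ⟨i, hi⟩ := h1
    refine ⟨i, ?_⟩
    have := EReal.toENNReal_le_toENNReal (hi.2.trans (buyerVirtual_le _ _))
    simpa using this
  by_cases h2 : ∃ i, BVCGWins I c v i j
  · obtain ⟨i, hi⟩ := h2
    exact ⟨i, cost_le_reserve.trans hi.2.2⟩
  · rw [if_neg h1, if_neg h2] at h
    norm_num at h

end

end Broker

namespace Broker
open Filter Topology

section

variable {n m : ℕ} (I : Market n m)

/-! ### Measurability of the mechanisms -/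

theorem measurableSet_isFirstMax {α β : Type*} [MeasurableSpace α] [LinearOrder β]
    [MeasurableSpace β] [TopologicalSpace β] [OrderClosedTopology β] [SecondCountableTopology β]
    [OpensMeasurableSpace β] {n : ℕ} {f : α → Fin n → β} (hf : ∀ k, Measurable fun a => f a k)
    (i : Fin n) : MeasurableSet {a | IsFirstMax (f a) i} := by
  have : {a | IsFirstMax (f a) i} =
      (⋂ k, {a | f a k ≤ f a i}) ∩ ⋂ k, ⋂ _ : k < i, {a | f a k < f a i} := by
    ext a
    simp [IsFirstMax]
  rw [this]
  exact (MeasurableSet.iInter fun k => measurableSet_le (hf k) (hf i)).inter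
    (MeasurableSet.iInter fun k => MeasurableSet.iInter fun _ => measurableSet_lt (hf k) (hf i))

theorem measurable_value (i : Fin n) (j : Fin m) :
    Measurable fun w : Costs m × BProfile n m => w.2 i j :=
  (measurable_pi_apply j).comp ((measurable_pi_apply i).comp measurable_snd)

theorem measurableSet_ITWins (i : Fin n) (j : Fin m) :
    MeasurableSet {w : Costs m × BProfile n m | ITWins I w.1 w.2 i j} := by
  have hv : ∀ k, Measurable fun w : Costs m × BProfile n m =>
      buyerVirtual (I.DB k j) (w.2 k j) := fun k =>
    (measurable_buyerVirtual _).comp (measurable_value k j)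
  refine (measurableSet_isFirstMax hv i).inter (measurableSet_le ?_ (hv i))
  exact measurable_coe_ennreal_ereal.comp ((measurable_pi_apply j).comp measurable_fst)

theorem measurable_ITPrice (i : Fin n) (j : Fin m) :
    Measurable fun w : Costs m × BProfile n m => ITPrice I w.1 w.2 i j := by
  refine measurable_sInf_of_upClosed (K := (I.DB i j).support)
    (S := fun w : Costs m × BProfile n m => {z | ITWins I w.1 (setValue w.2 i j z) i j})
    (fun w z _ z' _ h hz => ITWins_setValue_mono h hz) fun z => ?_
  have : Measurable fun w : Costs m × BProfile n m => (w.1, setValue w.2 i j z) :=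
    measurable_fst.prodMk ((measurable_setValue i j).comp
      (measurable_snd.prodMk measurable_const))
  exact this (measurableSet_ITWins I i j)

theorem measurable_MIT_x (i : Fin n) (j : Fin m) :
    Measurable fun w : Costs m × BProfile n m => (MIT I).x w.1 w.2 i j :=
  Measurable.ite (measurableSet_ITWins I i j) measurable_const measurable_const

theorem measurable_MIT_p (i : Fin n) :
    Measurable fun w : Costs m × BProfile n m => (MIT I).p w.1 w.2 i := by
  unfold MIT
  dsimp only
  exact Finset.measurable_sum _ fun j _ =>
    Measurable.ite (measurableSet_ITWins I i j) (measurable_ITPrice I i j) measurable_const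

theorem measurable_reserve (i : Fin n) :
    Measurable fun w : Costs m × BProfile n m => reserve w.1 w.2 i := by
  refine measurable_pi_iff.2 fun j => Measurable.max ?_ ((measurable_pi_apply j).comp measurable_fst)
  exact Measurable.iSup fun k => Measurable.iSup fun _ => (measurable_value k j).ennreal_ofReal

theorem measurable_surplus_comp {α : Type*} [MeasurableSpace α] {f : α → Fin m → ℝ≥0∞}
    {g : α → Fin m → ℝ} (hf : Measurable f) (hg : Measurable g) :
    Measurable fun a => surplus (f a) (g a) := by
  unfold surplus
  refine Finset.measurable_sum _ fun j _ => Measurable.ennreal_toReal ?_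
  exact ((measurable_pi_apply j).comp hg).ennreal_ofReal.sub ((measurable_pi_apply j).comp hf)

theorem measurable_entryFee (i : Fin n) :
    Measurable fun w : Costs m × BProfile n m => entryFee I w.1 w.2 i := by
  have := measurable_sSup_of_downClosed (K := univ) (S := fun w : Costs m × BProfile n m =>
    {e : ℝ | 1 / 2 ≤ (Measure.pi fun j => I.DB i j)
      {t : Fin m → ℝ | e ≤ surplus (reserve w.1 w.2 i) t}})
    (fun w z _ z' _ h hz => le_trans (show (1 / 2 : ℝ≥0∞) ≤ _ from hz)
      (measure_mono fun t (ht : z' ≤ _) => h.trans ht)) (fun e => ?_)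
  · have heq : (fun w : Costs m × BProfile n m => entryFee I w.1 w.2 i) = fun w =>
        sSup {z | z ∈ univ ∧ z ∈ {e : ℝ | 1 / 2 ≤ (Measure.pi fun j => I.DB i j)
          {t : Fin m → ℝ | e ≤ surplus (reserve w.1 w.2 i) t}}} := by
      funext w
      unfold entryFee
      congr 1
      ext e
      simp
    rw [heq]
    exact this
  · change MeasurableSet {w : Costs m × BProfile n m | 1 / 2 ≤ (Measure.pi fun j => I.DB i j)
      {t : Fin m → ℝ | e ≤ surplus (reserve w.1 w.2 i) t}}
    refine measurableSet_le measurable_const ?_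
    have hset : MeasurableSet {q : (Costs m × BProfile n m) × (Fin m → ℝ) |
        e ≤ surplus (reserve q.1.1 q.1.2 i) q.2} :=
      measurableSet_le measurable_const
        (measurable_surplus_comp ((measurable_reserve i).comp measurable_fst) measurable_snd)
    exact measurable_measure_prodMk_left hset

theorem measurableSet_accepts (i : Fin n) :
    MeasurableSet {w : Costs m × BProfile n m | Accepts I w.1 w.2 i} :=
  measurableSet_le (measurable_entryFee I i) (measurable_surplus_comp (measurable_reserve i)
    ((measurable_pi_apply i).comp measurable_snd))

theorem measurableSet_BVCGWins (i : Fin n) (j : Fin m) :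
    MeasurableSet {w : Costs m × BProfile n m | BVCGWins I w.1 w.2 i j} :=
  (measurableSet_accepts I i).inter
    ((measurableSet_isFirstMax (fun k => measurable_value k j) i).inter
      (measurableSet_le ((measurable_pi_apply j).comp (measurable_reserve i))
        (measurable_value i j).ennreal_ofReal))

theorem measurable_MBVCG_x (i : Fin n) (j : Fin m) :
    Measurable fun w : Costs m × BProfile n m => (MBVCG I).x w.1 w.2 i j :=
  Measurable.ite (measurableSet_BVCGWins I i j) measurable_const measurable_const

theorem measurable_MBVCG_p (i : Fin n) :
    Measurable fun w : Costs m × BProfile n m => (MBVCG I).p w.1 w.2 i := by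
  refine Measurable.ite (measurableSet_accepts I i) ((measurable_entryFee I i).add
    (Finset.measurable_sum _ fun j _ => Measurable.ite (measurableSet_BVCGWins I i j) ?_
      measurable_const)) measurable_const
  exact ((measurable_pi_apply j).comp (measurable_reserve i)).ennreal_toReal

theorem measurable_MA_x (i : Fin n) (j : Fin m) :
    Measurable fun w : Costs m × BProfile n m => (MA I).x w.1 w.2 i j :=
  ((measurable_MIT_x I i j).const_mul _).add ((measurable_MBVCG_x I i j).const_mul _)

theorem measurable_MA_p (i : Fin n) :
    Measurable fun w : Costs m × BProfile n m => (MA I).p w.1 w.2 i :=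
  ((measurable_MIT_p I i).const_mul _).add ((measurable_MBVCG_p I i).const_mul _)

theorem measurable_MIT_sold (j : Fin m) :
    Measurable fun w : Costs m × BProfile n m => (MIT I).sold w.1 w.2 j :=
  Finset.measurable_sum _ fun i _ => measurable_MIT_x I i j

theorem measurable_MBVCG_sold (j : Fin m) :
    Measurable fun w : Costs m × BProfile n m => (MBVCG I).sold w.1 w.2 j :=
  Finset.measurable_sum _ fun i _ => measurable_MBVCG_x I i j

theorem measurable_MA_sold (j : Fin m) :
    Measurable fun w : Costs m × BProfile n m => (MA I).sold w.1 w.2 j :=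
  Finset.measurable_sum _ fun i _ => measurable_MA_x I i j

theorem measurable_costs_profile : Measurable fun w : BProfile n m × SProfile m =>
    (virtualCosts I w.2, w.1) :=
  ((measurable_virtualCosts I).comp measurable_snd).prodMk measurable_fst

/-! ### Threshold payments -/

section Threshold

variable {K : Set ℝ} {x : ℝ → ℝ} {V : ℝ}

/-- The threshold price at the quantile `u`. -/
noncomputable def threshold (K : Set ℝ) (x : ℝ → ℝ) (u : ℝ) : ℝ := sSup {y | y ∈ K ∧ u ≤ x y}

theorem threshold_nonneg (hK : ∀ y ∈ K, 0 ≤ y) (u : ℝ) : 0 ≤ threshold K x u :=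
  Real.sSup_nonneg fun _ hy => hK _ hy.1

theorem threshold_le (hV0 : 0 ≤ V) (hV : ∀ y ∈ K, 0 < x y → y ≤ V) {u : ℝ} (hu : 0 < u) :
    threshold K x u ≤ V :=
  Real.sSup_le (fun y hy => hV y hy.1 (hu.trans_le hy.2)) hV0

theorem bddAbove_threshold (hV : ∀ y ∈ K, 0 < x y → y ≤ V) {u : ℝ} (hu : 0 < u) :
    BddAbove {y | y ∈ K ∧ u ≤ x y} := ⟨V, fun y hy => hV y hy.1 (hu.trans_le hy.2)⟩

theorem intervalIntegrable_threshold (hK : ∀ y ∈ K, 0 ≤ y) (hV0 : 0 ≤ V)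
    (hV : ∀ y ∈ K, 0 < x y → y ≤ V) {a b : ℝ} (ha : 0 ≤ a) (hb : 0 ≤ b) :
    IntervalIntegrable (threshold K x) volume a b := by
  -- At `u ≤ 0` the set of trading types may be unbounded, with junk supremum 0. Redefining the
  -- threshold there as the bound `V` restores monotonicity without affecting the integral.
  have hanti : Antitone fun u => if u ≤ 0 then V else threshold K x u := by
    intro u u' h
    by_cases hu : u ≤ 0
    · simp only [hu, if_true]
      split_ifs with hu'
      · exact le_rfl
      · exact threshold_le hV0 hV (not_le.1 hu')
    · have hu' : ¬ u' ≤ 0 := fun h' => hu (h.trans h')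
      simp only [hu, hu', if_false]
      refine Real.sSup_le (fun y hy => ?_) (threshold_nonneg hK u)
      exact le_csSup (bddAbove_threshold hV (not_le.1 hu)) ⟨hy.1, h.trans hy.2⟩
  refine IntervalIntegrable.congr ?_ (hanti.intervalIntegrable (a := a) (b := b))
  intro u hu
  have : 0 < u := by
    rcases le_total a b with h | h
    · rw [uIoc_of_le h] at hu; exact ha.trans_lt hu.1
    · rw [uIoc_of_ge h] at hu; exact hb.trans_lt hu.1
  simp [not_le.2 this]

theorem le_threshold (hV : ∀ y ∈ K, 0 < x y → y ≤ V) {s u : ℝ} (hs : s ∈ K) (hu : 0 < u)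
    (hus : u ≤ x s) : s ≤ threshold K x u :=
  le_csSup (bddAbove_threshold hV hu) ⟨hs, hus⟩

theorem mul_le_integral_threshold (hK : ∀ y ∈ K, 0 ≤ y) (hV0 : 0 ≤ V)
    (hV : ∀ y ∈ K, 0 < x y → y ≤ V) {s : ℝ} (hs : s ∈ K) {a b : ℝ} (ha : 0 ≤ a) (hab : a ≤ b)
    (hb : b ≤ x s) : s * (b - a) ≤ ∫ u in a..b, threshold K x u := by
  calc s * (b - a) = ∫ _ in a..b, s := by simp [mul_comm]
    _ ≤ _ := intervalIntegral.integral_mono_on_of_le_Ioo hab (by simp)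
        (intervalIntegrable_threshold hK hV0 hV ha (ha.trans hab)) fun u hu =>
          le_threshold hV hs (ha.trans_lt hu.1) (hu.2.le.trans hb)

/-- Threshold payments make truthful reports optimal for a seller. -/
theorem threshold_dsic (hK : ∀ y ∈ K, 0 ≤ y) (hV0 : 0 ≤ V) (hV : ∀ y ∈ K, 0 < x y → y ≤ V)
    (hx0 : ∀ y ∈ K, 0 ≤ x y) (hx : ∀ y ∈ K, ∀ z ∈ K, y ≤ z → x z ≤ x y) {s z : ℝ} (hs : s ∈ K)
    (hz : z ∈ K) : (∫ u in (0 : ℝ)..x z, threshold K x u) - s * x z ≤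
      (∫ u in (0 : ℝ)..x s, threshold K x u) - s * x s := by
  have hint : ∀ {a b : ℝ}, 0 ≤ a → 0 ≤ b → IntervalIntegrable (threshold K x) volume a b :=
    fun ha hb => intervalIntegrable_threshold hK hV0 hV ha hb
  rcases le_total (x z) (x s) with h | h
  · rw [← intervalIntegral.integral_add_adjacent_intervals (hint le_rfl (hx0 z hz))
      (hint (hx0 z hz) (hx0 s hs))]
    have := mul_le_integral_threshold hK hV0 hV hs (hx0 z hz) h le_rfl
    linarith
  · rw [← intervalIntegral.integral_add_adjacent_intervals (hint le_rfl (hx0 s hs))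
      (hint (hx0 s hs) (hx0 z hz))]
    -- For `u` above `x s` only types below `s` trade, so the additional quantity is paid at most
    -- `s` per unit.
    have : ∫ u in x s..x z, threshold K x u ≤ s * (x z - x s) := by
      calc _ ≤ ∫ _ in x s..x z, s := by
            refine intervalIntegral.integral_mono_on_of_le_Ioo h
              (hint (hx0 s hs) (hx0 z hz)) (by simp) fun u hu => ?_
            refine Real.sSup_le (fun y hy => ?_) (hK s hs)
            by_contra hcon
            have := hx s hs y hy.1 (not_le.1 hcon).le
            linarith [hu.1, hy.2]
        _ = _ := by simp [mul_comm]
    linarith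

end Threshold

/-! ### The two-sided mechanism -/

theorem reduction_pS (v : BProfile n m) (s : SProfile m) (j : Fin m) :
    (reduction I (MA I)).pS v s j =
      ∫ u in (0 : ℝ)..(MA I).sold (virtualCosts I s) v j,
        threshold (I.DS j).support
          (fun z => (MA I).sold (virtualCosts I (Function.update s j z)) v j) u := rfl

theorem virtualCosts_update_self (s : SProfile m) (j : Fin m) (z : ℝ) :
    virtualCosts I (Function.update s j z) j = sellerVirtual (I.DS j) z := by
  simp [virtualCosts]

theorem virtualCosts_update_of_ne (s : SProfile m) {j k : Fin m} (z : ℝ) (h : k ≠ j) :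
    virtualCosts I (Function.update s j z) k = virtualCosts I s k := by
  simp [virtualCosts, h]

variable {I}

theorem sold_update_anti (v : BProfile n m) (s : SProfile m) (j : Fin m) {y z : ℝ}
    (h : sellerVirtual (I.DS j) y ≤ sellerVirtual (I.DS j) z) :
    (MA I).sold (virtualCosts I (Function.update s j z)) v j ≤
      (MA I).sold (virtualCosts I (Function.update s j y)) v j := by
  refine sold_MA_anti I ?_ (fun k hk => ?_) v
  · rw [virtualCosts_update_self, virtualCosts_update_self]; exact h
  · rw [virtualCosts_update_of_ne _ _ _ hk, virtualCosts_update_of_ne _ _ _ hk]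

/-- An item that is sold has some `v i j` at least its virtual cost, hence at least the seller's
value. This bounds the thresholds, so that their real suprema are meaningful and the payments
integrable. -/
theorem le_sum_value_of_sold_pos {v : BProfile n m} (hv : v ∈ I.TB) (s : SProfile m) (j : Fin m)
    {y : ℝ} (h : 0 < (MA I).sold (virtualCosts I (Function.update s j y)) v j) :
    y ≤ ∑ i, v i j := by
  obtain ⟨i, hi⟩ := exists_cost_le_of_sold_MA_pos h
  rw [virtualCosts_update_self] at hi
  exact (le_of_sellerVirtual_le (nonneg_of_mem_TB hv i j) hi).trans
    (Finset.single_le_sum (f := fun i => v i j) (fun i _ => nonneg_of_mem_TB hv i j)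
      (Finset.mem_univ i))

theorem sum_value_nonneg {v : BProfile n m} (hv : v ∈ I.TB) (j : Fin m) : 0 ≤ ∑ i, v i j :=
  Finset.sum_nonneg fun i _ => nonneg_of_mem_TB hv i j

theorem integrable_value (hmean : ∀ i j, Integrable (fun z : ℝ => z) (I.DB i j)) (i : Fin n)
    (j : Fin m) : Integrable (fun w : BProfile n m × SProfile m => w.1 i j) I.dist :=
  (measurePreserving_value I i j).integrable_comp_of_integrable (hmean i j)

variable (I)

theorem measurable_reduction_xB (i : Fin n) (j : Fin m) :
    Measurable fun w : BProfile n m × SProfile m => (MA I).x (virtualCosts I w.2) w.1 i j := by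
  have h := (measurable_MA_x I i j).comp (measurable_costs_profile I)
  exact h

theorem measurable_reduction_xS (j : Fin m) :
    Measurable fun w : BProfile n m × SProfile m => (MA I).sold (virtualCosts I w.2) w.1 j := by
  have h := (measurable_MA_sold I j).comp (measurable_costs_profile I)
  exact h

theorem measurable_reduction_pB (i : Fin n) :
    Measurable fun w : BProfile n m × SProfile m => (MA I).p (virtualCosts I w.2) w.1 i := by
  have h := (measurable_MA_p I i).comp (measurable_costs_profile I)
  exact h

/-- The threshold is jointly measurable in profile and quantile, being the supremum of a downward
closed part of the support; the moving endpoint of the integral is absorbed into an indicator. -/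
theorem measurable_reduction_pS (j : Fin m) : Measurable fun w : BProfile n m × SProfile m =>
    (reduction I (MA I)).pS w.1 w.2 j := by
  set x : BProfile n m × SProfile m → ℝ := fun w => (MA I).sold (virtualCosts I w.2) w.1 j
    with hx
  have hxm : Measurable x := measurable_reduction_xS I j
  have hx0 : ∀ w, 0 ≤ x w := fun w => sold_MA_mem.1
  set S : BProfile n m × SProfile m → ℝ → ℝ := fun w z =>
    (MA I).sold (virtualCosts I (Function.update w.2 j z)) w.1 j with hS
  have hT : Measurable fun q : (BProfile n m × SProfile m) × ℝ =>
      threshold (I.DS j).support (S q.1) q.2 := by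
    refine measurable_sSup_of_downClosed (K := (I.DS j).support)
      (S := fun q : (BProfile n m × SProfile m) × ℝ => {y | q.2 ≤ S q.1 y})
      (fun q y _ z _ h (hz : q.2 ≤ S q.1 z) => hz.trans
        (sold_update_anti q.1.1 q.1.2 j (sellerVirtual_mono _ h))) fun z => ?_
    have hSz : Measurable fun w : BProfile n m × SProfile m => S w z := by
      have h1 : Measurable fun w : BProfile n m × SProfile m =>
          (w.1, Function.update w.2 j z) := by
        refine measurable_fst.prodMk (measurable_pi_iff.2 fun k => ?_)
        by_cases hk : k = j
        · subst hk; simp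
        · simp only [Function.update_of_ne hk]; fun_prop
      have h2 := (measurable_reduction_xS I j).comp h1
      exact h2
    have h3 : Measurable fun q : (BProfile n m × SProfile m) × ℝ => S q.1 z :=
      hSz.comp measurable_fst
    exact measurableSet_le measurable_snd h3
  have heq : (fun w : BProfile n m × SProfile m => (reduction I (MA I)).pS w.1 w.2 j) =
      fun w => ∫ u, (Ioc 0 (x w)).indicator (threshold (I.DS j).support (S w)) u := by
    funext w
    rw [reduction_pS, intervalIntegral.integral_of_le (hx0 w),
      integral_indicator measurableSet_Ioc]
  rw [heq]
  have hset : MeasurableSet {q : (BProfile n m × SProfile m) × ℝ | q.2 ∈ Ioc 0 (x q.1)} :=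
    (measurableSet_lt measurable_const measurable_snd).inter
      (measurableSet_le measurable_snd (hxm.comp measurable_fst))
  have := (hT.indicator hset).stronglyMeasurable.integral_prod_right' (ν := volume)
  exact this.measurable

theorem wellFormed_reduction : (reduction I (MA I)).WellFormed I where
  meas_xB i j := measurable_reduction_xB I i j
  meas_xS j := measurable_reduction_xS I j
  meas_pB i := measurable_reduction_pB I i
  meas_pS j := measurable_reduction_pS I j
  xB_mem v _ s _ i j := ⟨x_MA_nonneg, x_MA_le_one⟩
  xS_mem v _ s _ j := sold_MA_mem
  pB_nonneg v _ s _ i := by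
    change 0 ≤ (MA I).p _ v i
    rw [p_MA]
    have h1 := p_MIT_nonneg (I := I) (c := virtualCosts I s) (v := v) (i := i)
    have h2 := p_MBVCG_nonneg (I := I) (c := virtualCosts I s) (v := v) (i := i)
    change 0 ≤ 3 / 4 * (MIT I).p (virtualCosts I s) v i + 1 / 4 * (MBVCG I).p (virtualCosts I s) v i
    linarith
  pS_nonneg v _ s _ j := by
    rw [reduction_pS]
    refine intervalIntegral.integral_nonneg sold_MA_mem.1 fun u _ => ?_
    exact threshold_nonneg (fun y hy => nonneg_of_mem_support (I.nonnegS j) hy) u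

-- Individual rationality bounds the payment by the sum of the buyer's values, which have finite
-- means.
variable {I} in
theorem integrable_pB {M : Mechanism n m} (hwf : M.WellFormed I) (hir : M.IR I)
    (hmean : ∀ i j, Integrable (fun z : ℝ => z) (I.DB i j)) (i : Fin n) :
    Integrable (fun w : BProfile n m × SProfile m => M.pB w.1 w.2 i) I.dist := by
  refine Integrable.mono' (integrable_finsetSum Finset.univ fun j _ => integrable_value hmean i j)
    (hwf.meas_pB i).aestronglyMeasurable ?_
  filter_upwards [ae_mem_TB_TS I] with w hw
  rw [Real.norm_of_nonneg (hwf.pB_nonneg _ hw.1 _ hw.2 i)]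
  have h1 := hir.buyer _ hw.1 _ hw.2 i
  unfold Mechanism.utilityB at h1
  have h2 : ∑ j, M.xB w.1 w.2 i j * w.1 i j ≤ ∑ j, w.1 i j := Finset.sum_le_sum fun j _ =>
    mul_le_of_le_one_left (nonneg_of_mem_TB hw.1 i j) (hwf.xB_mem _ hw.1 _ hw.2 i j).2
  linarith

theorem admissible_reduction (hmean : ∀ i j, Integrable (fun z : ℝ => z) (I.DB i j)) :
    (reduction I (MA I)).Admissible I := by
  have hwf := wellFormed_reduction I
  have hK : ∀ j, ∀ y ∈ (I.DS j).support, 0 ≤ y := fun j y hy =>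
    nonneg_of_mem_support (I.nonnegS j) hy
  have hutil : ∀ i w v s, (reduction I (MA I)).utilityB i w v s =
      (MA I).utility (virtualCosts I s) i w v := fun _ _ _ _ => rfl
  have hbuyer : ∀ v ∈ I.TB, ∀ s ∈ I.TS, ∀ i, 0 ≤ (reduction I (MA I)).utilityB i (v i) v s := by
    intro v hv s _ i
    rw [hutil, utility_MA]
    have h1 := utility_MIT_nonneg (c := virtualCosts I s) (i := i) hv
    have h2 := utility_MBVCG_nonneg (c := virtualCosts I s) (i := i) hv
    linarith
  -- The threshold curve of a seller does not involve her own report; only the upper limit of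
  -- integration does.
  have hpS : ∀ (v : BProfile n m) (s : SProfile m) (j : Fin m) (z : ℝ),
      (reduction I (MA I)).pS v (Function.update s j z) j =
      ∫ u in (0 : ℝ)..(MA I).sold (virtualCosts I (Function.update s j z)) v j,
        threshold (I.DS j).support
          (fun z => (MA I).sold (virtualCosts I (Function.update s j z)) v j) u := by
    intro v s j z
    rw [reduction_pS]
    simp only [Function.update_idem]
  have hseller : ∀ v ∈ I.TB, ∀ s ∈ I.TS, ∀ j, 0 ≤ (reduction I (MA I)).utilityS j (s j) v s := by
    intro v hv s hs j
    have h := mul_le_integral_threshold (hK j) (sum_value_nonneg hv j)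
      (x := fun z => (MA I).sold (virtualCosts I (Function.update s j z)) v j)
      (fun y _ hy => le_sum_value_of_sold_pos hv s j hy) (hs j) le_rfl sold_MA_mem.1 le_rfl
    have h2 := hpS v s j (s j)
    rw [Function.update_eq_self] at h h2
    change 0 ≤ (reduction I (MA I)).pS v s j - s j * (MA I).sold (virtualCosts I s) v j
    rw [h2]
    simp only [sub_zero] at h
    linarith
  refine ⟨hwf, fun v _ s _ j => le_rfl, ⟨?_, ?_⟩, ⟨hbuyer, hseller⟩, ?_⟩
  · intro v hv s _ i w hw
    rw [hutil, hutil, utility_MA, utility_MA]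
    have h1 := utility_MIT_dsic (c := virtualCosts I s) (i := i) hv hw
    have h2 := utility_MBVCG_dsic (c := virtualCosts I s) (i := i) hv (w := w)
    linarith
  · intro v hv s hs j z hz
    have h := threshold_dsic (hK j) (sum_value_nonneg hv j)
      (x := fun z => (MA I).sold (virtualCosts I (Function.update s j z)) v j)
      (fun y _ hy => le_sum_value_of_sold_pos hv s j hy) (fun y _ => sold_MA_mem.1)
      (fun y _ z _ h => sold_update_anti v s j (sellerVirtual_mono _ h)) (hs j) hz
    have h1 := hpS v s j (s j)
    have h2 := hpS v s j z
    rw [Function.update_eq_self] at h1 h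
    change (reduction I (MA I)).pS v (Function.update s j z) j -
        s j * (MA I).sold (virtualCosts I (Function.update s j z)) v j ≤
      (reduction I (MA I)).pS v s j - s j * (MA I).sold (virtualCosts I s) v j
    rw [h1, h2]
    exact h
  · have hval : ∀ i j, Integrable (fun w : BProfile n m × SProfile m => w.1 i j) I.dist :=
      integrable_value hmean
    refine Integrable.sub (integrable_finsetSum _ fun i _ => ?_)
      (integrable_finsetSum _ fun j _ => ?_)
    · exact integrable_pB hwf ⟨hbuyer, hseller⟩ hmean i
    · refine Integrable.mono' (integrable_finsetSum Finset.univ fun i _ => hval i j)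
        (hwf.meas_pS j).aestronglyMeasurable ?_
      filter_upwards [ae_mem_TB_TS I] with w hw
      rw [Real.norm_of_nonneg (hwf.pS_nonneg _ hw.1 _ hw.2 j)]
      have hV := sum_value_nonneg hw.1 j
      have hle : ∀ y ∈ (I.DS j).support,
          0 < (MA I).sold (virtualCosts I (Function.update w.2 j y)) w.1 j →
            y ≤ ∑ i, w.1 i j := fun y _ hy => le_sum_value_of_sold_pos hw.1 w.2 j hy
      have hsold := sold_MA_mem (I := I) (c := virtualCosts I w.2) (v := w.1) (j := j)
      rw [reduction_pS]
      calc _ ≤ ∫ _ in (0 : ℝ)..(MA I).sold (virtualCosts I w.2) w.1 j, ∑ i, w.1 i j :=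
            intervalIntegral.integral_mono_on_of_le_Ioo hsold.1
              (intervalIntegrable_threshold (hK j) hV hle le_rfl hsold.1) (by simp)
              fun u hu => threshold_le hV hle hu.1
        _ = (MA I).sold (virtualCosts I w.2) w.1 j * ∑ i, w.1 i j := by simp
        _ ≤ _ := mul_le_of_le_one_left hV hsold.2

end

end Broker

namespace Broker
open Filter Topology

/-! ### The surplus outside of the favorite item -/

section CoreTail

variable {ι : Type*} [Fintype ι] {α : ι → Type*} [∀ j, MeasurableSpace (α j)]
  {μ : ∀ j, Measure (α j)} [∀ j, IsProbabilityMeasure (μ j)] {X : ∀ j, α j → ℝ≥0∞} {r : ι → ℝ≥0∞}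

/-- The tail: values above the level `∑ k, r k` that are exceeded by another one. -/
theorem setLIntegral_exceeded_le (hX : ∀ j, Measurable (X j)) (hXt : ∀ j z, X j z ≠ ⊤)
    (hr : ∀ j x, x ≠ ⊤ → x * μ j {z | x ≤ X j z} ≤ r j) (j : ι) :
    ∫⁻ t in {t | ∑ k, r k < X j (t j) ∧ ∃ k, k ≠ j ∧ X j (t j) ≤ X k (t k)}, X j (t j)
      ∂Measure.pi μ ≤ r j := by
  classical
  by_cases hR : ∑ k, r k = ⊤
  · have : {t : ∀ j, α j | ∑ k, r k < X j (t j) ∧ ∃ k, k ≠ j ∧ X j (t j) ≤ X k (t k)} = ∅ := by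
      ext t; simp [hR]
    rw [this]; simp
  have hXm : ∀ k, Measurable fun t : ∀ j, α j => X k (t k) := fun k =>
    (hX k).comp (measurable_pi_apply k)
  have hset : ∀ k, MeasurableSet {t : ∀ j, α j | ∑ k, r k < X j (t j) ∧ X j (t j) ≤ X k (t k)} :=
    fun k => (measurableSet_lt measurable_const (hXm j)).inter (measurableSet_le (hXm j) (hXm k))
  have hS : MeasurableSet {t : ∀ j, α j | ∑ k, r k < X j (t j)} :=
    measurableSet_lt measurable_const (hXm j)
  -- Resample coordinate `k` with `X j (t j)` fixed: the assumed tail bound of `X k` is applied at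
  -- the level `X j (t j)`.
  have hcomp : ∀ k, k ≠ j → ∫⁻ t in {t | ∑ k, r k < X j (t j) ∧ X j (t j) ≤ X k (t k)}, X j (t j)
      ∂Measure.pi μ ≤ r k * Measure.pi μ {t | ∑ k, r k < X j (t j)} := by
    intro k hk
    rw [← lintegral_indicator (hset k), lintegral_pi_update μ k ((hXm j).indicator (hset k)),
      ← lintegral_indicator_const hS]
    refine lintegral_mono fun t => ?_
    by_cases ht : ∑ k, r k < X j (t j)
    · calc _ = ∫⁻ z, {z | X j (t j) ≤ X k z}.indicator (fun _ => X j (t j)) z ∂μ k := by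
            refine lintegral_congr fun z => ?_
            simp only [indicator, mem_ofPred_eq, Function.update_self,
              Function.update_of_ne hk.symm, ht, true_and]
        _ = X j (t j) * μ k {z | X j (t j) ≤ X k z} :=
            lintegral_indicator_const (measurableSet_le measurable_const (hX k)) _
        _ ≤ r k := hr k _ (hXt j _)
        _ = _ := by simp [indicator, ht]
    · simp [indicator, Function.update_of_ne hk.symm, ht]
  calc _ ≤ ∫⁻ t in ⋃ k ∈ Finset.univ.erase j,
          {t | ∑ k, r k < X j (t j) ∧ X j (t j) ≤ X k (t k)}, X j (t j) ∂Measure.pi μ := by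
        refine lintegral_mono_set fun t ht => ?_
        obtain ⟨h1, k, hk, h2⟩ := ht
        exact mem_biUnion (by simp [hk]) ⟨h1, h2⟩
    _ ≤ ∑ k ∈ Finset.univ.erase j,
          ∫⁻ t in {t | ∑ k, r k < X j (t j) ∧ X j (t j) ≤ X k (t k)}, X j (t j) ∂Measure.pi μ := by
        rw [← Finset.set_biUnion_coe, biUnion_eq_iUnion]
        refine (lintegral_iUnion_le _ _).trans ?_
        rw [tsum_fintype]
        exact (Finset.sum_coe_sort (Finset.univ.erase j) fun k =>
          ∫⁻ t in {t | ∑ k, r k < X j (t j) ∧ X j (t j) ≤ X k (t k)}, X j (t j) ∂Measure.pi μ).le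
    _ ≤ ∑ k ∈ Finset.univ.erase j, r k * Measure.pi μ {t | ∑ k, r k < X j (t j)} :=
        Finset.sum_le_sum fun k hk => hcomp k (Finset.ne_of_mem_erase hk)
    _ ≤ (∑ k, r k) * Measure.pi μ {t | ∑ k, r k < X j (t j)} := by
        rw [← Finset.sum_mul]
        gcongr
        exact Finset.erase_subset _ _
    -- The factor `∑ k, r k` is itself a level, and the tail bound of `X j` there gives `r j`.
    _ ≤ (∑ k, r k) * μ j {z | ∑ k, r k ≤ X j z} := by
        gcongr
        rw [← (measurePreserving_eval μ j).measure_preimage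
          (measurableSet_le measurable_const (hX j)).nullMeasurableSet]
        exact measure_mono fun t ht => by
          have h : ∑ k, r k < X j (t j) := ht
          exact h.le
    _ ≤ r j := hr j _ hR

/-- Second moments from a tail bound, for a bounded variable. -/
theorem integral_sq_le_of_tail {β : Type*} [MeasurableSpace β] {ν : Measure β}
    [IsProbabilityMeasure ν] {Y : β → ℝ} {R ρ : ℝ} (hY : Measurable Y) (hY0 : ∀ z, 0 ≤ Y z)
    (hYR : ∀ z, Y z ≤ R) (hR : 0 ≤ R) (hρ : 0 ≤ ρ)
    (htail : ∀ x, 0 < x → ENNReal.ofReal x * ν {z | x ≤ Y z} ≤ ENNReal.ofReal ρ) :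
    ∫ z, Y z ^ 2 ∂ν ≤ 2 * R * ρ := by
  -- Layer cake: the second moment is the integral of `2 * t * ν {t ≤ Y}` over `(0, R]`, where the
  -- integrand is at most `2 * ρ`.
  have h := lintegral_rpow_eq_lintegral_meas_le_mul ν (f := Y) (Eventually.of_forall hY0)
    hY.aemeasurable (p := 2) (by norm_num)
  rw [integral_eq_lintegral_of_nonneg_ae (Eventually.of_forall fun z => sq_nonneg _)
    (hY.pow_const 2).aestronglyMeasurable]
  refine ENNReal.toReal_le_of_le_ofReal (by positivity) ?_
  simp only [Real.rpow_two] at h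
  rw [h]
  have h2 : ∫⁻ t in Ioi (0 : ℝ), ν {z | t ≤ Y z} * ENNReal.ofReal (t ^ ((2 : ℝ) - 1)) ≤
      ∫⁻ t in Ioi (0 : ℝ), (Ioc 0 R).indicator (fun _ => ENNReal.ofReal ρ) t := by
    refine setLIntegral_mono' measurableSet_Ioi fun t (ht : 0 < t) => ?_
    by_cases htR : t ≤ R
    · rw [indicator_of_mem (show t ∈ Ioc 0 R from ⟨ht, htR⟩), mul_comm]
      norm_num
      exact htail t ht
    · have : {z | t ≤ Y z} = ∅ := by
        ext z
        simp only [mem_ofPred_eq, mem_empty_iff_false, iff_false, not_le]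
        exact (hYR z).trans_lt (not_le.1 htR)
      rw [this]
      simp
  calc _ ≤ ENNReal.ofReal 2 *
        ∫⁻ t in Ioi (0 : ℝ), (Ioc 0 R).indicator (fun _ => ENNReal.ofReal ρ) t := by gcongr
    _ ≤ ENNReal.ofReal 2 * ∫⁻ t, (Ioc 0 R).indicator (fun _ => ENNReal.ofReal ρ) t := by
        gcongr
        exact Measure.restrict_le_self
    _ = ENNReal.ofReal (2 * R * ρ) := by
        rw [lintegral_indicator_const measurableSet_Ioc, Real.volume_Ioc, sub_zero,
          ← ENNReal.ofReal_mul hρ, ← ENNReal.ofReal_mul (by norm_num)]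
        congr 1
        ring

/-- The core: the mean of a sum of bounded independent variables is controlled by its median. -/
theorem half_le_measure_sum_ge {Y : ∀ j, α j → ℝ} {ρ : ι → ℝ} (hY : ∀ j, Measurable (Y j))
    (hY0 : ∀ j z, 0 ≤ Y j z) (hYR : ∀ j z, Y j z ≤ ∑ k, ρ k) (hρ : ∀ j, 0 ≤ ρ j)
    (htail : ∀ j x, 0 < x → ENNReal.ofReal x * μ j {z | x ≤ Y j z} ≤ ENNReal.ofReal (ρ j)) :
    1 / 2 ≤ Measure.pi μ {t | (∑ j, ∫ z, Y j z ∂μ j) - 2 * ∑ k, ρ k ≤ ∑ j, Y j (t j)} := by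
  set R := ∑ k, ρ k with hR
  have hR0 : 0 ≤ R := Finset.sum_nonneg fun k _ => hρ k
  -- Chebyshev needs a positive deviation; for `R = 0` all variables vanish.
  rcases hR0.eq_or_lt with h0 | hpos
  · have hz : ∀ j z, Y j z = 0 := fun j z => le_antisymm ((hYR j z).trans h0.symm.le) (hY0 j z)
    simp [hz, ← h0]
  have hL2 : ∀ j, MemLp (Y j) 2 (μ j) := fun j =>
    MemLp.of_bound (hY j).aestronglyMeasurable R (Eventually.of_forall fun z => by
      rw [Real.norm_of_nonneg (hY0 j z)]; exact hYR j z)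
  -- By independence the variances add up, each being at most the second moment bound `2 * R * ρ j`.
  have hvar : ProbabilityTheory.variance (∑ j, fun t : ∀ j, α j => Y j (t j)) (Measure.pi μ) ≤
      2 * R ^ 2 := by
    rw [ProbabilityTheory.variance_sum_pi hL2]
    calc _ ≤ ∑ j, 2 * R * ρ j := Finset.sum_le_sum fun j _ =>
          (ProbabilityTheory.variance_le_expectation_sq (hY j).aestronglyMeasurable).trans
            (integral_sq_le_of_tail (hY j) (hY0 j) (hYR j) hR0 (hρ j) (htail j))
      _ = 2 * R ^ 2 := by rw [← Finset.mul_sum, ← hR]; ring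
  have hL2' : MemLp (∑ j, fun t : ∀ j, α j => Y j (t j)) 2 (Measure.pi μ) :=
    memLp_finsetSum' _ fun j _ => (hL2 j).comp_measurePreserving (measurePreserving_eval μ j)
  have hmean : ∫ t, (∑ j, fun t : ∀ j, α j => Y j (t j)) t ∂Measure.pi μ =
      ∑ j, ∫ z, Y j z ∂μ j := by
    simp only [Finset.sum_apply]
    have hint : ∀ j, Integrable (fun t : ∀ j, α j => Y j (t j)) (Measure.pi μ) := fun j =>
      ((hL2 j).comp_measurePreserving (measurePreserving_eval μ j)).integrable one_le_two
    rw [integral_finsetSum _ fun j _ => hint j]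
    refine Finset.sum_congr rfl fun j _ => ?_
    exact integral_comp_eval (μ := μ) (hY j).aestronglyMeasurable
  -- A deviation of `2 * R` has probability at most `2 * R ^ 2 / (2 * R) ^ 2 = 1 / 2`.
  have hch := ProbabilityTheory.meas_ge_le_variance_div_sq hL2' (c := 2 * R) (by positivity)
  rw [hmean] at hch
  simp only [Finset.sum_apply] at hch
  have hhalf : ENNReal.ofReal (ProbabilityTheory.variance
      (∑ j, fun t : ∀ j, α j => Y j (t j)) (Measure.pi μ) / (2 * R) ^ 2) ≤ 1 / 2 := by
    have : (1 / 2 : ℝ≥0∞) = ENNReal.ofReal (1 / 2) := by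
      rw [ENNReal.ofReal_div_of_pos (by norm_num)]; simp
    rw [this]
    apply ENNReal.ofReal_le_ofReal
    rw [div_le_iff₀ (by positivity)]
    nlinarith
  set S := {t : ∀ j, α j | (∑ j, ∫ z, Y j z ∂μ j) - 2 * R ≤ ∑ j, Y j (t j)} with hS
  have hSm : MeasurableSet S := measurableSet_le measurable_const
    (Finset.measurable_sum _ fun j _ => (hY j).comp (measurable_pi_apply j))
  have hSc : Measure.pi μ Sᶜ ≤ 1 / 2 := by
    refine (measure_mono fun t ht => ?_).trans (hch.trans hhalf)
    have ht' : ∑ j, Y j (t j) < (∑ j, ∫ z, Y j z ∂μ j) - 2 * R := not_le.1 ht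
    change 2 * R ≤ |_|
    rw [abs_of_nonpos (by linarith)]
    linarith
  have h1 := prob_add_prob_compl (μ := Measure.pi μ) hSm
  have h2 : (1 : ℝ≥0∞) ≤ Measure.pi μ S + 1 / 2 := h1.symm.le.trans (by gcongr)
  calc (1 / 2 : ℝ≥0∞) = 1 - 1 / 2 := by simp
    _ ≤ _ := tsub_le_iff_right.2 h2

/-- The expected surplus outside of the favorite coordinate, by the core-tail decomposition at the
level `∑ j, r j`. -/
theorem lintegral_sum_exceeded_le (hX : ∀ j, Measurable (X j)) (hXt : ∀ j z, X j z ≠ ⊤)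
    (hr : ∀ j x, x ≠ ⊤ → x * μ j {z | x ≤ X j z} ≤ r j) (F : ι → Set (∀ j, α j))
    (hFm : ∀ j, MeasurableSet (F j))
    (hF : ∀ j, ∀ t ∈ F j, 0 < X j (t j) → ∃ k, k ≠ j ∧ X j (t j) ≤ X k (t k)) :
    ∫⁻ t, ∑ j, (F j).indicator (fun t => X j (t j)) t ∂Measure.pi μ ≤ 3 * (∑ j, r j) +
      ENNReal.ofReal (sSup {e : ℝ | 1 / 2 ≤ Measure.pi μ {t | e ≤ ∑ j, (X j (t j)).toReal}}) := by
  set E := sSup {e : ℝ | 1 / 2 ≤ Measure.pi μ {t | e ≤ ∑ j, (X j (t j)).toReal}} with hE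
  by_cases hR : ∑ k, r k = ⊤
  · rw [hR]; simp
  have hrt : ∀ k, r k ≠ ⊤ := fun k hk => hR (ENNReal.sum_eq_top.2 ⟨k, Finset.mem_univ _, hk⟩)
  have hXm : ∀ k, Measurable fun t : ∀ j, α j => X k (t k) := fun k =>
    (hX k).comp (measurable_pi_apply k)
  -- The core: each variable is set to 0 above the level `∑ k, r k`.
  set Y : ∀ j, α j → ℝ := fun j => {z | X j z ≤ ∑ k, r k}.indicator fun z => (X j z).toReal with hY
  have hset : ∀ j, MeasurableSet {z | X j z ≤ ∑ k, r k} := fun j =>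
    measurableSet_le (hX j) measurable_const
  have hYm : ∀ j, Measurable (Y j) := fun j => (hX j).ennreal_toReal.indicator (hset j)
  have hY0 : ∀ j z, 0 ≤ Y j z := fun j z => indicator_nonneg (fun _ _ => ENNReal.toReal_nonneg) _
  have hYX : ∀ j z, Y j z ≤ (X j z).toReal := fun j z =>
    indicator_le_self' (fun _ _ => ENNReal.toReal_nonneg) _
  have hRsum : ∑ k, (r k).toReal = (∑ k, r k).toReal := (ENNReal.toReal_sum fun k _ => hrt k).symm
  have hYR : ∀ j z, Y j z ≤ ∑ k, (r k).toReal := by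
    intro j z
    rw [hRsum]
    simp only [hY, indicator_apply]
    split_ifs with h
    · exact ENNReal.toReal_mono hR h
    · exact ENNReal.toReal_nonneg
  have hmed := half_le_measure_sum_ge (μ := μ) hYm hY0 hYR (fun j => ENNReal.toReal_nonneg)
    (fun j x hx => by
      rw [ENNReal.ofReal_toReal (hrt j)]
      refine le_trans ?_ (hr j (ENNReal.ofReal x) ENNReal.ofReal_ne_top)
      gcongr with z
      intro h
      exact ENNReal.ofReal_le_of_le_toReal (h.trans (hYX j z)))
  -- The full sum dominates the core sum, so its largest median is at least the core mean minus
  -- twice the level.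
  have hcore : (∑ j, ∫ z, Y j z ∂μ j) - 2 * ∑ k, (r k).toReal ≤ E := by
    refine le_median (Measure.pi μ) (Finset.measurable_sum _ fun j _ => (hXm j).ennreal_toReal)
      (hmed.trans (measure_mono fun t ht => ?_))
    exact le_trans (show _ ≤ _ from ht) (Finset.sum_le_sum fun j _ => hYX j _)
  have hE0 : 0 ≤ E := median_nonneg _ fun t => Finset.sum_nonneg fun j _ => ENNReal.toReal_nonneg
  have hYint : ∀ j, Integrable (Y j) (μ j) := fun j =>
    Integrable.of_bound (hYm j).aestronglyMeasurable (∑ k, (r k).toReal)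
      (Eventually.of_forall fun z => by rw [Real.norm_of_nonneg (hY0 j z)]; exact hYR j z)
  have hcoreE : ∑ j, ∫⁻ z, ENNReal.ofReal (Y j z) ∂μ j ≤ 2 * (∑ k, r k) + ENNReal.ofReal E := by
    calc _ = ∑ j, ENNReal.ofReal (∫ z, Y j z ∂μ j) := Finset.sum_congr rfl fun j _ =>
          (ofReal_integral_eq_lintegral_ofReal (hYint j) (Eventually.of_forall (hY0 j))).symm
      _ = ENNReal.ofReal (∑ j, ∫ z, Y j z ∂μ j) :=
          (ENNReal.ofReal_sum_of_nonneg fun j _ => integral_nonneg (hY0 j)).symm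
      _ ≤ ENNReal.ofReal (2 * (∑ k, r k).toReal + E) := by
          apply ENNReal.ofReal_le_ofReal
          rw [← hRsum]
          linarith
      _ = _ := by
          rw [ENNReal.ofReal_add (by positivity) hE0, ENNReal.ofReal_mul (by norm_num),
            ENNReal.ofReal_toReal hR]
          simp
  -- On `F j` a value is either in the core or in the exceeded tail. The tails cost `∑ j, r j` once
  -- and the core twice, which gives the constant 3.
  have hsplit : ∀ j, ∫⁻ t, (F j).indicator (fun t => X j (t j)) t ∂Measure.pi μ ≤
      r j + ∫⁻ z, ENNReal.ofReal (Y j z) ∂μ j := by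
    intro j
    have hT : MeasurableSet {t : ∀ j, α j | ∑ k, r k < X j (t j) ∧
        ∃ k, k ≠ j ∧ X j (t j) ≤ X k (t k)} := by
      refine (measurableSet_lt measurable_const (hXm j)).inter ?_
      have : {t : ∀ j, α j | ∃ k, k ≠ j ∧ X j (t j) ≤ X k (t k)} =
          ⋃ k, ⋃ _ : k ≠ j, {t | X j (t j) ≤ X k (t k)} := by
        ext t; simp
      change MeasurableSet {t : ∀ j, α j | ∃ k, k ≠ j ∧ X j (t j) ≤ X k (t k)}
      rw [this]
      exact MeasurableSet.iUnion fun k => MeasurableSet.iUnion fun _ =>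
        measurableSet_le (hXm j) (hXm k)
    calc _ ≤ ∫⁻ t, ({t | ∑ k, r k < X j (t j) ∧ ∃ k, k ≠ j ∧ X j (t j) ≤ X k (t k)}.indicator
            (fun t => X j (t j)) t + ENNReal.ofReal (Y j (t j))) ∂Measure.pi μ := by
          refine lintegral_mono fun t => ?_
          by_cases ht : t ∈ F j
          · rw [indicator_of_mem ht]
            rcases le_or_gt (X j (t j)) (∑ k, r k) with h | h
            · refine le_trans ?_ le_add_self
              simp only [hY]
              rw [indicator_of_mem (show t j ∈ {z | X j z ≤ ∑ k, r k} from h),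
                ENNReal.ofReal_toReal (hXt j _)]
            · have hmem : t ∈ {t : ∀ j, α j | ∑ k, r k < X j (t j) ∧
                  ∃ k, k ≠ j ∧ X j (t j) ≤ X k (t k)} := ⟨h, hF j t ht (bot_le.trans_lt h)⟩
              rw [indicator_of_mem hmem]
              exact le_self_add
          · simp [indicator_of_notMem ht]
      _ = _ := by
          rw [lintegral_add_left ((hXm j).indicator hT), lintegral_indicator hT]
          congr 1
          exact (measurePreserving_eval μ j).lintegral_comp (hYm j).ennreal_ofReal
      _ ≤ _ := add_le_add_left (setLIntegral_exceeded_le hX hXt hr j) _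
  rw [lintegral_finsetSum _ fun j _ => (hXm j).indicator (hFm j)]
  calc _ ≤ ∑ j, (r j + ∫⁻ z, ENNReal.ofReal (Y j z) ∂μ j) := Finset.sum_le_sum fun j _ => hsplit j
    _ = ∑ j, r j + ∑ j, ∫⁻ z, ENNReal.ofReal (Y j z) ∂μ j := Finset.sum_add_distrib
    _ ≤ ∑ j, r j + (2 * (∑ k, r k) + ENNReal.ofReal E) := by gcongr
    _ = _ := by ring

end CoreTail

end Broker

namespace Broker
open Filter Topology

/-! ### Favorite items and the buyers' payments -/

section

variable {n m : ℕ}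

/-- The excess `(v i j - β_ij)⁺` of a value over its reserve. -/
noncomputable def excess (c : Costs m) (v : BProfile n m) (i : Fin n) (j : Fin m) : ℝ≥0∞ :=
  ENNReal.ofReal (v i j) - reserve c v i j

/-- Item `j` is the favorite of buyer `i`: its excess is positive and the first largest one. -/
def IsFavorite (c : Costs m) (v : BProfile n m) (i : Fin n) (j : Fin m) : Prop :=
  0 < excess c v i j ∧ IsFirstMax (excess c v i) j

/-- The largest virtual surplus `max_i (φ_ij(v_ij)⁺ - c_j)⁺` of item `j`. -/
noncomputable def virtualSurplus (I : Market n m) (c : Costs m) (v : BProfile n m) (j : Fin m) :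
    ℝ≥0∞ := ⨆ i, (posVirtual (I.DB i j) (v i j) - c j)

/-- The surplus `max_i (min(v_ij, β_ij) - c_j)⁺` of item `j` that a second-price auction collects. -/
noncomputable def secondSurplus (c : Costs m) (v : BProfile n m) (j : Fin m) : ℝ≥0∞ :=
  ⨆ i, (min (ENNReal.ofReal (v i j)) (reserve c v i j) - c j)

theorem measurable_cost (j : Fin m) : Measurable fun w : Costs m × BProfile n m => w.1 j :=
  (measurable_pi_apply j).comp measurable_fst

theorem measurable_reserve_apply (i : Fin n) (j : Fin m) :
    Measurable fun w : Costs m × BProfile n m => reserve w.1 w.2 i j :=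
  (measurable_pi_apply j).comp (measurable_reserve i)

theorem measurable_excess (i : Fin n) (j : Fin m) :
    Measurable fun w : Costs m × BProfile n m => excess w.1 w.2 i j :=
  (measurable_value i j).ennreal_ofReal.sub (measurable_reserve_apply i j)

theorem measurableSet_isFavorite (i : Fin n) (j : Fin m) :
    MeasurableSet {w : Costs m × BProfile n m | IsFavorite w.1 w.2 i j} :=
  (measurableSet_lt measurable_const (measurable_excess i j)).inter
    (measurableSet_isFirstMax (fun k => measurable_excess i k) j)

theorem measurable_posVirtual_value (I : Market n m) (i : Fin n) (j : Fin m) :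
    Measurable fun w : Costs m × BProfile n m => posVirtual (I.DB i j) (w.2 i j) :=
  (measurable_posVirtual _).comp (measurable_value i j)

theorem measurable_virtualSurplus (I : Market n m) (j : Fin m) :
    Measurable fun w : Costs m × BProfile n m => virtualSurplus I w.1 w.2 j :=
  Measurable.iSup fun i => (measurable_posVirtual_value I i j).sub (measurable_cost j)

theorem measurable_secondSurplus (j : Fin m) :
    Measurable fun w : Costs m × BProfile n m => secondSurplus w.1 w.2 j :=
  Measurable.iSup fun i => ((measurable_value i j).ennreal_ofReal.min
    (measurable_reserve_apply i j)).sub (measurable_cost j)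

variable {c : Costs m} {v : BProfile n m} {i : Fin n} {j : Fin m}

theorem IsFavorite.unique {k : Fin m} (hj : IsFavorite c v i j) (hk : IsFavorite c v i k) : j = k :=
  hj.2.unique hk.2

theorem reserve_setValue (c : Costs m) (v : BProfile n m) (i : Fin n) (j : Fin m) (z : ℝ) :
    reserve c (setValue v i j z) i = reserve c v i := reserve_update c v i _

theorem excess_setValue_self (c : Costs m) (v : BProfile n m) (i : Fin n) (j : Fin m) (z : ℝ) :
    excess c (setValue v i j z) i j = ENNReal.ofReal z - reserve c v i j := by
  rw [excess, setValue_self, reserve_setValue]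

/-- The reserves of a buyer ignore her own values, so raising one value raises only its own excess.
This upward closedness is what the single-parameter payment bound requires. -/
theorem IsFavorite.setValue_mono {z z' : ℝ} (hz : z ≤ z')
    (h : IsFavorite c (setValue v i j z) i j) : IsFavorite c (setValue v i j z') i j := by
  have hle : excess c (setValue v i j z) i j ≤ excess c (setValue v i j z') i j := by
    rw [excess_setValue_self, excess_setValue_self]
    exact tsub_le_tsub_right (ENNReal.ofReal_le_ofReal hz) _
  refine ⟨h.1.trans_le hle, h.2.update_mono hle fun k hk => ?_⟩
  simp only [excess, reserve_setValue, setValue_of_ne_item _ _ _ _ hk]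

theorem exists_excess_le_of_not_isFavorite (h : ¬ IsFavorite c v i j) (hpos : 0 < excess c v i j) :
    ∃ k, k ≠ j ∧ excess c v i j ≤ excess c v i k := by
  have h' : ¬ IsFirstMax (excess c v i) j := fun hf => h ⟨hpos, hf⟩
  unfold IsFirstMax at h'
  rw [not_and_or] at h'
  rcases h' with h' | h'
  · push Not at h'
    obtain ⟨k, hk⟩ := h'
    exact ⟨k, fun hkj => by subst hkj; exact lt_irrefl _ hk, hk.le⟩
  · push Not at h'
    obtain ⟨k, hkj, hk⟩ := h'
    exact ⟨k, hkj.ne, hk⟩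

/-- Split the value at the reserve: the part below it is cost plus what a second-price auction
collects, the part above it is the excess. -/
theorem ofReal_value_le : ENNReal.ofReal (v i j) ≤ c j + secondSurplus c v j + excess c v i j := by
  have h1 : min (ENNReal.ofReal (v i j)) (reserve c v i j) ≤ c j + secondSurplus c v j :=
    tsub_le_iff_left.1 (le_iSup (fun i => min (ENNReal.ofReal (v i j)) (reserve c v i j) - c j) i)
  calc ENNReal.ofReal (v i j) ≤ min (ENNReal.ofReal (v i j)) (reserve c v i j) +
        (ENNReal.ofReal (v i j) - reserve c v i j) := by
        rcases le_total (ENNReal.ofReal (v i j)) (reserve c v i j) with h | h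
        · rw [min_eq_left h]; exact le_self_add
        · rw [min_eq_right h, add_tsub_cancel_of_le h]
    _ ≤ _ := by unfold excess; gcongr

variable (I : Market n m)

theorem posVirtual_le_add_virtualSurplus :
    posVirtual (I.DB i j) (v i j) - c j ≤ virtualSurplus I c v j :=
  le_iSup (fun i => posVirtual (I.DB i j) (v i j) - c j) i

/-- Only the highest bidder for an item can have a virtual value above her reserve. -/
theorem sum_posVirtual_sub_reserve_le :
    ∑ i, (posVirtual (I.DB i j) (v i j) - reserve c v i j) ≤ virtualSurplus I c v j := by
  classical
  by_cases h : ∃ i, 0 < posVirtual (I.DB i j) (v i j) - reserve c v i j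
  swap
  · push Not at h
    rw [Finset.sum_eq_zero fun i _ => le_antisymm (h i) bot_le]
    exact bot_le
  obtain ⟨i, hi⟩ := h
  have hi' : reserve c v i j < ENNReal.ofReal (v i j) :=
    (tsub_pos_iff_lt.1 hi).trans_le (posVirtual_le _ _)
  rw [Finset.sum_eq_single i]
  · exact (tsub_le_tsub_left cost_le_reserve _).trans (posVirtual_le_add_virtualSurplus I)
  · intro k _ hk
    refine tsub_eq_zero_of_le ?_
    calc _ ≤ ENNReal.ofReal (v k j) := posVirtual_le _ _
      _ ≤ reserve c v i j := ofReal_le_reserve hk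
      _ ≤ ENNReal.ofReal (v i j) := hi'.le
      _ ≤ reserve c v k j := ofReal_le_reserve hk.symm
  · simp

/-- The profiles at which item `j` is the favorite of buyer `i`. -/
def favoriteSet (i : Fin n) (j : Fin m) : Set (BProfile n m × SProfile m) :=
  {w | IsFavorite (virtualCosts I w.2) w.1 i j}

theorem measurableSet_favoriteSet (i : Fin n) (j : Fin m) :
    MeasurableSet (favoriteSet I i j) :=
  measurable_costs_profile I (measurableSet_isFavorite i j)

theorem measurable_profile_value (i : Fin n) (j : Fin m) :
    Measurable fun w : BProfile n m × SProfile m => w.1 i j :=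
  (measurable_pi_apply j).comp ((measurable_pi_apply i).comp measurable_fst)

theorem measurable_profile_cost (j : Fin m) :
    Measurable fun w : BProfile n m × SProfile m => virtualCosts I w.2 j :=
  (measurable_pi_apply j).comp ((measurable_virtualCosts I).comp measurable_snd)

theorem measurable_profile_posVirtual (i : Fin n) (j : Fin m) :
    Measurable fun w : BProfile n m × SProfile m => posVirtual (I.DB i j) (w.1 i j) :=
  (measurable_posVirtual _).comp (measurable_profile_value i j)

theorem measurable_profile_setValue (v : BProfile n m) (s : SProfile m) (i : Fin n) (j : Fin m) :
    Measurable fun z : ℝ => (setValue v i j z, s) := by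
  have h : Measurable fun z : ℝ => setValue v i j z :=
    (measurable_setValue i j).comp measurable_prodMk_left
  exact h.prodMk measurable_const

/-! ### Splitting a buyer's payment along her favorite item -/

section Payments

variable {I} {M : Mechanism n m}

/-- Incentive compatibility between types that differ only in item `j`: by additivity, imitating
`z'` yields the utility of `z'` plus the difference of values on the quantity of `j` received. -/
theorem utilityB_setValue_le (hM : M.Admissible I) {v : BProfile n m} (hv : v ∈ I.TB)
    {s : SProfile m} (hs : s ∈ I.TS) (i : Fin n) (j : Fin m) {z z' : ℝ} (hz : z ∈ (I.DB i j).support)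
    (hz' : z' ∈ (I.DB i j).support) :
    (z - z') * M.xB (setValue v i j z') s i j +
        M.utilityB i (setValue v i j z' i) (setValue v i j z') s ≤
      M.utilityB i (setValue v i j z i) (setValue v i j z) s := by
  have h := hM.dsic.buyer _ (setValue_mem_TB hv hz) s hs i _ (setValue_mem_TB hv hz' i)
  have hup : Function.update (setValue v i j z) i (setValue v i j z' i) = setValue v i j z' := by
    simp [setValue]
  rw [hup] at h
  refine le_trans (le_of_eq ?_) h
  unfold Mechanism.utilityB
  rw [setValue_row, setValue_row, ← Finset.add_sum_erase _ _ (Finset.mem_univ j),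
    ← Finset.add_sum_erase Finset.univ (fun l => M.xB (setValue v i j z') s i l *
      Function.update (v i) j z l) (Finset.mem_univ j)]
  have : ∑ l ∈ Finset.univ.erase j, M.xB (setValue v i j z') s i l * Function.update (v i) j z l =
      ∑ l ∈ Finset.univ.erase j, M.xB (setValue v i j z') s i l * Function.update (v i) j z' l :=
    Finset.sum_congr rfl fun l hl => by
      rw [Function.update_of_ne (Finset.ne_of_mem_erase hl),
        Function.update_of_ne (Finset.ne_of_mem_erase hl)]
  rw [this]
  simp only [Function.update_self]
  ring

theorem measurable_utilityB (hM : M.Admissible I) (i : Fin n) :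
    Measurable fun w : BProfile n m × SProfile m => M.utilityB i (w.1 i) w.1 w.2 :=
  (Finset.measurable_sum _ fun j _ =>
    (hM.wellFormed.meas_xB i j).mul (measurable_profile_value i j)).sub (hM.wellFormed.meas_pB i)

/-- The part of the payment that is attributed to the favorite item is bounded by the virtual
value. -/
theorem setLIntegral_favorite_payment_le (hM : M.Admissible I)
    (hmean : ∀ i j, Integrable (fun z : ℝ => z) (I.DB i j)) (i : Fin n) (j : Fin m) :
    ∫⁻ w in favoriteSet I i j, ENNReal.ofReal (w.1 i j * M.xB w.1 w.2 i j -
        M.utilityB i (w.1 i) w.1 w.2) ∂I.dist ≤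
      ∫⁻ w in favoriteSet I i j, ((posVirtual (I.DB i j) (w.1 i j) - virtualCosts I w.2 j) +
        virtualCosts I w.2 j) * ENNReal.ofReal (M.xB w.1 w.2 i j) ∂I.dist := by
  have hF := measurableSet_favoriteSet I i j
  have hm1 : Measurable fun w : BProfile n m × SProfile m =>
      ENNReal.ofReal (w.1 i j * M.xB w.1 w.2 i j - M.utilityB i (w.1 i) w.1 w.2) :=
    (((measurable_profile_value i j).mul (hM.wellFormed.meas_xB i j)).sub
      (measurable_utilityB hM i)).ennreal_ofReal
  have hm2 : Measurable fun w : BProfile n m × SProfile m =>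
      ((posVirtual (I.DB i j) (w.1 i j) - virtualCosts I w.2 j) + virtualCosts I w.2 j) *
        ENNReal.ofReal (M.xB w.1 w.2 i j) :=
    (((measurable_profile_posVirtual I i j).sub (measurable_profile_cost I j)).add
      (measurable_profile_cost I j)).mul (hM.wellFormed.meas_xB i j).ennreal_ofReal
  rw [← lintegral_indicator hF, ← lintegral_indicator hF]
  refine lintegral_dist_mono_value I (hm1.indicator hF) (hm2.indicator hF) i j ?_
  filter_upwards [ae_mem_TB_TS I, ae_virtualCosts_ne_top I] with w hw hct
  obtain ⟨v, s⟩ := w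
  obtain ⟨hv, hs⟩ := hw
  have hsec := measurable_profile_setValue v s i j
  set W : Set ℝ := {z | IsFavorite (virtualCosts I s) (setValue v i j z) i j} with hW
  have hWm : MeasurableSet W := hsec hF
  have hxm : Measurable fun z : ℝ => M.xB (setValue v i j z) s i j := by
    have h := (hM.wellFormed.meas_xB i j).comp hsec
    exact h
  -- With the other values fixed, charge `z * x - u` for item `j`. The utility in this one-item
  -- mechanism is the total utility `u`, so incentive compatibility and individual rationality carry
  -- over.
  have key := setLIntegral_payment_le (I.nonnegB i j) (hmean i j) hWm
    (fun z hz z' h => IsFavorite.setValue_mono h hz)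
    (x := fun z => M.xB (setValue v i j z) s i j)
    (p := fun z => z * M.xB (setValue v i j z) s i j -
      M.utilityB i (setValue v i j z i) (setValue v i j z) s) hxm
    (fun z hz => (hM.wellFormed.xB_mem _ (setValue_mem_TB hv hz.1) s hs i j).1)
    (fun z hz z' hz' => by
      have := utilityB_setValue_le hM hv hs i j hz.1 hz'.1
      linarith)
    (fun z hz => by
      have := hM.ir.buyer _ (setValue_mem_TB hv hz.1) s hs i
      linarith) (hct j)
  rw [← lintegral_indicator hWm, ← lintegral_indicator hWm] at key
  refine le_trans (le_of_eq ?_) (key.trans (le_of_eq ?_)) <;> refine lintegral_congr fun z => ?_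
  · by_cases hz : z ∈ W
    · rw [indicator_of_mem hz, indicator_of_mem (show (setValue v i j z, s) ∈ favoriteSet I i j
        from hz)]
      simp only [setValue_self]
    · rw [indicator_of_notMem hz, indicator_of_notMem
        (show (setValue v i j z, s) ∉ favoriteSet I i j from hz)]
  · by_cases hz : z ∈ W
    · rw [indicator_of_mem hz, indicator_of_mem (show (setValue v i j z, s) ∈ favoriteSet I i j
        from hz)]
      simp only [setValue_self]
    · rw [indicator_of_notMem hz, indicator_of_notMem
        (show (setValue v i j z, s) ∉ favoriteSet I i j from hz)]

/-- A payment is at most the value of the items that are not the favorite one, plus the part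
attributed to the favorite. -/
theorem ofReal_pB_le (hM : M.Admissible I) {v : BProfile n m} (hv : v ∈ I.TB) {s : SProfile m}
    (hs : s ∈ I.TS) (i : Fin n) : ENNReal.ofReal (M.pB v s i) ≤
      ∑ j, ((favoriteSet I i j).indicator (fun w => ENNReal.ofReal (w.1 i j * M.xB w.1 w.2 i j -
          M.utilityB i (w.1 i) w.1 w.2)) (v, s) +
        (favoriteSet I i j)ᶜ.indicator
          (fun w => ENNReal.ofReal (M.xB w.1 w.2 i j) * ENNReal.ofReal (w.1 i j)) (v, s)) := by
  classical
  set u := M.utilityB i (v i) v s with hu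
  have hu0 : 0 ≤ u := hM.ir.buyer v hv s hs i
  have hcount : (∑ j, if IsFavorite (virtualCosts I s) v i j then (1 : ℝ) else 0) ≤ 1 := by
    rw [sum_ite_of_unique fun _ _ hj hk => hj.unique hk]
    split_ifs <;> norm_num
  -- There is at most one favorite item, so the nonnegative utility is subtracted at most once.
  have hp : M.pB v s i ≤ ∑ j, (v i j * M.xB v s i j -
      (if IsFavorite (virtualCosts I s) v i j then 1 else 0) * u) := by
    rw [Finset.sum_sub_distrib, ← Finset.sum_mul]
    have h1 : u = ∑ j, v i j * M.xB v s i j - M.pB v s i := by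
      rw [hu]; unfold Mechanism.utilityB; simp_rw [mul_comm]
    nlinarith
  refine (ENNReal.ofReal_le_ofReal hp).trans ((Finset.le_sum_of_subadditive ENNReal.ofReal
    ENNReal.ofReal_zero.le
    (fun _ _ => ENNReal.ofReal_add_le) _ _).trans
    (Finset.sum_le_sum fun j _ => ?_))
  by_cases hj : IsFavorite (virtualCosts I s) v i j
  · rw [indicator_of_mem (show (v, s) ∈ favoriteSet I i j from hj)]
    refine le_trans (le_of_eq ?_) le_self_add
    simp [hj, hu]
  · rw [indicator_of_mem (show (v, s) ∈ (favoriteSet I i j)ᶜ from hj)]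
    refine le_trans (le_of_eq ?_) le_add_self
    rw [← ENNReal.ofReal_mul (hM.wellFormed.xB_mem v hv s hs i j).1]
    simp [hj, mul_comm]

end Payments

end

end Broker

namespace Broker
open Filter Topology

/-! ### The upper bound on the profit of a mechanism -/

section

variable {n m : ℕ} {I : Market n m} {c : Costs m} {v : BProfile n m} {i : Fin n} {j : Fin m}

-- The minimum of value and reserve is largest at a highest bidder. If she meets her reserve, the
-- minimum is the reserve; otherwise the cost exceeds all bids and the surplus is 0.
open Classical in
theorem secondSurplus_le_sum : secondSurplus c v j ≤
    ∑ i, if IsFirstMax (fun k => v k j) i ∧ reserve c v i j ≤ ENNReal.ofReal (v i j) then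
      reserve c v i j - c j else 0 := by
  refine iSup_le fun k => ?_
  obtain ⟨i, hi⟩ := exists_isFirstMax (fun k => v k j) k
  have hmin : min (ENNReal.ofReal (v k j)) (reserve c v k j) ≤
      min (ENNReal.ofReal (v i j)) (reserve c v i j) := by
    by_cases hki : k = i
    · rw [hki]
    · exact (min_le_left _ _).trans
        (le_min (ENNReal.ofReal_le_ofReal (hi.1 k)) (ofReal_le_reserve hki))
  refine (tsub_le_tsub_right hmin _).trans ?_
  by_cases hβ : reserve c v i j ≤ ENNReal.ofReal (v i j)
  · refine le_trans ?_ (Finset.single_le_sum (fun _ _ => bot_le) (Finset.mem_univ i))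
    rw [if_pos ⟨hi, hβ⟩, min_eq_right hβ]
  · refine (tsub_eq_zero_of_le ?_).le.trans bot_le
    refine (min_le_left _ _).trans ?_
    by_contra hcon
    refine hβ (max_le (iSup₂_le fun l _ => ENNReal.ofReal_le_ofReal (hi.1 l)) (not_le.1 hcon).le)

/-- Given the other bids, buyer `i` faces the posted price `β_ij` on an upward closed set of values,
so the price collects at most the larger of virtual value and cost; the cost is then subtracted on
both sides. -/
theorem lintegral_reserve_sub_cost_le (hmean : ∀ i j, Integrable (fun z : ℝ => z) (I.DB i j))
    (i : Fin n) (j : Fin m) {V : Set (BProfile n m × SProfile m)}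
    (hV : V = {w | IsFirstMax (fun k => w.1 k j) i ∧
      reserve (virtualCosts I w.2) w.1 i j ≤ ENNReal.ofReal (w.1 i j)}) (hVm : MeasurableSet V) :
    ∫⁻ w in V, (reserve (virtualCosts I w.2) w.1 i j - virtualCosts I w.2 j) ∂I.dist ≤
      ∫⁻ w in V, (posVirtual (I.DB i j) (w.1 i j) - virtualCosts I w.2 j) ∂I.dist := by
  have hβm : Measurable fun w : BProfile n m × SProfile m =>
      reserve (virtualCosts I w.2) w.1 i j := by
    have h := (measurable_reserve_apply i j).comp (measurable_costs_profile I)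
    exact h
  rw [← lintegral_indicator hVm, ← lintegral_indicator hVm]
  refine lintegral_dist_mono_value I ((hβm.sub (measurable_profile_cost I j)).indicator hVm)
    (((measurable_profile_posVirtual I i j).sub (measurable_profile_cost I j)).indicator hVm) i j ?_
  filter_upwards [ae_virtualCosts_ne_top I] with w hct
  obtain ⟨v, s⟩ := w
  have hsec := measurable_profile_setValue v s i j
  set c := virtualCosts I s with hc
  set W : Set ℝ := {z | (setValue v i j z, s) ∈ V} with hW
  have hWm : MeasurableSet W := hsec hVm
  have hβ : reserve c v i j ≠ ⊤ := reserve_ne_top (hct j)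
  have hmem : ∀ z, z ∈ W ↔ IsFirstMax (fun k => setValue v i j z k j) i ∧
      reserve c v i j ≤ ENNReal.ofReal z := by
    intro z
    rw [hW, hV]
    simp only [mem_ofPred_eq, reserve_setValue, setValue_self]
    rfl
  have hup : ∀ z ∈ W, ∀ z', z ≤ z' → z' ∈ W := by
    intro z hz z' h
    rw [hmem] at hz ⊢
    refine ⟨hz.1.update_mono ?_ fun k hk => ?_, hz.2.trans (ENNReal.ofReal_le_ofReal h)⟩
    · simpa only [setValue_self] using h
    · rw [setValue_of_ne _ _ _ _ hk, setValue_of_ne _ _ _ _ hk]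
  have hfun : ∀ (f : ℝ → ℝ≥0∞) (g : BProfile n m × SProfile m → ℝ≥0∞),
      (∀ z, g (setValue v i j z, s) = f z) →
      ∫⁻ z, V.indicator g (setValue v i j z, s) ∂(I.DB i j) = ∫⁻ z in W, f z ∂(I.DB i j) := by
    intro f g hfg
    rw [← lintegral_indicator hWm]
    refine lintegral_congr fun z => ?_
    by_cases hz : z ∈ W
    · rw [indicator_of_mem hz, indicator_of_mem (show (setValue v i j z, s) ∈ V from hz), hfg]
    · rw [indicator_of_notMem hz, indicator_of_notMem (show (setValue v i j z, s) ∉ V from hz)]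
  rw [hfun (fun _ => reserve c v i j - c j) _ fun z => by simp only [reserve_setValue, ← hc],
    hfun (fun z => posVirtual (I.DB i j) z - c j) _ fun z => by
      simp only [setValue_self, ← hc]]
  rw [setLIntegral_const]
  -- With a zero reserve the winning set may contain negative reals, since `ENNReal.ofReal` sends
  -- them to 0, but the left side vanishes.
  by_cases hβ0 : reserve c v i j = 0
  · simp [hβ0]
  have hWt : W ⊆ Ici (reserve c v i j).toReal := by
    intro z hz
    have h := ((hmem z).1 hz).2
    by_cases hz0 : 0 ≤ z
    · exact ENNReal.toReal_le_of_le_ofReal hz0 h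
    · rw [ENNReal.ofReal_of_nonpos (not_le.1 hz0).le] at h
      exact absurd (le_antisymm h bot_le) hβ0
  have key := mul_measure_le_setLIntegral_posVirtual (hmean i j) hWm hWt
    (Eventually.of_forall fun y hy a ha => by
      by_contra hlt
      exact hy (hup a ha y (not_le.1 hlt).le)) (hct j)
  rw [ENNReal.ofReal_toReal hβ, lintegral_add_right _ measurable_const, setLIntegral_const] at key
  refine (ENNReal.add_le_add_iff_right (ENNReal.mul_ne_top (hct j) (measure_ne_top _ W))).1
    (le_trans (le_of_eq ?_) key)
  rw [← add_mul, tsub_add_cancel_of_le cost_le_reserve]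

/-- A second-price auction collects at most the virtual surplus. -/
theorem lintegral_secondSurplus_le (hmean : ∀ i j, Integrable (fun z : ℝ => z) (I.DB i j))
    (j : Fin m) : ∫⁻ w, secondSurplus (virtualCosts I w.2) w.1 j ∂I.dist ≤
      ∫⁻ w, virtualSurplus I (virtualCosts I w.2) w.1 j ∂I.dist := by
  classical
  set V : Fin n → Set (BProfile n m × SProfile m) := fun i =>
    {w | IsFirstMax (fun k => w.1 k j) i ∧
      reserve (virtualCosts I w.2) w.1 i j ≤ ENNReal.ofReal (w.1 i j)} with hV
  have hβm : ∀ i, Measurable fun w : BProfile n m × SProfile m =>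
      reserve (virtualCosts I w.2) w.1 i j := by
    intro i
    have h := (measurable_reserve_apply i j).comp (measurable_costs_profile I)
    exact h
  have hVm : ∀ i, MeasurableSet (V i) := fun i =>
    (measurableSet_isFirstMax (fun k => measurable_profile_value k j) i).inter
      (measurableSet_le (hβm i) (measurable_profile_value i j).ennreal_ofReal)
  have hm1 : ∀ i, Measurable fun w => (V i).indicator (fun w =>
      reserve (virtualCosts I w.2) w.1 i j - virtualCosts I w.2 j) w := fun i =>
    ((hβm i).sub (measurable_profile_cost I j)).indicator (hVm i)
  have hm2 : ∀ i, Measurable fun w => (V i).indicator (fun w =>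
      posVirtual (I.DB i j) (w.1 i j) - virtualCosts I w.2 j) w := fun i =>
    ((measurable_profile_posVirtual I i j).sub (measurable_profile_cost I j)).indicator (hVm i)
  calc _ ≤ ∫⁻ w, ∑ i, (V i).indicator (fun w => reserve (virtualCosts I w.2) w.1 i j -
          virtualCosts I w.2 j) w ∂I.dist := by
        refine lintegral_mono fun w => secondSurplus_le_sum.trans (le_of_eq ?_)
        exact Finset.sum_congr rfl fun i _ => by simp only [indicator_apply, hV, mem_ofPred_eq]
    _ = ∑ i, ∫⁻ w in V i, (reserve (virtualCosts I w.2) w.1 i j -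
          virtualCosts I w.2 j) ∂I.dist := by
        rw [lintegral_finsetSum _ fun i _ => hm1 i]
        exact Finset.sum_congr rfl fun i _ => lintegral_indicator (hVm i) _
    _ ≤ ∑ i, ∫⁻ w in V i, (posVirtual (I.DB i j) (w.1 i j) - virtualCosts I w.2 j) ∂I.dist :=
        Finset.sum_le_sum fun i _ => lintegral_reserve_sub_cost_le hmean i j rfl (hVm i)
    _ = ∫⁻ w, ∑ i, (V i).indicator (fun w => posVirtual (I.DB i j) (w.1 i j) -
          virtualCosts I w.2 j) w ∂I.dist := by
        rw [lintegral_finsetSum _ fun i _ => hm2 i]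
        exact Finset.sum_congr rfl fun i _ => (lintegral_indicator (hVm i) _).symm
    _ ≤ _ := by
        refine lintegral_mono fun w => ?_
        by_cases h : ∃ i, w ∈ V i
        · obtain ⟨i, hi⟩ := h
          refine (Finset.sum_eq_single i (fun k _ hk => ?_) (by simp)).le.trans ?_
          · exact indicator_of_notMem (fun hk' => hk (hk'.1.unique hi.1)) _
          · rw [indicator_of_mem hi]
            exact posVirtual_le_add_virtualSurplus I
        · push Not at h
          rw [Finset.sum_eq_zero fun i _ => indicator_of_notMem (h i) _]
          exact bot_le

theorem measurable_profile_excess (i : Fin n) (j : Fin m) :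
    Measurable fun w : BProfile n m × SProfile m => excess (virtualCosts I w.2) w.1 i j := by
  have h := (measurable_excess i j).comp (measurable_costs_profile I)
  exact h

theorem measurable_profile_reserve (i : Fin n) (j : Fin m) :
    Measurable fun w : BProfile n m × SProfile m => reserve (virtualCosts I w.2) w.1 i j := by
  have h := (measurable_reserve_apply i j).comp (measurable_costs_profile I)
  exact h

theorem measurable_profile_entryFee (i : Fin n) :
    Measurable fun w : BProfile n m × SProfile m => entryFee I (virtualCosts I w.2) w.1 i := by
  have h := (measurable_entryFee I i).comp (measurable_costs_profile I)
  exact h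

/-- The profiles at which buyer `i` accepts her entry fee. -/
def acceptSet (I : Market n m) (i : Fin n) : Set (BProfile n m × SProfile m) :=
  {w | Accepts I (virtualCosts I w.2) w.1 i}

theorem measurableSet_acceptSet (i : Fin n) : MeasurableSet (acceptSet I i) :=
  measurable_costs_profile I (measurableSet_accepts I i)

/-- An entry fee is accepted at least half of the time. -/
theorem ofReal_entryFee_le (I : Market n m) (c : Costs m) (v : BProfile n m) (i : Fin n) :
    ENNReal.ofReal (entryFee I c v i) ≤ 2 * (ENNReal.ofReal (entryFee I c v i) *
      (Measure.pi fun j => I.DB i j) {t | Accepts I c (Function.update v i t) i}) := by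
  have h := half_le_measure_entryFee I c v i
  have heq : {t | Accepts I c (Function.update v i t) i} =
      {t | entryFee I c v i ≤ surplus (reserve c v i) t} := by
    ext t
    simp only [Accepts, entryFee_update, reserve_update, Function.update_self, mem_ofPred_eq]
  rw [heq]
  calc ENNReal.ofReal (entryFee I c v i)
      = 2 * (ENNReal.ofReal (entryFee I c v i) * (1 / 2)) := by
        rw [mul_left_comm, one_div, ENNReal.mul_inv_cancel two_ne_zero ENNReal.ofNat_ne_top,
          mul_one]
    _ ≤ _ := by gcongr

/-- The excess outside of the favorite item. -/
theorem lintegral_unfavored_excess_le (hmean : ∀ i j, Integrable (fun z : ℝ => z) (I.DB i j))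
    (i : Fin n) :
    ∫⁻ w, ∑ j, (favoriteSet I i j)ᶜ.indicator
        (fun w => excess (virtualCosts I w.2) w.1 i j) w ∂I.dist ≤
      ∫⁻ w, (3 * ∑ j, (posVirtual (I.DB i j) (w.1 i j) - reserve (virtualCosts I w.2) w.1 i j) +
        2 * (acceptSet I i).indicator
          (fun w => ENNReal.ofReal (entryFee I (virtualCosts I w.2) w.1 i)) w) ∂I.dist := by
  have hm1 : Measurable fun w : BProfile n m × SProfile m => ∑ j, (favoriteSet I i j)ᶜ.indicator
        (fun w => excess (virtualCosts I w.2) w.1 i j) w := Finset.measurable_sum _ fun j _ =>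
    (measurable_profile_excess i j).indicator (measurableSet_favoriteSet I i j).compl
  have hm3 : ∀ j, Measurable fun w : BProfile n m × SProfile m =>
      posVirtual (I.DB i j) (w.1 i j) - reserve (virtualCosts I w.2) w.1 i j := fun j =>
    (measurable_profile_posVirtual I i j).sub (measurable_profile_reserve i j)
  have hm4 := (measurable_profile_entryFee (I := I) i).ennreal_ofReal.indicator
    (measurableSet_acceptSet (I := I) i)
  refine lintegral_dist_mono_row I hm1 (((Finset.measurable_sum _ fun j _ =>
    hm3 j).const_mul _).add (hm4.const_mul _)) i ?_
  filter_upwards [ae_virtualCosts_ne_top I] with w hct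
  obtain ⟨v, s⟩ := w
  set c := virtualCosts I s with hc
  have hβ : ∀ j, reserve c v i j ≠ ⊤ := fun j => reserve_ne_top (hct j)
  have hupd : Measurable fun t : Fin m → ℝ => (Function.update v i t, s) :=
    (measurable_update v).prodMk measurable_const
  have hex : ∀ t j, excess c (Function.update v i t) i j =
      ENNReal.ofReal (t j) - reserve c v i j := by
    intro t j
    simp only [excess, reserve_update, Function.update_self]
  have hX : ∀ j, Measurable fun z : ℝ => ENNReal.ofReal z - reserve c v i j := fun j =>
    ENNReal.measurable_ofReal.sub measurable_const
  -- The level `r j` is the optimal posted-price profit at cost `β_ij`: having excess at least `x`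
  -- means accepting the price `x + β_ij`, whose profit is at most `r j`. The median in the
  -- conclusion is the entry fee by definition.
  have key := lintegral_sum_exceeded_le (μ := fun j => I.DB i j)
    (X := fun j z => ENNReal.ofReal z - reserve c v i j)
    (r := fun j => ∫⁻ z, (posVirtual (I.DB i j) z - reserve c v i j) ∂(I.DB i j)) hX
    (fun j z => (tsub_le_self.trans_lt ENNReal.ofReal_lt_top).ne)
    (fun j x hx => by
      by_cases hx0 : x = 0
      · simp [hx0]
      have hset : {z : ℝ | x ≤ ENNReal.ofReal z - reserve c v i j} ⊆
          Ici (x + reserve c v i j).toReal := by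
        intro z (hz : x ≤ ENNReal.ofReal z - reserve c v i j)
        have hpos : 0 < ENNReal.ofReal z - reserve c v i j := (pos_iff_ne_zero.2 hx0).trans_le hz
        refine ENNReal.toReal_le_of_le_ofReal
          (ENNReal.ofReal_pos.1 (hpos.trans_le tsub_le_self)).le ?_
        exact (ENNReal.le_sub_iff_add_le_right (hβ j) (tsub_pos_iff_lt.1 hpos).le).1 hz
      have := ofReal_sub_mul_measure_Ici_le (hmean i j) (hβ j) (x + reserve c v i j).toReal
      rw [ENNReal.ofReal_toReal (ENNReal.add_ne_top.2 ⟨hx, hβ j⟩),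
        ENNReal.add_sub_cancel_right (hβ j)] at this
      exact le_trans (by gcongr) this)
    (fun j => {t | ¬ IsFavorite c (Function.update v i t) i j})
    (fun j => hupd (measurableSet_favoriteSet I i j).compl)
    (fun j t ht hpos => by
      have := exists_excess_le_of_not_isFavorite ht (by rw [hex]; exact hpos)
      simpa only [hex] using this)
  refine le_trans (le_of_eq ?_) (key.trans ?_)
  · refine lintegral_congr fun t => Finset.sum_congr rfl fun j _ => ?_
    by_cases h : IsFavorite c (Function.update v i t) i j
    · rw [indicator_of_notMem (show t ∉ {t | ¬ IsFavorite c (Function.update v i t) i j} from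
        not_not_intro h), indicator_of_notMem (show (Function.update v i t, s) ∉
        (favoriteSet I i j)ᶜ from not_not_intro h)]
    · rw [indicator_of_mem (show t ∈ {t | ¬ IsFavorite c (Function.update v i t) i j} from h),
        indicator_of_mem (show (Function.update v i t, s) ∈ (favoriteSet I i j)ᶜ from h)]
      exact hex t j
  · have hA : MeasurableSet {t : Fin m → ℝ | Accepts I c (Function.update v i t) i} :=
      hupd (measurableSet_acceptSet i)
    have hm5 : ∀ j, Measurable fun t : Fin m → ℝ =>
        posVirtual (I.DB i j) (t j) - reserve c v i j := fun j =>
      ((measurable_posVirtual _).comp (measurable_pi_apply j)).sub measurable_const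
    have hm6 : Measurable fun t : Fin m → ℝ =>
        3 * ∑ j, (posVirtual (I.DB i j) (t j) - reserve c v i j) :=
      (Finset.measurable_sum _ fun j _ => hm5 j).const_mul 3
    have hg : ∀ t, (3 * ∑ j, (posVirtual (I.DB i j) (Function.update v i t i j) -
          reserve c (Function.update v i t) i j) + 2 * (acceptSet I i).indicator
            (fun w => ENNReal.ofReal (entryFee I (virtualCosts I w.2) w.1 i))
            (Function.update v i t, s)) =
        3 * ∑ j, (posVirtual (I.DB i j) (t j) - reserve c v i j) +
          2 * {t | Accepts I c (Function.update v i t) i}.indicator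
            (fun _ => ENNReal.ofReal (entryFee I c v i)) t := by
      intro t
      congr 1
      · simp only [Function.update_self, reserve_update]
      · congr 1
        by_cases h : Accepts I c (Function.update v i t) i
        · rw [indicator_of_mem (show t ∈ {t | Accepts I c (Function.update v i t) i} from h),
            indicator_of_mem (show (Function.update v i t, s) ∈ acceptSet I i from h)]
          simp only [← hc, entryFee_update]
        · rw [indicator_of_notMem (show t ∉ {t | Accepts I c (Function.update v i t) i} from h),
            indicator_of_notMem (show (Function.update v i t, s) ∉ acceptSet I i from h)]
    refine le_of_le_of_eq ?_ (lintegral_congr hg).symm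
    rw [lintegral_add_left hm6,
      lintegral_const_mul _ (Finset.measurable_sum _ fun j _ => hm5 j),
      lintegral_const_mul _ (measurable_const.indicator hA),
      lintegral_finsetSum _ fun j _ => hm5 j, lintegral_indicator_const hA]
    refine add_le_add (le_of_eq ?_) (ofReal_entryFee_le I c v i)
    congr 1
    refine Finset.sum_congr rfl fun j _ => ?_
    exact ((measurePreserving_eval (fun j => I.DB i j) j).lintegral_comp
      ((measurable_posVirtual _).sub measurable_const)).symm

/-- A seller's expected payment is at least her expected virtual cost. -/
theorem lintegral_cost_mul_xS_le {M : Mechanism n m} (hM : M.Admissible I) (j : Fin m) :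
    ∫⁻ w, virtualCosts I w.2 j * ENNReal.ofReal (M.xS w.1 w.2 j) ∂I.dist ≤
      ∫⁻ w, ENNReal.ofReal (M.pS w.1 w.2 j) ∂I.dist := by
  refine lintegral_dist_mono_seller I ((measurable_profile_cost I j).mul
    (hM.wellFormed.meas_xS j).ennreal_ofReal) (hM.wellFormed.meas_pS j).ennreal_ofReal j ?_
  filter_upwards [ae_mem_TB_TS I] with w hw
  obtain ⟨v, s⟩ := w
  obtain ⟨hv, hs⟩ := hw
  have hupd : Measurable fun z : ℝ => (v, Function.update s j z) :=
    measurable_const.prodMk (measurable_update s)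
  have hxm : Measurable fun z : ℝ => M.xS v (Function.update s j z) j := by
    have h := (hM.wellFormed.meas_xS j).comp hupd
    exact h
  have key := lintegral_sellerVirtual_mul_le (I.nonnegS j)
    (x := fun z => M.xS v (Function.update s j z) j)
    (p := fun z => M.pS v (Function.update s j z) j) hxm
    (fun z hz => (hM.wellFormed.xS_mem v hv _ (update_mem_TS hs hz) j).1)
    (fun z hz z' hz' => by
      have h := hM.dsic.seller v hv _ (update_mem_TS hs hz) j z' hz'
      simp only [Function.update_idem, Function.update_self, Mechanism.utilityS] at h
      exact h)
    (fun z hz => by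
      have h := hM.ir.seller v hv _ (update_mem_TS hs hz) j
      simp only [Function.update_self, Mechanism.utilityS] at h
      exact h)
  simp only [virtualCosts_update_self]
  exact key

/-- The revenue attributed to one item. -/
theorem sum_item_revenue_le {M : Mechanism n m} (hM : M.Admissible I) {v : BProfile n m}
    (hv : v ∈ I.TB) {s : SProfile m} (hs : s ∈ I.TS) (j : Fin m) :
    ∑ i, ((favoriteSet I i j).indicator (fun w => ((posVirtual (I.DB i j) (w.1 i j) -
          virtualCosts I w.2 j) + virtualCosts I w.2 j) * ENNReal.ofReal (M.xB w.1 w.2 i j)) (v, s) +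
        (favoriteSet I i j)ᶜ.indicator
          (fun w => ENNReal.ofReal (M.xB w.1 w.2 i j) * ENNReal.ofReal (w.1 i j)) (v, s)) ≤
      virtualCosts I s j * ENNReal.ofReal (M.xS v s j) +
        virtualSurplus I (virtualCosts I s) v j + secondSurplus (virtualCosts I s) v j +
        ∑ i, (favoriteSet I i j)ᶜ.indicator
          (fun w => excess (virtualCosts I w.2) w.1 i j) (v, s) := by
  set c := virtualCosts I s with hc
  set Φ := virtualSurplus I c v j with hΦ
  set Δ := secondSurplus c v j with hΔ
  have hx0 : ∀ i, 0 ≤ M.xB v s i j := fun i => (hM.wellFormed.xB_mem v hv s hs i j).1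
  have hsum : ∑ i, ENNReal.ofReal (M.xB v s i j) ≤ ENNReal.ofReal (M.xS v s j) := by
    rw [← ENNReal.ofReal_sum_of_nonneg fun i _ => hx0 i]
    exact ENNReal.ofReal_le_ofReal (hM.feasible v hv s hs j)
  have hS1 : ENNReal.ofReal (M.xS v s j) ≤ 1 :=
    ENNReal.ofReal_le_one.2 (hM.wellFormed.xS_mem v hv s hs j).2
  -- Every buyer's share is raised to the common factor `c j + Φ + Δ`, so that the sum over buyers
  -- uses only that the allocation of `j` is at most `xS ≤ 1`.
  have hterm : ∀ i, (favoriteSet I i j).indicator (fun w => ((posVirtual (I.DB i j) (w.1 i j) -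
          virtualCosts I w.2 j) + virtualCosts I w.2 j) * ENNReal.ofReal (M.xB w.1 w.2 i j)) (v, s) +
        (favoriteSet I i j)ᶜ.indicator
          (fun w => ENNReal.ofReal (M.xB w.1 w.2 i j) * ENNReal.ofReal (w.1 i j)) (v, s) ≤
      (c j + (Φ + Δ)) * ENNReal.ofReal (M.xB v s i j) + (favoriteSet I i j)ᶜ.indicator
          (fun w => excess (virtualCosts I w.2) w.1 i j) (v, s) := by
    intro i
    by_cases h : (v, s) ∈ favoriteSet I i j
    · rw [indicator_of_mem h, indicator_of_notMem (not_not_intro h),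
        indicator_of_notMem (not_not_intro h), add_zero, add_zero]
      simp only [← hc]
      gcongr ?_ * _
      rw [add_comm]
      gcongr
      exact (posVirtual_le_add_virtualSurplus I).trans le_self_add
    · rw [indicator_of_notMem h, indicator_of_mem (show (v, s) ∈ (favoriteSet I i j)ᶜ from h),
        indicator_of_mem (show (v, s) ∈ (favoriteSet I i j)ᶜ from h), zero_add]
      simp only [← hc]
      have hx1 : ENNReal.ofReal (M.xB v s i j) ≤ 1 :=
        ENNReal.ofReal_le_one.2 (hM.wellFormed.xB_mem v hv s hs i j).2
      calc _ ≤ ENNReal.ofReal (M.xB v s i j) * (c j + Δ + excess c v i j) := by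
            gcongr
            exact ofReal_value_le
        _ = (c j + Δ) * ENNReal.ofReal (M.xB v s i j) +
            ENNReal.ofReal (M.xB v s i j) * excess c v i j := by ring
        _ ≤ _ := by
            gcongr
            · exact le_add_self
            · exact mul_le_of_le_one_left bot_le hx1
  refine (Finset.sum_le_sum fun i _ => hterm i).trans ?_
  rw [Finset.sum_add_distrib, ← Finset.mul_sum]
  gcongr
  calc _ ≤ (c j + (Φ + Δ)) * ENNReal.ofReal (M.xS v s j) := by gcongr
    _ = c j * ENNReal.ofReal (M.xS v s j) + (Φ + Δ) * ENNReal.ofReal (M.xS v s j) := by ring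
    _ ≤ c j * ENNReal.ofReal (M.xS v s j) + (Φ + Δ) := by
        gcongr
        exact mul_le_of_le_one_right bot_le hS1
    _ = _ := by ring

theorem measurable_profile_virtualSurplus (j : Fin m) : Measurable fun
    w : BProfile n m × SProfile m => virtualSurplus I (virtualCosts I w.2) w.1 j := by
  have h := (measurable_virtualSurplus I j).comp (measurable_costs_profile I)
  exact h

theorem measurable_profile_secondSurplus (j : Fin m) : Measurable fun
    w : BProfile n m × SProfile m => secondSurplus (virtualCosts I w.2) w.1 j := by
  have h := (measurable_secondSurplus j).comp (measurable_costs_profile I)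
  exact h

/-- The expected revenue of a mechanism, bounded by its expected payments to the sellers, the
virtual surplus, and the entry fees. -/
theorem lintegral_sum_pB_le {M : Mechanism n m} (hM : M.Admissible I)
    (hmean : ∀ i j, Integrable (fun z : ℝ => z) (I.DB i j)) :
    ∑ i, ∫⁻ w, ENNReal.ofReal (M.pB w.1 w.2 i) ∂I.dist ≤
      ∑ j, ∫⁻ w, ENNReal.ofReal (M.pS w.1 w.2 j) ∂I.dist +
      5 * ∑ j, ∫⁻ w, virtualSurplus I (virtualCosts I w.2) w.1 j ∂I.dist +
      2 * ∑ i, ∫⁻ w in acceptSet I i,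
        ENNReal.ofReal (entryFee I (virtualCosts I w.2) w.1 i) ∂I.dist := by
  have hF : ∀ i j, MeasurableSet (favoriteSet I i j) := measurableSet_favoriteSet I
  have hxm : ∀ i j, Measurable fun w : BProfile n m × SProfile m =>
      ENNReal.ofReal (M.xB w.1 w.2 i j) := fun i j => (hM.wellFormed.meas_xB i j).ennreal_ofReal
  have hπ : ∀ i j, Measurable fun w => (favoriteSet I i j).indicator (fun w =>
      ENNReal.ofReal (w.1 i j * M.xB w.1 w.2 i j - M.utilityB i (w.1 i) w.1 w.2)) w := fun i j =>
    (((measurable_profile_value i j).mul (hM.wellFormed.meas_xB i j)).sub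
      (measurable_utilityB hM i)).ennreal_ofReal.indicator (hF i j)
  have hA : ∀ i j, Measurable fun w => (favoriteSet I i j).indicator (fun w =>
      ((posVirtual (I.DB i j) (w.1 i j) - virtualCosts I w.2 j) + virtualCosts I w.2 j) *
        ENNReal.ofReal (M.xB w.1 w.2 i j)) w := fun i j =>
    ((((measurable_profile_posVirtual I i j).sub (measurable_profile_cost I j)).add
      (measurable_profile_cost I j)).mul (hxm i j)).indicator (hF i j)
  have hB : ∀ i j, Measurable fun w => (favoriteSet I i j)ᶜ.indicator (fun w =>
      ENNReal.ofReal (M.xB w.1 w.2 i j) * ENNReal.ofReal (w.1 i j)) w := fun i j =>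
    ((hxm i j).mul (measurable_profile_value i j).ennreal_ofReal).indicator (hF i j).compl
  have hE : ∀ i j, Measurable fun w => (favoriteSet I i j)ᶜ.indicator (fun w =>
      excess (virtualCosts I w.2) w.1 i j) w := fun i j =>
    (measurable_profile_excess i j).indicator (hF i j).compl
  have hcx : ∀ j, Measurable fun w : BProfile n m × SProfile m =>
      virtualCosts I w.2 j * ENNReal.ofReal (M.xS w.1 w.2 j) := fun j =>
    (measurable_profile_cost I j).mul (hM.wellFormed.meas_xS j).ennreal_ofReal
  have hΦ := measurable_profile_virtualSurplus (I := I)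
  have hΔ := measurable_profile_secondSurplus (I := I)
  have hψβ : ∀ i j, Measurable fun w : BProfile n m × SProfile m =>
      posVirtual (I.DB i j) (w.1 i j) - reserve (virtualCosts I w.2) w.1 i j := fun i j =>
    (measurable_profile_posVirtual I i j).sub (measurable_profile_reserve i j)
  have hbuyer : ∀ i, ∫⁻ w, ENNReal.ofReal (M.pB w.1 w.2 i) ∂I.dist ≤
      ∑ j, ∫⁻ w, ((favoriteSet I i j).indicator (fun w => ((posVirtual (I.DB i j) (w.1 i j) -
          virtualCosts I w.2 j) + virtualCosts I w.2 j) * ENNReal.ofReal (M.xB w.1 w.2 i j)) w +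
        (favoriteSet I i j)ᶜ.indicator (fun w =>
          ENNReal.ofReal (M.xB w.1 w.2 i j) * ENNReal.ofReal (w.1 i j)) w) ∂I.dist := by
    intro i
    have h1 : ∀ᵐ w ∂I.dist, ENNReal.ofReal (M.pB w.1 w.2 i) ≤
        ∑ j, ((favoriteSet I i j).indicator (fun w => ENNReal.ofReal (w.1 i j * M.xB w.1 w.2 i j -
          M.utilityB i (w.1 i) w.1 w.2)) w + (favoriteSet I i j)ᶜ.indicator
          (fun w => ENNReal.ofReal (M.xB w.1 w.2 i j) * ENNReal.ofReal (w.1 i j)) w) := by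
      filter_upwards [ae_mem_TB_TS I] with w hw
      exact ofReal_pB_le hM hw.1 hw.2 i
    refine (lintegral_mono_ae h1).trans ?_
    rw [lintegral_finsetSum _ fun j _ => (hπ i j).fun_add (hB i j)]
    refine Finset.sum_le_sum fun j _ => ?_
    rw [lintegral_add_left (hπ i j), lintegral_add_left (hA i j)]
    refine add_le_add ?_ le_rfl
    rw [lintegral_indicator (hF i j), lintegral_indicator (hF i j)]
    exact setLIntegral_favorite_payment_le hM hmean i j
  -- The cost term is absorbed by the payment to the seller, and the factor 2 counts the virtual
  -- surplus and the second-price surplus it dominates.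
  have hitem : ∀ j, ∑ i, ∫⁻ w, ((favoriteSet I i j).indicator (fun w =>
          ((posVirtual (I.DB i j) (w.1 i j) - virtualCosts I w.2 j) + virtualCosts I w.2 j) *
            ENNReal.ofReal (M.xB w.1 w.2 i j)) w +
        (favoriteSet I i j)ᶜ.indicator (fun w =>
          ENNReal.ofReal (M.xB w.1 w.2 i j) * ENNReal.ofReal (w.1 i j)) w) ∂I.dist ≤
      ∫⁻ w, ENNReal.ofReal (M.pS w.1 w.2 j) ∂I.dist +
        2 * ∫⁻ w, virtualSurplus I (virtualCosts I w.2) w.1 j ∂I.dist +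
        ∑ i, ∫⁻ w, (favoriteSet I i j)ᶜ.indicator (fun w =>
          excess (virtualCosts I w.2) w.1 i j) w ∂I.dist := by
    intro j
    rw [← lintegral_finsetSum _ fun i _ => (hA i j).fun_add (hB i j)]
    have h1 : ∀ᵐ w ∂I.dist, ∑ i, ((favoriteSet I i j).indicator (fun w =>
          ((posVirtual (I.DB i j) (w.1 i j) - virtualCosts I w.2 j) + virtualCosts I w.2 j) *
            ENNReal.ofReal (M.xB w.1 w.2 i j)) w +
        (favoriteSet I i j)ᶜ.indicator (fun w =>
          ENNReal.ofReal (M.xB w.1 w.2 i j) * ENNReal.ofReal (w.1 i j)) w) ≤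
        virtualCosts I w.2 j * ENNReal.ofReal (M.xS w.1 w.2 j) +
        virtualSurplus I (virtualCosts I w.2) w.1 j + secondSurplus (virtualCosts I w.2) w.1 j +
        ∑ i, (favoriteSet I i j)ᶜ.indicator
          (fun w => excess (virtualCosts I w.2) w.1 i j) w := by
      filter_upwards [ae_mem_TB_TS I] with w hw
      exact sum_item_revenue_le hM hw.1 hw.2 j
    refine (lintegral_mono_ae h1).trans ?_
    rw [lintegral_add_left (((hcx j).fun_add (hΦ j)).fun_add (hΔ j)),
      lintegral_add_left ((hcx j).fun_add (hΦ j)), lintegral_add_left (hcx j),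
      lintegral_finsetSum _ fun i _ => hE i j, two_mul, ← add_assoc]
    exact add_le_add_left (add_le_add (add_le_add_left (lintegral_cost_mul_xS_le hM j) _)
      (lintegral_secondSurplus_le hmean j)) _
  -- After exchanging the sums over buyers and items, at each profile the terms of all buyers for
  -- one item are together at most its virtual surplus, so no factor `n` appears.
  have hexc : ∑ i, ∑ j, ∫⁻ w, (favoriteSet I i j)ᶜ.indicator (fun w =>
          excess (virtualCosts I w.2) w.1 i j) w ∂I.dist ≤
      3 * ∑ j, ∫⁻ w, virtualSurplus I (virtualCosts I w.2) w.1 j ∂I.dist +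
      2 * ∑ i, ∫⁻ w in acceptSet I i,
        ENNReal.ofReal (entryFee I (virtualCosts I w.2) w.1 i) ∂I.dist := by
    calc _ ≤ ∑ i, (3 * ∑ j, ∫⁻ w, (posVirtual (I.DB i j) (w.1 i j) -
            reserve (virtualCosts I w.2) w.1 i j) ∂I.dist + 2 * ∫⁻ w in acceptSet I i,
            ENNReal.ofReal (entryFee I (virtualCosts I w.2) w.1 i) ∂I.dist) := by
          refine Finset.sum_le_sum fun i _ => ?_
          have h := lintegral_unfavored_excess_le hmean i
          have hacc := (measurable_profile_entryFee (I := I) i).ennreal_ofReal.indicator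
            (measurableSet_acceptSet (I := I) i)
          rw [lintegral_finsetSum _ fun j _ => hE i j,
            lintegral_add_left ((Finset.measurable_sum _ fun j _ => hψβ i j).const_mul 3),
            lintegral_const_mul _ (Finset.measurable_sum _ fun j _ => hψβ i j),
            lintegral_const_mul _ hacc, lintegral_finsetSum _ fun j _ => hψβ i j,
            lintegral_indicator (measurableSet_acceptSet i)] at h
          exact h
      _ = 3 * ∑ j, ∫⁻ w, ∑ i, (posVirtual (I.DB i j) (w.1 i j) -
            reserve (virtualCosts I w.2) w.1 i j) ∂I.dist + 2 * ∑ i, ∫⁻ w in acceptSet I i,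
            ENNReal.ofReal (entryFee I (virtualCosts I w.2) w.1 i) ∂I.dist := by
          rw [Finset.sum_add_distrib, ← Finset.mul_sum, ← Finset.mul_sum, Finset.sum_comm]
          congr 2
          exact Finset.sum_congr rfl fun j _ => (lintegral_finsetSum _ fun i _ => hψβ i j).symm
      _ ≤ _ := by
          gcongr with j _ w
          exact sum_posVirtual_sub_reserve_le I
  calc _ ≤ ∑ i, ∑ j, ∫⁻ w, ((favoriteSet I i j).indicator (fun w =>
          ((posVirtual (I.DB i j) (w.1 i j) - virtualCosts I w.2 j) + virtualCosts I w.2 j) *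
            ENNReal.ofReal (M.xB w.1 w.2 i j)) w +
        (favoriteSet I i j)ᶜ.indicator (fun w =>
          ENNReal.ofReal (M.xB w.1 w.2 i j) * ENNReal.ofReal (w.1 i j)) w) ∂I.dist :=
        Finset.sum_le_sum fun i _ => hbuyer i
    _ ≤ ∑ j, (∫⁻ w, ENNReal.ofReal (M.pS w.1 w.2 j) ∂I.dist +
        2 * ∫⁻ w, virtualSurplus I (virtualCosts I w.2) w.1 j ∂I.dist +
        ∑ i, ∫⁻ w, (favoriteSet I i j)ᶜ.indicator (fun w =>
          excess (virtualCosts I w.2) w.1 i j) w ∂I.dist) := by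
        rw [Finset.sum_comm]
        exact Finset.sum_le_sum fun j _ => hitem j
    _ = ∑ j, ∫⁻ w, ENNReal.ofReal (M.pS w.1 w.2 j) ∂I.dist +
        2 * ∑ j, ∫⁻ w, virtualSurplus I (virtualCosts I w.2) w.1 j ∂I.dist +
        ∑ i, ∑ j, ∫⁻ w, (favoriteSet I i j)ᶜ.indicator (fun w =>
          excess (virtualCosts I w.2) w.1 i j) w ∂I.dist := by
        rw [Finset.sum_add_distrib, Finset.sum_add_distrib, ← Finset.mul_sum]
        congr 1
        exact Finset.sum_comm
    _ ≤ _ := (add_le_add_right hexc _).trans (le_of_eq (by ring))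

end

end Broker

namespace Broker
open Filter Topology

/-! ### The lower bound on the profit of the mixed mechanism -/

section

variable {n m : ℕ} {I : Market n m} {c : Costs m} {v : BProfile n m} {i : Fin n} {j : Fin m}

/-- Threshold payments cost at most the virtual costs of the items sold. -/
theorem lintegral_reduction_pS_le (I : Market n m) (j : Fin m) :
    ∫⁻ w, ENNReal.ofReal ((reduction I (MA I)).pS w.1 w.2 j) ∂I.dist ≤
      ∫⁻ w, virtualCosts I w.2 j *
        ENNReal.ofReal ((MA I).sold (virtualCosts I w.2) w.1 j) ∂I.dist := by
  refine lintegral_dist_mono_seller I (measurable_reduction_pS I j).ennreal_ofReal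
    ((measurable_profile_cost I j).mul (measurable_reduction_xS I j).ennreal_ofReal) j
    (Eventually.of_forall fun w => ?_)
  obtain ⟨v, s⟩ := w
  have hupd : Measurable fun z : ℝ => (v, Function.update s j z) :=
    measurable_const.prodMk (measurable_update s)
  have hxm : Measurable fun z : ℝ => (MA I).sold (virtualCosts I (Function.update s j z)) v j := by
    have h := (measurable_reduction_xS I j).comp hupd
    exact h
  have key := lintegral_threshold_payment_le (I.nonnegS j)
    (x := fun z => (MA I).sold (virtualCosts I (Function.update s j z)) v j) hxm
    (fun z => sold_MA_mem.1) (fun y z h => sold_update_anti v s j h)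
    -- An item of infinite virtual cost is never sold, since some finite value would have to cover
    -- it.
    (fun z hz => by
      by_contra hpos
      obtain ⟨i, hi⟩ := exists_cost_le_of_sold_MA_pos (not_le.1 hpos)
      rw [virtualCosts_update_self, hz] at hi
      exact ENNReal.ofReal_ne_top (top_le_iff.1 hi))
  simp only [virtualCosts_update_self]
  refine le_of_eq_of_le (lintegral_congr fun z => ?_) key
  rw [reduction_pS]
  simp only [Function.update_idem]
  rfl

/-- The profiles at which buyer `i` wins item `j` in the item-wise mechanism. -/
def itemwiseSet (I : Market n m) (i : Fin n) (j : Fin m) : Set (BProfile n m × SProfile m) :=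
  {w | ITWins I (virtualCosts I w.2) w.1 i j}

theorem measurableSet_itemwiseSet (i : Fin n) (j : Fin m) : MeasurableSet (itemwiseSet I i j) :=
  measurable_costs_profile I (measurableSet_ITWins I i j)

theorem ITWins_setValue_of_le {y z : ℝ} (hz : ITWins I c (setValue v i j z) i j)
    (h : buyerVirtual (I.DB i j) z ≤ buyerVirtual (I.DB i j) y) :
    ITWins I c (setValue v i j y) i j := by
  have hmono : buyerVirtual (I.DB i j) (setValue v i j z i j) ≤
      buyerVirtual (I.DB i j) (setValue v i j y i j) := by
    rw [setValue_self, setValue_self]; exact h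
  refine ⟨hz.1.update_mono hmono fun k hk => ?_, hz.2.trans hmono⟩
  rw [setValue_of_ne _ _ _ _ hk, setValue_of_ne _ _ _ _ hk]

/-- The threshold prices of the item-wise mechanism collect the virtual values. -/
theorem setLIntegral_posVirtual_le_price (hmean : ∀ i j, Integrable (fun z : ℝ => z) (I.DB i j))
    (i : Fin n) (j : Fin m) :
    ∫⁻ w in itemwiseSet I i j, posVirtual (I.DB i j) (w.1 i j) ∂I.dist ≤
      ∫⁻ w in itemwiseSet I i j,
        ENNReal.ofReal (ITPrice I (virtualCosts I w.2) w.1 i j) ∂I.dist := by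
  have hS := measurableSet_itemwiseSet (I := I) i j
  have hPm : Measurable fun w : BProfile n m × SProfile m =>
      ITPrice I (virtualCosts I w.2) w.1 i j := by
    have h := (measurable_ITPrice I i j).comp (measurable_costs_profile I)
    exact h
  rw [← lintegral_indicator hS, ← lintegral_indicator hS]
  refine lintegral_dist_mono_value I ((measurable_profile_posVirtual I i j).indicator hS)
    (hPm.ennreal_ofReal.indicator hS) i j (Eventually.of_forall fun w => ?_)
  obtain ⟨v, s⟩ := w
  set c := virtualCosts I s with hc
  set W : Set ℝ := {z | ITWins I c (setValue v i j z) i j} with hW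
  have hWm : MeasurableSet W := measurable_profile_setValue v s i j hS
  have hfun : ∀ (f : ℝ → ℝ≥0∞) (g : BProfile n m × SProfile m → ℝ≥0∞),
      (∀ z, g (setValue v i j z, s) = f z) →
      ∫⁻ z, (itemwiseSet I i j).indicator g (setValue v i j z, s) ∂(I.DB i j) =
        ∫⁻ z in W, f z ∂(I.DB i j) := by
    intro f g hfg
    rw [← lintegral_indicator hWm]
    refine lintegral_congr fun z => ?_
    by_cases hz : z ∈ W
    · rw [indicator_of_mem hz, indicator_of_mem
        (show (setValue v i j z, s) ∈ itemwiseSet I i j from hz), hfg]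
    · rw [indicator_of_notMem hz, indicator_of_notMem
        (show (setValue v i j z, s) ∉ itemwiseSet I i j from hz)]
  rw [hfun (fun z => posVirtual (I.DB i j) z) _ fun z => by simp only [setValue_self],
    hfun (fun _ => ENNReal.ofReal (ITPrice I c v i j)) _ fun z => by
      simp only [← hc]
      rw [ITPrice_congr (v := setValue v i j z) (v' := v) fun k hk => setValue_of_ne _ _ _ _ hk],
    setLIntegral_const]
  -- If no value in the support wins, the winning set is null.
  by_cases hne : ((I.DB i j).support ∩ W).Nonempty
  swap
  · rw [← setLIntegral_inter_support, not_nonempty_iff_eq_empty.1 hne]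
    simp
  have hglb : IsGLB ((I.DB i j).support ∩ W) (ITPrice I c v i j) :=
    isGLB_csInf hne ⟨0, fun y hy => nonneg_of_mem_support (I.nonnegB i j) hy.1⟩
  -- The infimum defining the price need not be a winning value. Winning values `u k` converging to
  -- it each collect the virtual values, and the inequality passes to the limit.
  obtain ⟨u, -, -, hu, hmem⟩ := hglb.exists_seq_antitone_tendsto hne
  refine ge_of_tendsto' (ENNReal.Tendsto.mul_const
    ((ENNReal.continuous_ofReal.tendsto _).comp hu) (Or.inr (measure_ne_top _ _))) fun k => ?_
  have hk : ITWins I c (setValue v i j (u k)) i j := (hmem k).2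
  refine setLIntegral_posVirtual_le (hmean i j) hWm ?_ (Eventually.of_forall fun y hy =>
    ITWins_setValue_of_le hk hy)
  have := hk.2
  rw [setValue_self] at this
  exact (EReal.coe_ennreal_nonneg _).trans this

open Classical in
/-- The virtual surplus is what the winner's virtual value leaves after the cost. -/
theorem virtualSurplus_add_le_sum : virtualSurplus I c v j +
    c j * ENNReal.ofReal ((MIT I).sold c v j) ≤
      ∑ i, if ITWins I c v i j then posVirtual (I.DB i j) (v i j) else 0 := by
  rw [sold_MIT]
  by_cases h : ∃ i, ITWins I c v i j
  · rw [if_pos h, ENNReal.ofReal_one, mul_one]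
    obtain ⟨i, hi⟩ := h
    refine le_trans ?_ (Finset.single_le_sum (fun _ _ => bot_le) (Finset.mem_univ i))
    rw [if_pos hi]
    have hci : c j ≤ posVirtual (I.DB i j) (v i j) := by
      simpa [posVirtual] using EReal.toENNReal_le_toENNReal hi.2
    have hK : virtualSurplus I c v j ≤ posVirtual (I.DB i j) (v i j) - c j :=
      iSup_le fun k => tsub_le_tsub_right (EReal.toENNReal_le_toENNReal (hi.1.1 k)) _
    calc _ ≤ posVirtual (I.DB i j) (v i j) - c j + c j := by gcongr
      _ = _ := tsub_add_cancel_of_le hci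
  · rw [if_neg h, ENNReal.ofReal_zero, mul_zero, add_zero]
    refine iSup_le fun k => le_of_eq_of_le (tsub_eq_zero_of_le ?_) bot_le
    -- A virtual value above the cost would make the first bidder of largest virtual value a winner,
    -- so an unsold item has zero virtual surplus.
    obtain ⟨i, hi⟩ := exists_isFirstMax (fun k => buyerVirtual (I.DB k j) (v k j)) k
    by_contra hcon
    have hlt : c j < posVirtual (I.DB i j) (v i j) :=
      (not_le.1 hcon).trans_le (EReal.toENNReal_le_toENNReal (hi.1 k))
    refine h ⟨i, hi, ?_⟩
    rw [← coe_posVirtual (EReal.toENNReal_pos_iff.1 (bot_le.trans_lt hlt)).le]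
    exact EReal.coe_ennreal_le_coe_ennreal_iff.2 hlt.le

open Classical in
theorem ofReal_p_MIT (I : Market n m) (c : Costs m) (v : BProfile n m) (i : Fin n) :
    ENNReal.ofReal ((MIT I).p c v i) =
      ∑ j, if ITWins I c v i j then ENNReal.ofReal (ITPrice I c v i j) else 0 := by
  unfold MIT
  dsimp only
  rw [ENNReal.ofReal_sum_of_nonneg fun j _ => by split_ifs; exacts [ITPrice_nonneg, le_rfl]]
  refine Finset.sum_congr rfl fun j _ => ?_
  split_ifs <;> simp

theorem measurable_profile_MIT_sold (j : Fin m) : Measurable fun w : BProfile n m × SProfile m =>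
    (MIT I).sold (virtualCosts I w.2) w.1 j := by
  have h := (measurable_MIT_sold I j).comp (measurable_costs_profile I)
  exact h

theorem measurable_profile_MBVCG_sold (j : Fin m) : Measurable fun
    w : BProfile n m × SProfile m => (MBVCG I).sold (virtualCosts I w.2) w.1 j := by
  have h := (measurable_MBVCG_sold I j).comp (measurable_costs_profile I)
  exact h

/-- The expected revenue of the item-wise mechanism. -/
theorem le_lintegral_sum_p_MIT (hmean : ∀ i j, Integrable (fun z : ℝ => z) (I.DB i j)) :
    ∑ j, ∫⁻ w, virtualSurplus I (virtualCosts I w.2) w.1 j ∂I.dist +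
      ∑ j, ∫⁻ w, virtualCosts I w.2 j *
        ENNReal.ofReal ((MIT I).sold (virtualCosts I w.2) w.1 j) ∂I.dist ≤
      ∑ i, ∫⁻ w, ENNReal.ofReal ((MIT I).p (virtualCosts I w.2) w.1 i) ∂I.dist := by
  classical
  have hS : ∀ i j, MeasurableSet (itemwiseSet I i j) := measurableSet_itemwiseSet
  have hPm : ∀ i j, Measurable fun w => (itemwiseSet I i j).indicator
      (fun w => ENNReal.ofReal (ITPrice I (virtualCosts I w.2) w.1 i j)) w := by
    intro i j
    have h := (measurable_ITPrice I i j).comp (measurable_costs_profile I)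
    exact h.ennreal_ofReal.indicator (hS i j)
  have hψm : ∀ i j, Measurable fun w => (itemwiseSet I i j).indicator
      (fun w => posVirtual (I.DB i j) (w.1 i j)) w := fun i j =>
    (measurable_profile_posVirtual I i j).indicator (hS i j)
  have hind : ∀ i j w (f : BProfile n m × SProfile m → ℝ≥0∞),
      (if ITWins I (virtualCosts I w.2) w.1 i j then f w else 0) =
        (itemwiseSet I i j).indicator f w := fun i j w f => by
    simp only [indicator_apply, itemwiseSet, mem_ofPred_eq]
  calc _ = ∑ j, ∫⁻ w, (virtualSurplus I (virtualCosts I w.2) w.1 j + virtualCosts I w.2 j *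
        ENNReal.ofReal ((MIT I).sold (virtualCosts I w.2) w.1 j)) ∂I.dist := by
        rw [← Finset.sum_add_distrib]
        exact Finset.sum_congr rfl fun j _ =>
          (lintegral_add_left (measurable_profile_virtualSurplus j) _).symm
    _ ≤ ∑ j, ∫⁻ w, ∑ i, (itemwiseSet I i j).indicator
          (fun w => posVirtual (I.DB i j) (w.1 i j)) w ∂I.dist := by
        refine Finset.sum_le_sum fun j _ => lintegral_mono fun w => ?_
        refine virtualSurplus_add_le_sum.trans (le_of_eq ?_)
        exact Finset.sum_congr rfl fun i _ =>
          hind i j w fun w => posVirtual (I.DB i j) (w.1 i j)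
    _ = ∑ j, ∑ i, ∫⁻ w in itemwiseSet I i j, posVirtual (I.DB i j) (w.1 i j) ∂I.dist := by
        refine Finset.sum_congr rfl fun j _ => ?_
        rw [lintegral_finsetSum _ fun i _ => hψm i j]
        exact Finset.sum_congr rfl fun i _ => lintegral_indicator (hS i j) _
    _ ≤ ∑ j, ∑ i, ∫⁻ w in itemwiseSet I i j,
          ENNReal.ofReal (ITPrice I (virtualCosts I w.2) w.1 i j) ∂I.dist :=
        Finset.sum_le_sum fun j _ => Finset.sum_le_sum fun i _ =>
          setLIntegral_posVirtual_le_price hmean i j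
    _ = _ := by
        rw [Finset.sum_comm]
        refine Finset.sum_congr rfl fun i _ => ?_
        simp only [ofReal_p_MIT]
        have h : ∀ w : BProfile n m × SProfile m,
            (∑ j, if ITWins I (virtualCosts I w.2) w.1 i j then
              ENNReal.ofReal (ITPrice I (virtualCosts I w.2) w.1 i j) else 0) =
            ∑ j, (itemwiseSet I i j).indicator
              (fun w => ENNReal.ofReal (ITPrice I (virtualCosts I w.2) w.1 i j)) w := fun w =>
          Finset.sum_congr rfl fun j _ =>
            hind i j w fun w => ENNReal.ofReal (ITPrice I (virtualCosts I w.2) w.1 i j)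
        rw [lintegral_congr h, lintegral_finsetSum _ fun j _ => hPm i j]
        exact Finset.sum_congr rfl fun j _ => (lintegral_indicator (hS i j) _).symm

open Classical in
/-- The revenue of the bundling VCG mechanism at each profile. -/
theorem le_sum_p_MBVCG (I : Market n m) (c : Costs m) (v : BProfile n m) :
    (∑ i, if Accepts I c v i then ENNReal.ofReal (entryFee I c v i) else 0) +
      ∑ j, c j * ENNReal.ofReal ((MBVCG I).sold c v j) ≤
      ∑ i, ENNReal.ofReal ((MBVCG I).p c v i) := by
  have hsold : ∀ j, c j * ENNReal.ofReal ((MBVCG I).sold c v j) =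
      ∑ i, if BVCGWins I c v i j then c j else 0 := by
    intro j
    unfold CostMechanism.sold
    rw [ENNReal.ofReal_sum_of_nonneg fun i _ => x_MBVCG_nonneg, Finset.mul_sum]
    refine Finset.sum_congr rfl fun i _ => ?_
    unfold MBVCG
    dsimp only
    split_ifs <;> simp
  simp only [hsold]
  rw [Finset.sum_comm, ← Finset.sum_add_distrib]
  refine Finset.sum_le_sum fun i _ => ?_
  unfold MBVCG
  dsimp only
  by_cases ha : Accepts I c v i
  · rw [if_pos ha, if_pos ha, ENNReal.ofReal_add entryFee_nonneg (Finset.sum_nonneg fun j _ => by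
      split_ifs; exacts [ENNReal.toReal_nonneg, le_rfl]),
      ENNReal.ofReal_sum_of_nonneg fun j _ => by
        split_ifs; exacts [ENNReal.toReal_nonneg, le_rfl]]
    gcongr with j _
    split_ifs with hw
    · rw [ENNReal.ofReal_toReal (ne_top_of_le_ne_top ENNReal.ofReal_ne_top hw.2.2)]
      exact cost_le_reserve
    · simp
  · rw [if_neg ha, if_neg ha]
    have : ∀ j, ¬ BVCGWins I c v i j := fun j hj => ha hj.1
    simp [this]

/-- The expected revenue of the bundling VCG mechanism. -/
theorem le_lintegral_sum_p_MBVCG (I : Market n m) :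
    ∑ i, ∫⁻ w in acceptSet I i, ENNReal.ofReal (entryFee I (virtualCosts I w.2) w.1 i) ∂I.dist +
      ∑ j, ∫⁻ w, virtualCosts I w.2 j *
        ENNReal.ofReal ((MBVCG I).sold (virtualCosts I w.2) w.1 j) ∂I.dist ≤
      ∑ i, ∫⁻ w, ENNReal.ofReal ((MBVCG I).p (virtualCosts I w.2) w.1 i) ∂I.dist := by
  classical
  have he : ∀ i, Measurable fun w => (acceptSet I i).indicator
      (fun w => ENNReal.ofReal (entryFee I (virtualCosts I w.2) w.1 i)) w := fun i =>
    (measurable_profile_entryFee i).ennreal_ofReal.indicator (measurableSet_acceptSet i)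
  have hcs : ∀ j, Measurable fun w : BProfile n m × SProfile m => virtualCosts I w.2 j *
      ENNReal.ofReal ((MBVCG I).sold (virtualCosts I w.2) w.1 j) := fun j =>
    (measurable_profile_cost I j).mul (measurable_profile_MBVCG_sold j).ennreal_ofReal
  have hp : ∀ i, Measurable fun w : BProfile n m × SProfile m =>
      ENNReal.ofReal ((MBVCG I).p (virtualCosts I w.2) w.1 i) := by
    intro i
    have h := (measurable_MBVCG_p I i).comp (measurable_costs_profile I)
    exact h.ennreal_ofReal
  have heq : ∀ i, ∫⁻ w in acceptSet I i,
      ENNReal.ofReal (entryFee I (virtualCosts I w.2) w.1 i) ∂I.dist =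
      ∫⁻ w, (acceptSet I i).indicator
        (fun w => ENNReal.ofReal (entryFee I (virtualCosts I w.2) w.1 i)) w ∂I.dist := fun i =>
    (lintegral_indicator (measurableSet_acceptSet i) _).symm
  simp only [heq]
  rw [← lintegral_finsetSum _ fun i _ => he i, ← lintegral_finsetSum _ fun j _ => hcs j,
    ← lintegral_finsetSum _ fun i _ => hp i,
    ← lintegral_add_left (Finset.measurable_fun_sum _ fun i _ => he i)]
  refine lintegral_mono fun w => le_of_eq_of_le ?_ (le_sum_p_MBVCG I (virtualCosts I w.2) w.1)
  congr 1

theorem four_mul_ofReal_mix {a b : ℝ} (ha : 0 ≤ a) (hb : 0 ≤ b) :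
    4 * ENNReal.ofReal (3 / 4 * a + 1 / 4 * b) = 3 * ENNReal.ofReal a + ENNReal.ofReal b := by
  have h4 : (4 : ℝ≥0∞) = ENNReal.ofReal 4 := by simp
  have h3 : (3 : ℝ≥0∞) = ENNReal.ofReal 3 := by simp
  rw [h4, h3, ← ENNReal.ofReal_mul (by norm_num), ← ENNReal.ofReal_mul (by norm_num),
    ← ENNReal.ofReal_add (by positivity) hb]
  congr 1
  ring

/-- The expected revenue of the two-sided mechanism. -/
theorem le_lintegral_sum_reduction_pB (hmean : ∀ i j, Integrable (fun z : ℝ => z) (I.DB i j)) :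
    3 * ∑ j, ∫⁻ w, virtualSurplus I (virtualCosts I w.2) w.1 j ∂I.dist +
      ∑ i, ∫⁻ w in acceptSet I i, ENNReal.ofReal (entryFee I (virtualCosts I w.2) w.1 i) ∂I.dist +
      4 * ∑ j, ∫⁻ w, ENNReal.ofReal ((reduction I (MA I)).pS w.1 w.2 j) ∂I.dist ≤
      4 * ∑ i, ∫⁻ w, ENNReal.ofReal ((reduction I (MA I)).pB w.1 w.2 i) ∂I.dist := by
  have hpIT : ∀ i, Measurable fun w : BProfile n m × SProfile m =>
      ENNReal.ofReal ((MIT I).p (virtualCosts I w.2) w.1 i) := by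
    intro i
    have h := (measurable_MIT_p I i).comp (measurable_costs_profile I)
    exact h.ennreal_ofReal
  have hcs : ∀ j, Measurable fun w : BProfile n m × SProfile m => virtualCosts I w.2 j *
      ENNReal.ofReal ((MIT I).sold (virtualCosts I w.2) w.1 j) := fun j =>
    (measurable_profile_cost I j).mul (measurable_profile_MIT_sold j).ennreal_ofReal
  have hcA : ∀ j, Measurable fun w : BProfile n m × SProfile m => virtualCosts I w.2 j *
      ENNReal.ofReal ((MA I).sold (virtualCosts I w.2) w.1 j) := fun j =>
    (measurable_profile_cost I j).mul (measurable_reduction_xS I j).ennreal_ofReal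
  have hpB : ∀ i, 4 * ∫⁻ w, ENNReal.ofReal ((reduction I (MA I)).pB w.1 w.2 i) ∂I.dist =
      3 * ∫⁻ w, ENNReal.ofReal ((MIT I).p (virtualCosts I w.2) w.1 i) ∂I.dist +
        ∫⁻ w, ENNReal.ofReal ((MBVCG I).p (virtualCosts I w.2) w.1 i) ∂I.dist := by
    intro i
    rw [← lintegral_const_mul _ (hpIT i), ← lintegral_add_left ((hpIT i).const_mul 3)]
    refine (lintegral_const_mul 4 (measurable_reduction_pB I i).ennreal_ofReal).symm.trans
      (lintegral_congr fun w => ?_)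
    rw [← four_mul_ofReal_mix p_MIT_nonneg p_MBVCG_nonneg, ← p_MA]
  have hsold : ∀ j, 4 * ∫⁻ w, virtualCosts I w.2 j *
        ENNReal.ofReal ((MA I).sold (virtualCosts I w.2) w.1 j) ∂I.dist =
      3 * ∫⁻ w, virtualCosts I w.2 j *
        ENNReal.ofReal ((MIT I).sold (virtualCosts I w.2) w.1 j) ∂I.dist +
      ∫⁻ w, virtualCosts I w.2 j *
        ENNReal.ofReal ((MBVCG I).sold (virtualCosts I w.2) w.1 j) ∂I.dist := by
    intro j
    rw [← lintegral_const_mul _ (hcs j), ← lintegral_add_left ((hcs j).const_mul 3),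
      ← lintegral_const_mul _ (hcA j)]
    refine lintegral_congr fun w => ?_
    rw [mul_left_comm, sold_MA, four_mul_ofReal_mix sold_MIT_mem.1 sold_MBVCG_mem.1]
    ring
  calc _ ≤ 3 * ∑ j, ∫⁻ w, virtualSurplus I (virtualCosts I w.2) w.1 j ∂I.dist +
        ∑ i, ∫⁻ w in acceptSet I i,
          ENNReal.ofReal (entryFee I (virtualCosts I w.2) w.1 i) ∂I.dist +
        4 * ∑ j, ∫⁻ w, virtualCosts I w.2 j *
          ENNReal.ofReal ((MA I).sold (virtualCosts I w.2) w.1 j) ∂I.dist := by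
        gcongr 3 * _ + _ + 4 * ?_
        exact Finset.sum_le_sum fun j _ => lintegral_reduction_pS_le I j
    _ = 3 * (∑ j, ∫⁻ w, virtualSurplus I (virtualCosts I w.2) w.1 j ∂I.dist +
          ∑ j, ∫⁻ w, virtualCosts I w.2 j *
            ENNReal.ofReal ((MIT I).sold (virtualCosts I w.2) w.1 j) ∂I.dist) +
        (∑ i, ∫⁻ w in acceptSet I i,
          ENNReal.ofReal (entryFee I (virtualCosts I w.2) w.1 i) ∂I.dist +
          ∑ j, ∫⁻ w, virtualCosts I w.2 j *
            ENNReal.ofReal ((MBVCG I).sold (virtualCosts I w.2) w.1 j) ∂I.dist) := by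
        have h : 4 * ∑ j, ∫⁻ w, virtualCosts I w.2 j *
              ENNReal.ofReal ((MA I).sold (virtualCosts I w.2) w.1 j) ∂I.dist =
            3 * ∑ j, ∫⁻ w, virtualCosts I w.2 j *
              ENNReal.ofReal ((MIT I).sold (virtualCosts I w.2) w.1 j) ∂I.dist +
            ∑ j, ∫⁻ w, virtualCosts I w.2 j *
              ENNReal.ofReal ((MBVCG I).sold (virtualCosts I w.2) w.1 j) ∂I.dist := by
          rw [Finset.mul_sum, Finset.mul_sum, ← Finset.sum_add_distrib]
          exact Finset.sum_congr rfl fun j _ => hsold j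
        rw [h]
        ring
    _ ≤ 3 * ∑ i, ∫⁻ w, ENNReal.ofReal ((MIT I).p (virtualCosts I w.2) w.1 i) ∂I.dist +
        ∑ i, ∫⁻ w, ENNReal.ofReal ((MBVCG I).p (virtualCosts I w.2) w.1 i) ∂I.dist := by
        refine add_le_add ?_ (le_lintegral_sum_p_MBVCG I)
        gcongr
        exact le_lintegral_sum_p_MIT hmean
    _ = _ := by
        rw [Finset.mul_sum, Finset.mul_sum, ← Finset.sum_add_distrib]
        exact Finset.sum_congr rfl fun i _ => (hpB i).symm

/-! ### The comparison -/

/-- Payments to the sellers are nonnegative and sum to revenue minus profit; the revenue is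
integrable by individual rationality and the profit by assumption. -/
theorem integrable_pS {M : Mechanism n m} (hM : M.Admissible I)
    (hmean : ∀ i j, Integrable (fun z : ℝ => z) (I.DB i j)) (j : Fin m) :
    Integrable (fun w : BProfile n m × SProfile m => M.pS w.1 w.2 j) I.dist := by
  have hB : Integrable (fun w : BProfile n m × SProfile m => ∑ i, M.pB w.1 w.2 i) I.dist :=
    integrable_finsetSum _ fun i _ => integrable_pB hM.wellFormed hM.ir hmean i
  refine Integrable.mono' (hB.sub hM.integrable) (hM.wellFormed.meas_pS j).aestronglyMeasurable ?_
  filter_upwards [ae_mem_TB_TS I] with w hw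
  have h0 := fun j => hM.wellFormed.pS_nonneg _ hw.1 _ hw.2 j
  rw [Real.norm_of_nonneg (h0 j)]
  simp only [Pi.sub_apply, Mechanism.profit, sub_sub_cancel]
  exact Finset.single_le_sum (f := fun j => M.pS w.1 w.2 j) (fun j _ => h0 j) (Finset.mem_univ j)

/-- The expected profit as a difference of expected payments. -/
theorem PFT_eq {M : Mechanism n m} (hM : M.Admissible I)
    (hmean : ∀ i j, Integrable (fun z : ℝ => z) (I.DB i j)) :
    ∑ i, ∫⁻ w, ENNReal.ofReal (M.pB w.1 w.2 i) ∂I.dist ≠ ⊤ ∧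
    ∑ j, ∫⁻ w, ENNReal.ofReal (M.pS w.1 w.2 j) ∂I.dist ≠ ⊤ ∧
    M.PFT I = (∑ i, ∫⁻ w, ENNReal.ofReal (M.pB w.1 w.2 i) ∂I.dist).toReal -
      (∑ j, ∫⁻ w, ENNReal.ofReal (M.pS w.1 w.2 j) ∂I.dist).toReal := by
  have hB := fun i => integrable_pB hM.wellFormed hM.ir hmean i
  have hS := fun j => integrable_pS hM hmean j
  have hBt : ∀ i, ∫⁻ w, ENNReal.ofReal (M.pB w.1 w.2 i) ∂I.dist ≠ ⊤ := fun i =>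
    (hB i).lintegral_lt_top.ne
  have hSt : ∀ j, ∫⁻ w, ENNReal.ofReal (M.pS w.1 w.2 j) ∂I.dist ≠ ⊤ := fun j =>
    (hS j).lintegral_lt_top.ne
  refine ⟨ENNReal.sum_ne_top.2 fun i _ => hBt i, ENNReal.sum_ne_top.2 fun j _ => hSt j, ?_⟩
  rw [ENNReal.toReal_sum fun i _ => hBt i, ENNReal.toReal_sum fun j _ => hSt j]
  unfold Mechanism.PFT Mechanism.profit
  rw [integral_sub (integrable_finsetSum _ fun i _ => hB i)
    (integrable_finsetSum _ fun j _ => hS j), integral_finsetSum _ fun i _ => hB i,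
    integral_finsetSum _ fun j _ => hS j]
  congr 1
  · refine Finset.sum_congr rfl fun i _ => integral_eq_lintegral_of_nonneg_ae ?_ (hB i).1
    filter_upwards [ae_mem_TB_TS I] with w hw
    exact hM.wellFormed.pB_nonneg _ hw.1 _ hw.2 i
  · refine Finset.sum_congr rfl fun j _ => integral_eq_lintegral_of_nonneg_ae ?_ (hS j).1
    filter_upwards [ae_mem_TB_TS I] with w hw
    exact hM.wellFormed.pS_nonneg _ hw.1 _ hw.2 j

/-- Writing R, P for revenue and payments of `M` and R', P' for those of the reduction: R - P ≤ 5K +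
2E ≤ 2(3K + E) ≤ 8(R' - P'). The revenue bound 4R' also shows that K and E are finite, so the
extended inequalities can be subtracted as real ones. -/
theorem PFT_le {M : Mechanism n m} (hM : M.Admissible I)
    (hmean : ∀ i j, Integrable (fun z : ℝ => z) (I.DB i j)) :
    M.PFT I ≤ 8 * (reduction I (MA I)).PFT I := by
  obtain ⟨hR, hP, hPFT⟩ := PFT_eq hM hmean
  obtain ⟨hR', hP', hPFT'⟩ := PFT_eq (admissible_reduction I hmean) hmean
  have hup := lintegral_sum_pB_le hM hmean
  have hlow := le_lintegral_sum_reduction_pB hmean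
  rw [hPFT, hPFT']
  generalize ∑ i, ∫⁻ w, ENNReal.ofReal (M.pB w.1 w.2 i) ∂I.dist = R at *
  generalize ∑ j, ∫⁻ w, ENNReal.ofReal (M.pS w.1 w.2 j) ∂I.dist = P at *
  generalize ∑ i, ∫⁻ w, ENNReal.ofReal ((reduction I (MA I)).pB w.1 w.2 i) ∂I.dist = R' at *
  generalize ∑ j, ∫⁻ w, ENNReal.ofReal ((reduction I (MA I)).pS w.1 w.2 j) ∂I.dist = P' at *
  generalize ∑ j, ∫⁻ w, virtualSurplus I (virtualCosts I w.2) w.1 j ∂I.dist = K at *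
  generalize ∑ i, ∫⁻ w in acceptSet I i,
    ENNReal.ofReal (entryFee I (virtualCosts I w.2) w.1 i) ∂I.dist = E at *
  have htop : 3 * K + E + 4 * P' ≠ ⊤ :=
    ne_top_of_le_ne_top (ENNReal.mul_ne_top ENNReal.ofNat_ne_top hR') hlow
  have hK : K ≠ ⊤ := by
    rintro rfl
    simp at htop
  have hE : E ≠ ⊤ := by
    rintro rfl
    simp at htop
  have h1 := ENNReal.toReal_mono (by finiteness) hup
  have h2 := ENNReal.toReal_mono (by finiteness) hlow
  rw [ENNReal.toReal_add (by finiteness) (by finiteness),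
    ENNReal.toReal_add (by finiteness) (by finiteness), ENNReal.toReal_mul,
    ENNReal.toReal_mul] at h1
  rw [ENNReal.toReal_add (by finiteness) (by finiteness),
    ENNReal.toReal_add (by finiteness) (by finiteness), ENNReal.toReal_mul,
    ENNReal.toReal_mul, ENNReal.toReal_mul] at h2
  simp only [ENNReal.toReal_ofNat] at h1 h2
  have hK0 : 0 ≤ K.toReal := ENNReal.toReal_nonneg
  linarith

end

end Broker

theorem theorem2 {n m : ℕ} (I : Broker.Market n m)
    (hmean : ∀ i j, MeasureTheory.Integrable (fun z : ℝ => z) (I.DB i j)) :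
    (Broker.MIT I).CostMonotone I ∧
    (Broker.MBVCG I).CostMonotone I ∧
    (Broker.MA I).CostMonotone I ∧
    (Broker.reduction I (Broker.MA I)).Admissible I ∧
    Broker.OPT I ≤ (((8 : ℝ) * (Broker.reduction I (Broker.MA I)).PFT I : ℝ) : EReal) := by
  refine ⟨fun c c' j hj _ v _ => Broker.sold_MIT_anti I hj v,
    fun c c' j hj hk v _ => Broker.sold_MBVCG_anti I hj hk v,
    fun c c' j hj hk v _ => Broker.sold_MA_anti I hj hk v,
    Broker.admissible_reduction I hmean, ?_⟩
  exact iSup₂_le fun M hM => EReal.coe_le_coe_iff.2 (Broker.PFT_le hM hmean)
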